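/- Let $\mathcal P$ be a finite dimensional commutative unital real algebra with a unital algebra homomorphism ${}^\#:\mathcal P\to\mathbb R$ (the body map) whose kernel $\mathcal I$ is nilpotent, and let $\mathcal P^{\mathbb C}=\mathbb C\otimes_{\mathbb R}\mathcal P$, with the induced body map ${}^\#:\mathcal P^{\mathbb C}\to\mathbb C$. Let $H\subset\mathbb C$ be the upper half plane and $\mathcal O(H)$ the space of holomorphic functions on $H$; the body map extends to $\mathcal O(H)\otimes_{\mathbb C}\mathcal P^{\mathbb C}\to\mathcal O(H)$. A $\mathcal P$-point of $H$ is an $a\in\mathcal P^{\mathbb C}$ with $a^\#\in H$, and $f\in\mathcal O(H)\otimes\mathcal P^{\mathbb C}$ is evaluated at $a$ by the $\mathcal P^{\mathbb C}$-linear extension of the finite Taylor expansion $h(a)=\sum_n \frac1{n!}h^{(n)}(a^\#)(a-a^\#)^n$, $h\in\mathcal O(H)$. Let $\Upsilon$ be a $\mathcal P$-lattice of $SL(2,\mathbb R)$, that is, a subgroup of $SL(2,\mathcal P)$ on which the (entrywise) body map is injective and whose image $\Gamma=\Upsilon^\#$ is a lattice in $SL(2,\mathbb R)$ (a discrete subgroup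 of finite covolume). Let $k\in\mathbb N=\{0,1,2,\dots\}$. For $\gamma=\begin{pmatrix}a&b\\c&d\end{pmatrix}\in SL(2,\mathcal P)$ put $f|_\gamma(z)=f\big((az+b)(cz+d)^{-1}\big)(cz+d)^{-k}$. Let $\gamma\in\Upsilon$ and $g\in SL(2,\mathbb R)$ be such that $g^{-1}\gamma^\#g=\begin{pmatrix}1&1\\0&1\end{pmatrix}$ (the points $g\infty$ so obtained are precisely the representatives of the cusps of $\Gamma\backslash H$). There are a unique $\chi\in\mathfrak{sl}(2,\mathcal P)$ with body $\begin{pmatrix}0&1\\0&0\end{pmatrix}$ and $\exp\chi=g^{-1}\gamma g$, and an $\Omega\in\mathcal O(H)\otimes\mathcal P^{\mathbb C}$, unique up to replacing it by $\Omega(z+a)$, $a\in\mathcal I\otimes\mathbb C$, with $\Omega^\#(z)=z$ and $\Omega(z+t)=\exp(t\chi)\,\Omega(z)$ (Möbius action) for all $t\in\mathbb R$. A function $f\in\mathcal O(H)\otimes\mathcal P^{\mathbb C}$ with $f|_\gamma=f$ is called bounded (vanishing) at the cusp $g\infty$ if $f|_g(\Omega(z))\,\Omega'(z)^{k/2}$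 is bounded (tends to $0$) as $\operatorname{Im}z\to\infty$; here the power of $\Omega'$, which has body $1$, is given by the binomial series. The space $M_k(\Upsilon)$ (respectively $S_k(\Upsilon)$) of automorphic (respectively cusp) forms of weight $k$ is the $\mathcal P^{\mathbb C}$-module of all $f\in\mathcal O(H)\otimes\mathcal P^{\mathbb C}$ with $f|_\gamma=f$ for all $\gamma\in\Upsilon$ that are bounded (respectively vanishing) at all cusps. $M_k(\Gamma)$ and $S_k(\Gamma)$ denote the classical spaces of automorphic and cusp forms of weight $k$ for $\Gamma$. **Theorem.** $M_k(\Gamma)$ and $M_k(\Upsilon)$ are finite dimensional over $\mathbb C$, $$\dim_{\mathbb C} M_k(\Gamma)\le\dim_{\mathbb C} M_k(\Upsilon)\le\dim_{\mathbb C} M_k(\Gamma)\cdot\dim_{\mathbb R}\mathcal P,$$ and the following are equivalent: (i) $\dim_{\mathbb C} M_k(\Upsilon)=\dim_{\mathbb C} M_k(\Gamma)\cdot\dim_{\mathbb R}\mathcal P$; (ii) there exist $f_1,\dots,f_r\in M_k(\Upsilon)$ such that $(f_1^\#,\dots,f_r^\#)$ is a basis of $M_k(\Gamma)$; (iii) $M_k(\Upsilon)$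 is a free $\mathcal P^{\mathbb C}$-module of rank $\dim_{\mathbb C}M_k(\Gamma)$. Furthermore, whenever $f_1,\dots,f_r\in M_k(\Upsilon)$ are such that $(f_1^\#,\dots,f_r^\#)$ is a basis of $M_k(\Gamma)$, then $(f_1,\dots,f_r)$ is a $\mathcal P^{\mathbb C}$-basis of $M_k(\Upsilon)$. The same statements hold with $S_k(\Gamma)$, $S_k(\Upsilon)$ in place of $M_k(\Gamma)$, $M_k(\Upsilon)$. -/

import Mathlib

open Matrix UpperHalfPlane TensorProduct
open scoped MatrixGroups ModularForm Manifold

noncomputable section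

namespace PLattice

/-- A parameter algebra: a finite dimensional commutative unital real algebra `P` with a unital
algebra projection `body : P → ℝ` whose kernel is nilpotent (it is then the unique maximal ideal
of `P`). -/
class ParameterAlgebra (P : Type*) [CommRing P] [Algebra ℝ P] where
  finite : Module.Finite ℝ P
  body : P →ₐ[ℝ] ℝ
  nilpotent : IsNilpotent (RingHom.ker body)

/-- The complexification `ℂ ⊗ P` of `P`. -/
abbrev PC (P : Type*) [CommRing P] [Algebra ℝ P] : Type _ := ℂ ⊗[ℝ] P

/-- The space `𝒪(ℍ)` of holomorphic functions on the upper half plane. -/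
def Hol : Submodule ℂ (ℍ → ℂ) where
  carrier := {h | MDiff h}
  zero_mem' := mdifferentiable_const
  add_mem' h₁ h₂ := h₁.add h₂
  smul_mem' c _ h := h.const_smul c

/-- `𝒪(ℍ) ⊗ P^ℂ`, as a module over `P^ℂ`: the `P`-holomorphic functions on `ℍ`. -/
abbrev PHol (P : Type*) [CommRing P] [Algebra ℝ P] : Type _ := PC P ⊗[ℂ] Hol

lemma contDiffAt_of_hol (h : Hol) (n : ℕ) (τ : ℍ) :
    ContDiffAt ℂ n ((h : ℍ → ℂ) ∘ ofComplex) (τ : ℂ) := by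
  have hd := UpperHalfPlane.mdifferentiable_iff.mp h.2
  exact (hd.contDiffOn isOpen_upperHalfPlaneSet).contDiffAt
    (isOpen_upperHalfPlaneSet.mem_nhds τ.im_pos)

/-- The `n`-th complex derivative of a holomorphic function at `τ`. -/
def derivAt (n : ℕ) (τ : ℍ) : Hol →ₗ[ℂ] ℂ where
  toFun h := iteratedDeriv n ((h : ℍ → ℂ) ∘ ofComplex) (τ : ℂ)
  map_add' h₁ h₂ := iteratedDeriv_add (contDiffAt_of_hol h₁ n τ) (contDiffAt_of_hol h₂ n τ)
  map_smul' c h := iteratedDeriv_const_smul_field c ((h : ℍ → ℂ) ∘ ofComplex)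

/-- The real weight `k` slash action `(h|_g)(z) = h(gz) (cz+d)^{-k}` on `𝒪(ℍ)`. -/
def slashHol (k : ℕ) (g : SL(2, ℝ)) : Hol →ₗ[ℂ] Hol where
  toFun h := ⟨(h : ℍ → ℂ) ∣[(k : ℤ)] SpecialLinearGroup.mapGL ℝ g, MDifferentiable.slash h.2 _ _⟩
  map_add' h₁ h₂ := Subtype.ext (SlashAction.add_slash _ _ _ _)
  map_smul' c h := Subtype.ext (by
    simp [ModularForm.smul_slash, UpperHalfPlane.σ])

section Algebra

variable {P : Type*} [CommRing P] [Algebra ℝ P]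

/-- The inclusion `P → P^ℂ`. -/
def incl : P →ₐ[ℝ] PC P := Algebra.TensorProduct.includeRight

/-- Möbius transformation of an element of `P^ℂ` by a matrix over `P`. -/
def mobius (M : Matrix (Fin 2) (Fin 2) P) (a : PC P) : PC P :=
  (incl (M 0 0) * a + incl (M 0 1)) * Ring.inverse (incl (M 1 0) * a + incl (M 1 1))

/-- The factor `j(g, z) = (c z + d)⁻¹`. -/
def jFactor (M : Matrix (Fin 2) (Fin 2) P) (a : PC P) : PC P :=
  Ring.inverse (incl (M 1 0) * a + incl (M 1 1))

/-- Exponential of a nilpotent matrix over `P`. -/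
def nilExp (M : Matrix (Fin 2) (Fin 2) P) : Matrix (Fin 2) (Fin 2) P :=
  ∑ n ∈ Finset.range (nilpotencyClass M), ((n.factorial : ℝ)⁻¹) • M ^ n

/-- The power `x ^ r`, `r ∈ ℝ`, of an element `x` with `x - 1` nilpotent, by the binomial series. -/
def unipotentPow (x : PC P) (r : ℝ) : PC P :=
  ∑ n ∈ Finset.range (nilpotencyClass (x - 1)),
    ((∏ i ∈ Finset.range n, (r - i)) / (n.factorial : ℝ)) • (x - 1) ^ n

/-- Value of a `P`-holomorphic function at an ordinary point of `ℍ`. -/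
def eval (z : ℍ) : PHol P →ₗ[PC P] PC P :=
  (Algebra.linearMap ℂ (PC P) ∘ₗ derivAt 0 z).liftBaseChange (PC P)

/-- Value at `z` of the complex derivative of a `P`-holomorphic function. -/
def evalDeriv (z : ℍ) : PHol P →ₗ[PC P] PC P :=
  (Algebra.linearMap ℂ (PC P) ∘ₗ derivAt 1 z).liftBaseChange (PC P)

/-- Value of a `P`-holomorphic function at the `P`-point `a` of `ℍ` with body `τ`, that is, the
`P^ℂ`-linear extension of the formal Taylor expansion
`h(a) = ∑ₙ h⁽ⁿ⁾(τ) / n! · (a - τ)ⁿ`, `h ∈ 𝒪(ℍ)`; the sum is finite as `a - τ` is nilpotent. -/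
def evalPPoint (τ : ℍ) (a : PC P) : PHol P →ₗ[PC P] PC P :=
  (∑ n ∈ Finset.range (nilpotencyClass (a - algebraMap ℂ (PC P) τ)),
    LinearMap.toSpanSingleton ℂ (PC P) ((a - algebraMap ℂ (PC P) τ) ^ n) ∘ₗ
      (((n.factorial : ℂ)⁻¹) • derivAt n τ)).liftBaseChange (PC P)

/-- The action `f ↦ f|_g` of a real matrix `g` on `P`-holomorphic functions. -/
def slashReal (k : ℕ) (g : SL(2, ℝ)) : PHol P →ₗ[PC P] PHol P :=
  (slashHol k g).baseChange (PC P)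

/-- Boundedness of a `P^ℂ`-valued function as `Im z → ∞`. -/
def IsBoundedAtInfty (F : ℍ → PC P) : Prop :=
  ∀ l : PC P →ₗ[ℂ] ℂ, IsBoundedAtImInfty (fun z => l (F z))

/-- Vanishing of a `P^ℂ`-valued function as `Im z → ∞`. -/
def IsZeroAtInfty (F : ℍ → PC P) : Prop :=
  ∀ l : PC P →ₗ[ℂ] ℂ, IsZeroAtImInfty (fun z => l (F z))

/-- The function `(f|_g)|_Ω (z) = f|_g(Ω z) Ω'(z)^{k/2}`, for a `P`-automorphism `Ω` of `ℍ` with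
body the identity. -/
def slashSlash (k : ℕ) (g : SL(2, ℝ)) (Ω f : PHol P) (z : ℍ) : PC P :=
  evalPPoint z (eval z Ω) (slashReal k g f) * unipotentPow (evalDeriv z Ω) ((k : ℝ) / 2)

end Algebra

/-- The body map `P^ℂ → ℂ`. -/
def bodyC (P : Type*) [CommRing P] [Algebra ℝ P] [ParameterAlgebra P] : PC P →ₐ[ℂ] ℂ :=
  Algebra.TensorProduct.lift (AlgHom.id ℂ ℂ)
    ((Algebra.ofId ℝ ℂ).comp (ParameterAlgebra.body (P := P))) (fun _ _ => Commute.all _ _)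

/-- The body map `SL(2, P) → SL(2, ℝ)`. The `P`-points of the Lie group `SL(2, ℝ)` are the
matrices of determinant one with entries in `P`. -/
def bodySL (P : Type*) [CommRing P] [Algebra ℝ P] [ParameterAlgebra P] : SL(2, P) →* SL(2, ℝ) :=
  SpecialLinearGroup.map ((ParameterAlgebra.body (P := P)) : P →+* ℝ)

/-- The translation `z ↦ z + 1`. -/
def translation : SL(2, ℝ) := ⟨!![1, 1; 0, 1], by simp [Matrix.det_fin_two]⟩

/-- A lattice in `SL(2, ℝ)`: a discrete subgroup of finite covolume with respect to Haar measure. -/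
def IsLattice (Γ : Subgroup SL(2, ℝ)) : Prop :=
  DiscreteTopology Γ ∧
    letI : MeasurableSpace SL(2, ℝ) := borel _
    ∃ (μ : MeasureTheory.Measure SL(2, ℝ)) (s : Set SL(2, ℝ)),
      μ.IsHaarMeasure ∧ MeasureTheory.IsFundamentalDomain Γ s μ ∧ μ s < ⊤

section Forms

variable {P : Type*} [CommRing P] [Algebra ℝ P] [ParameterAlgebra P]

/-- A `P`-lattice of `SL(2, ℝ)`: a subgroup of `SL(2, P)` whose body is a lattice and on which the
body map is injective. -/
def IsPLattice (Υ : Subgroup SL(2, P)) : Prop :=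
  IsLattice (Υ.map (bodySL P)) ∧ Set.InjOn (bodySL P) (Υ : Set SL(2, P))

/-- The body `Γ` of `Υ`, as a subgroup of `GL(2, ℝ)`. -/
abbrev bodyGroup (Υ : Subgroup SL(2, P)) : Subgroup (GL (Fin 2) ℝ) :=
  (Υ.map (bodySL P)).map (SpecialLinearGroup.mapGL ℝ)

/-- The body of a `P`-holomorphic function. -/
def bodyForm (f : PHol P) (z : ℍ) : ℂ := bodyC P (eval z f)

/-- The value at `z` of `f|_γ`, namely `f(γ z) j(γ, z)^k`, for `γ ∈ SL(2, P)`. -/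
def slashAt (k : ℕ) (γ : SL(2, P)) (z : ℍ) : PHol P →ₗ[PC P] PC P :=
  jFactor γ.1 (algebraMap ℂ (PC P) z) ^ k •
    evalPPoint (bodySL P γ • z) (mobius γ.1 (algebraMap ℂ (PC P) z))

/-- The data in the definition of boundedness at a cusp: `γ` has parabolic body fixing `g ∞` and
`g⁻¹ γ^# g` is `z ↦ z + 1`; `χ ∈ sl(2, P)` is the logarithm of `g⁻¹ γ g` with body
`(0 1; 0 0)`; and `Ω` is a `P`-automorphism of `ℍ` with body the identity that conjugates the
translations `z ↦ z + t` to `exp (t χ)`. For given `γ` and `g`, such `χ` and `Ω` exist, `χ` is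
unique and `Ω` is unique up to a translation. -/
structure IsCuspDatum (γ : SL(2, P)) (g : SL(2, ℝ)) (χ : Matrix (Fin 2) (Fin 2) P)
    (Ω : PHol P) : Prop where
  conj_body : g⁻¹ * bodySL P γ * g = translation
  trace_eq : χ.trace = 0
  body_eq : χ.map (ParameterAlgebra.body (P := P)) = !![0, 1; 0, 0]
  exp_eq : nilExp χ = (SpecialLinearGroup.map (algebraMap ℝ P) g⁻¹ * γ *
    SpecialLinearGroup.map (algebraMap ℝ P) g).1
  bodyForm_eq : ∀ z : ℍ, bodyForm Ω z = z
  equivariant : ∀ (t : ℝ) (z : ℍ), eval (t +ᵥ z) Ω = mobius (nilExp (t • χ)) (eval z Ω)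

/-- The space `M_k(Υ)` of automorphic forms of weight `k` for `Υ`. -/
def autForms (k : ℕ) (Υ : Subgroup SL(2, P)) : Submodule (PC P) (PHol P) where
  carrier := {f | (∀ γ ∈ Υ, ∀ z, slashAt k γ z f = eval z f) ∧
    ∀ γ ∈ Υ, ∀ g χ Ω, IsCuspDatum γ g χ Ω → IsBoundedAtInfty (slashSlash k g Ω f)}
  zero_mem' := by
    refine ⟨fun γ _ z => by simp, fun γ _ g χ Ω _ l => ?_⟩
    simp only [slashSlash, map_zero, zero_mul]
    exact Filter.const_boundedAtFilter atImInfty (0 : ℂ)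
  add_mem' := by
    rintro f₁ f₂ ⟨h₁, h₁'⟩ ⟨h₂, h₂'⟩
    refine ⟨fun γ hγ z => by simp [h₁ γ hγ z, h₂ γ hγ z], fun γ hγ g χ Ω hΩ l => ?_⟩
    have := (h₁' γ hγ g χ Ω hΩ l).add (h₂' γ hγ g χ Ω hΩ l)
    have he : (fun z => l (slashSlash k g Ω (f₁ + f₂) z)) =
        (fun z => l (slashSlash k g Ω f₁ z)) + fun z => l (slashSlash k g Ω f₂ z) := by
      ext z
      simp [slashSlash, add_mul]
    rw [he]
    exact this
  smul_mem' := by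
    rintro p f ⟨h, h'⟩
    refine ⟨fun γ hγ z => by simp [h γ hγ z], fun γ hγ g χ Ω hΩ l => ?_⟩
    have := h' γ hγ g χ Ω hΩ (l ∘ₗ LinearMap.mulLeft ℂ p)
    convert this using 1
    ext z
    simp [slashSlash, mul_assoc]

/-- The space `S_k(Υ)` of cusp forms of weight `k` for `Υ`. -/
def cuspForms (k : ℕ) (Υ : Subgroup SL(2, P)) : Submodule (PC P) (PHol P) where
  carrier := {f | (∀ γ ∈ Υ, ∀ z, slashAt k γ z f = eval z f) ∧
    ∀ γ ∈ Υ, ∀ g χ Ω, IsCuspDatum γ g χ Ω → IsZeroAtInfty (slashSlash k g Ω f)}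
  zero_mem' := by
    refine ⟨fun γ _ z => by simp, fun γ _ g χ Ω _ l => ?_⟩
    simp only [slashSlash, map_zero, zero_mul]
    exact Filter.zero_zeroAtFilter (β := ℂ) atImInfty
  add_mem' := by
    rintro f₁ f₂ ⟨h₁, h₁'⟩ ⟨h₂, h₂'⟩
    refine ⟨fun γ hγ z => by simp [h₁ γ hγ z, h₂ γ hγ z], fun γ hγ g χ Ω hΩ l => ?_⟩
    have := (h₁' γ hγ g χ Ω hΩ l).add (h₂' γ hγ g χ Ω hΩ l)
    have he : (fun z => l (slashSlash k g Ω (f₁ + f₂) z)) =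
        (fun z => l (slashSlash k g Ω f₁ z)) + fun z => l (slashSlash k g Ω f₂ z) := by
      ext z
      simp [slashSlash, add_mul]
    rw [he]
    exact this
  smul_mem' := by
    rintro p f ⟨h, h'⟩
    refine ⟨fun γ hγ z => by simp [h γ hγ z], fun γ hγ g χ Ω hΩ l => ?_⟩
    have := h' γ hγ g χ Ω hΩ (l ∘ₗ LinearMap.mulLeft ℂ p)
    convert this using 1
    ext z
    simp [slashSlash, mul_assoc]

end Forms

end PLattice

end

open PLattice

noncomputable section

namespace PLattice

open Topology MeasureTheory Pointwise

/-! ### Thick part of a lattice: compactness modulo the group -/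

section Geometry

/-! The core is algebraic. Let `I` be the nilpotent ideal of elements of `P^ℂ` with body zero, `J`
any ideal, and `l` a ℂ-linear form vanishing on `I·J`. Then `l(px) = l(p)·x^#` for `p ∈ J`. So if
`f` has coefficients in `J`, then `l ∘ f` sees only the bodies of Möbius arguments, automorphy
factors, `Ω` and `Ω'`: twisting `f` by `γ` and applying `l` is the classical slash of `l ∘ f` by
`γ^#` (`apply_slashAt`, `apply_slashSlash`). Hence `l ∘ f` is a classical form whenever `f` is an
automorphic form with coefficients in `J`.

Since `I` is nilpotent, every nonzero `J` carries such an `l` that is nonzero on `J`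
(`exists_leading_form`), and its kernel in `J` is an ideal of codimension one. Descending from `J =
P^ℂ` to `0`, each of the `dim P` steps contributes at most `dim M_k(Γ)`; this is the upper bound
(`finrank_inf_coeffIn_le`). For the lower bound, take `p ≠ 0` with `I·p = 0`: then `p ⊗ h` is
automorphic for every classical `h`. Forms whose bodies are ℂ-independent are `P^ℂ`-independent
(`linearIndependent_of_body`, again by a leading form on the ideal of coefficients), so lifts of a
basis span by a dimension count. Conversely, equality in the upper bound forces the first step, the
body map, to be onto. `dimension_theorem` packages this once for both kinds of form.

Two inputs remain. The first is that the classical spaces are finite dimensional for an arbitrary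
lattice (`finite_modularForm`). Reduction theory (`exists_isCompact_cusps`) comes from a packing
argument with finite covolume and from the Zassenhaus commutator estimate; a form vanishing at the
cusps, and to high order at finitely many points, then violates the maximum principle for `|f|² y^k`
unless it is zero.

The second is that every cusp of `Γ` really has data `χ`, `Ω` (`exists_isCuspDatum`), since
otherwise the condition at that cusp would be empty. Here `χ` is a nilpotent logarithm and `Ω(z) =
exp(zχ)·0`. -/

instance locallyCompactSpace_SL2R : LocallyCompactSpace SL(2, ℝ) :=
  haveI : LocallyCompactSpace (Matrix (Fin 2) (Fin 2) ℝ) :=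
    inferInstanceAs (LocallyCompactSpace (Fin 2 → Fin 2 → ℝ))
  Matrix.SpecialLinearGroup.isClosedEmbedding_val.locallyCompactSpace

instance secondCountableTopology_SL2R : SecondCountableTopology SL(2, ℝ) :=
  haveI : SecondCountableTopology (Matrix (Fin 2) (Fin 2) ℝ) :=
    inferInstanceAs (SecondCountableTopology (Fin 2 → Fin 2 → ℝ))
  Matrix.SpecialLinearGroup.isClosedEmbedding_val.isEmbedding.secondCountableTopology

/-- The part of the group where a lattice has no nontrivial conjugates near the identity is
compact modulo the lattice. -/
theorem exists_isCompact_of_isLattice {Γ : Subgroup SL(2, ℝ)} (hΓ : IsLattice Γ)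
    {V : Set SL(2, ℝ)} (hV : V ∈ 𝓝 1) :
    ∃ K : Set SL(2, ℝ), IsCompact K ∧
      ∀ g, (∀ γ ∈ Γ, g⁻¹ * γ * g ∈ V → γ = 1) → ∃ γ ∈ Γ, γ * g ∈ K := by
  obtain ⟨hd, hΓ⟩ := hΓ
  let _ : MeasurableSpace SL(2, ℝ) := borel _
  have : BorelSpace SL(2, ℝ) := ⟨rfl⟩
  obtain ⟨μ, s, hμ, hs, hfin⟩ := hΓ
  have : Countable Γ := TopologicalSpace.separableSpace_iff_countable.mp inferInstance
  obtain ⟨W', hW', hWV⟩ : ∃ W ∈ 𝓝 (1 : SL(2, ℝ)), ∀ v ∈ W, ∀ w ∈ W, v / w ∈ V :=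
    exists_nhds_split_inv hV
  obtain ⟨W, hW, hWW', hWc⟩ := local_compact_nhds hW'
  have hW0 : μ W ≠ 0 := (Measure.measure_pos_of_mem_nhds μ hW).ne'
  -- Packing: finite sets of thick points whose neighbourhoods `gW` stay disjoint modulo `Γ`.
  -- Thickness makes each `gW` inject into the quotient, so finite covolume bounds the number of
  -- points.
  let sep : Finset SL(2, ℝ) → Prop := fun A =>
    (∀ g ∈ A, ∀ γ ∈ Γ, g⁻¹ * γ * g ∈ V → γ = 1) ∧
      ∀ g ∈ A, ∀ g' ∈ A, g ≠ g' → ∀ γ ∈ Γ, ∀ w ∈ W, ∀ w' ∈ W, γ * g * w ≠ g' * w'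
  have hcard : ∀ A, sep A → (A.card : ENNReal) * μ W ≤ μ s := by
    rintro A ⟨hA1, hA2⟩
    have hmeas : ∀ g : SL(2, ℝ), MeasurableSet (g • W) := fun g =>
      (hWc.smul g).isClosed.measurableSet
    have hU : μ (⋃ g ∈ A, g • W) = A.card * μ W := by
      rw [measure_biUnion_finset]
      · simp [measure_smul]
      · intro g hg g' hg' hne
        rw [Function.onFun, Set.disjoint_left]
        rintro _ ⟨w, hw, rfl⟩ ⟨w', hw', h⟩
        exact hA2 g hg g' hg' hne 1 Γ.one_mem w hw w' hw' (by simpa using h.symm)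
      · exact fun g _ => hmeas g
    rw [← hU]
    refine hs.measure_le_of_pairwise_disjoint
      (Finset.measurableSet_biUnion _ fun g _ => hmeas g).nullMeasurableSet ?_
    intro γ₁ γ₂ hne
    refine ((Set.disjoint_left.mpr ?_).inter_left _).inter_right _ |>.aedisjoint
    rintro _ ⟨x, hx, rfl⟩ ⟨y, hy, hxy⟩
    simp only [Set.mem_iUnion] at hx hy
    obtain ⟨g, hg, w, hw, rfl⟩ := hx
    obtain ⟨g', hg', w', hw', rfl⟩ := hy
    have hxy' : (γ₂ : SL(2, ℝ)) * (g' * w') = γ₁ * (g * w) := hxy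
    by_cases h : g = g'
    · subst h
      refine hne ?_
      have h1 : (γ₂ : SL(2, ℝ))⁻¹ * γ₁ = 1 := by
        refine hA1 g hg _ (Γ.mul_mem (Γ.inv_mem γ₂.2) γ₁.2) ?_
        convert hWV w' (hWW' hw') w (hWW' hw) using 1
        rw [eq_div_iff_mul_eq', eq_comm]
        have : w' = g⁻¹ * ((γ₂ : SL(2, ℝ))⁻¹ * (γ₁ * (g * w))) := by rw [← hxy']; group
        rw [this]; group
      exact Subtype.ext (inv_mul_eq_one.mp h1).symm
    · refine hA2 g hg g' hg' h ((γ₂ : SL(2, ℝ))⁻¹ * γ₁) (Γ.mul_mem (Γ.inv_mem γ₂.2) γ₁.2)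
        w hw w' hw' ?_
      rw [mul_assoc, mul_assoc, ← hxy']; group
  obtain ⟨N, hN⟩ : ∃ N : ℕ, ∀ A, sep A → A.card ≤ N := by
    obtain ⟨N, hN⟩ := exists_nat_gt (μ s / μ W).toReal
    refine ⟨N, fun A hA => ?_⟩
    have h1 : (A.card : ENNReal) ≤ μ s / μ W :=
      (ENNReal.le_div_iff_mul_le (Or.inl hW0) (Or.inl hWc.measure_lt_top.ne)).mpr (hcard A hA)
    have h2 := ENNReal.toReal_mono (ENNReal.div_lt_top hfin.ne hW0).ne h1
    rw [ENNReal.toReal_natCast] at h2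
    exact_mod_cast (h2.trans_lt hN).le
  let S : Set ℕ := {n | ∃ A, sep A ∧ A.card = n}
  have hSb : BddAbove S := ⟨N, by rintro _ ⟨A, hA, rfl⟩; exact hN A hA⟩
  obtain ⟨A, hA, hAc⟩ : sSup S ∈ S := Nat.sSup_mem ⟨0, ∅, by simp [sep], rfl⟩ hSb
  -- `A` has maximal cardinality. A thick point with no `Γ`-translate in this compact set could be
  -- added to `A`.
  refine ⟨⋃ g ∈ A, g • (W * W⁻¹), A.isCompact_biUnion fun g _ => (hWc.mul hWc.inv).smul g, ?_⟩
  intro g hg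
  classical
  by_contra! hcon
  have hne : ∀ γ ∈ Γ, ∀ g' ∈ A, ∀ w ∈ W, ∀ w' ∈ W, γ * g * w ≠ g' * w' := by
    intro γ hγ g' hg' w hw w' hw' h
    refine hcon γ hγ ?_
    simp only [Set.mem_iUnion]
    refine ⟨g', hg', w' * w⁻¹, Set.mul_mem_mul hw' (Set.inv_mem_inv.mpr hw), ?_⟩
    change g' * (w' * w⁻¹) = γ * g
    rw [← mul_assoc, ← h]; group
  have hgA : g ∉ A := fun h =>
    hne 1 Γ.one_mem g h 1 (mem_of_mem_nhds hW) 1 (mem_of_mem_nhds hW) (by simp)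
  have : sep (insert g A) := by
    refine ⟨fun x hx => ?_, fun x hx y hy hxy γ hγ w hw w' hw' => ?_⟩
    · rcases Finset.mem_insert.mp hx with rfl | hx
      · exact hg
      · exact hA.1 x hx
    · rcases Finset.mem_insert.mp hx with hx' | hx' <;>
        rcases Finset.mem_insert.mp hy with hy' | hy'
      · exact absurd (hx'.trans hy'.symm) hxy
      · exact hx' ▸ hne γ hγ y hy' w hw w' hw'
      · intro h
        subst hy'
        refine hne γ⁻¹ (Γ.inv_mem hγ) x hx' w' hw' w hw ?_
        rw [mul_assoc, ← h]; group
      · exact hA.2 x hx' y hy' hxy γ hγ w hw w' hw'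
  have h3 : A.card + 1 ≤ sSup S := le_csSup hSb ⟨_, this, Finset.card_insert_of_notMem hgA⟩
  omega

end Geometry
end PLattice

namespace PLattice

open Topology MeasureTheory Pointwise

/-! ### Zassenhaus estimate and conjugation of elements near the identity -/

section TracelessNorm

/-- The squared Frobenius norm of the traceless part of a real `2 × 2` matrix. -/
def tracelessNorm (M : Matrix (Fin 2) (Fin 2) ℝ) : ℝ :=
  (M 0 0 - M 1 1) ^ 2 / 2 + M 0 1 ^ 2 + M 1 0 ^ 2

/-- The neighbourhood of the identity of all matrices with positive trace and small traceless
part. -/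
def nearOne (ε : ℝ) : Set SL(2, ℝ) :=
  {h | 0 < h 0 0 + h 1 1 ∧ tracelessNorm h < ε}

lemma continuous_coe_SL2 : Continuous fun h : SL(2, ℝ) => (h : Matrix (Fin 2) (Fin 2) ℝ) :=
  Matrix.SpecialLinearGroup.isClosedEmbedding_val.continuous

lemma continuous_entry (i j : Fin 2) : Continuous fun h : SL(2, ℝ) => h i j :=
  (continuous_apply_apply i j).comp continuous_coe_SL2

lemma continuous_tracelessNorm : Continuous fun h : SL(2, ℝ) => tracelessNorm h := by
  exact (((((continuous_entry 0 0).sub (continuous_entry 1 1)).pow 2).div_const 2).add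
    ((continuous_entry 0 1).pow 2)).add ((continuous_entry 1 0).pow 2)

lemma nearOne_mem_nhds {ε : ℝ} (hε : 0 < ε) : nearOne ε ∈ 𝓝 (1 : SL(2, ℝ)) := by
  refine IsOpen.mem_nhds ?_ ⟨by simp, by simpa [tracelessNorm] using hε⟩
  exact (isOpen_lt continuous_const ((continuous_entry 0 0).add (continuous_entry 1 1))).inter
    (isOpen_lt continuous_tracelessNorm continuous_const)

lemma det_SL2 (h : SL(2, ℝ)) : h 0 0 * h 1 1 - h 0 1 * h 1 0 = 1 := by
  have := h.det_coe
  rwa [Matrix.det_fin_two] at this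

lemma tracelessNorm_nonneg (M : Matrix (Fin 2) (Fin 2) ℝ) : 0 ≤ tracelessNorm M := by
  unfold tracelessNorm; positivity

/-- The determinant condition expresses the squared trace through the traceless part. Hence the
latter alone controls the whole matrix, and its sublevel sets are compact. -/
lemma frobenius_eq (h : SL(2, ℝ)) : h 0 0 ^ 2 + h 0 1 ^ 2 + h 1 0 ^ 2 + h 1 1 ^ 2 ≤
    2 + 2 * tracelessNorm h := by
  have := det_SL2 h
  unfold tracelessNorm
  nlinarith [sq_nonneg (h 0 1 + h 1 0), sq_nonneg (h 0 1 - h 1 0), sq_nonneg (h 0 0 - h 1 1)]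

lemma isCompact_frobenius_le (R : ℝ) : IsCompact
    {h : SL(2, ℝ) | h 0 0 ^ 2 + h 0 1 ^ 2 + h 1 0 ^ 2 + h 1 1 ^ 2 ≤ R} := by
  have hK : IsCompact (Set.univ.pi fun _ : Fin 2 => Set.univ.pi fun _ : Fin 2 =>
      Set.Icc (-(R + 1)) (R + 1)) :=
    isCompact_univ_pi fun _ => isCompact_univ_pi fun _ => isCompact_Icc
  refine (Matrix.SpecialLinearGroup.isClosedEmbedding_val.isCompact_preimage hK).of_isClosed_subset
    ?_ fun h hh => ?_
  · exact isClosed_le (((((continuous_entry 0 0).pow 2).add ((continuous_entry 0 1).pow 2)).add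
      ((continuous_entry 1 0).pow 2)).add ((continuous_entry 1 1).pow 2)) continuous_const
  · intro i _ j _
    change h.1 0 0 ^ 2 + h.1 0 1 ^ 2 + h.1 1 0 ^ 2 + h.1 1 1 ^ 2 ≤ R at hh
    rw [Set.mem_Icc, ← abs_le]
    have : (h.1 i j) ^ 2 ≤ R := by
      fin_cases i <;> fin_cases j <;> simp only [Fin.zero_eta, Fin.mk_one] <;>
      nlinarith [sq_nonneg (h.1 0 0), sq_nonneg (h.1 0 1), sq_nonneg (h.1 1 0), sq_nonneg (h.1 1 1)]
    refine abs_le_of_sq_le_sq ?_ (by nlinarith [sq_nonneg (h.1 i j)])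
    nlinarith [sq_nonneg (h.1 i j)]

lemma isCompact_tracelessNorm_le (ε : ℝ) : IsCompact {h : SL(2, ℝ) | tracelessNorm h ≤ ε} :=
  (isCompact_frobenius_le (2 + 2 * ε)).of_isClosed_subset
    (isClosed_le continuous_tracelessNorm continuous_const) fun h hh => by
      have := frobenius_eq h
      simp only [Set.mem_ofPred_eq] at hh ⊢
      linarith

lemma finite_inter_of_isCompact {Γ : Subgroup SL(2, ℝ)} [DiscreteTopology Γ] {C : Set SL(2, ℝ)}
    (hC : IsCompact C) : {γ | γ ∈ Γ ∧ γ ∈ C}.Finite := by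
  have hcl : IsClosed (Γ : Set SL(2, ℝ)) := Subgroup.isClosed_of_discrete
  have h2 : IsDiscrete (Γ : Set SL(2, ℝ)) := ⟨‹_›⟩
  exact (hC.inter_left hcl).finite (h2.mono Set.inter_subset_left)

/-- An element of positive trace with zero traceless part is the identity. -/
lemma eq_one_of_tracelessNorm_eq_zero {h : SL(2, ℝ)} (ht : 0 < h 0 0 + h 1 1)
    (h0 : tracelessNorm h ≤ 0) : h = 1 := by
  unfold tracelessNorm at h0
  have hd := det_SL2 h
  have h1 : h 0 1 = 0 := by nlinarith [sq_nonneg (h 0 0 - h 1 1), sq_nonneg (h 0 1), sq_nonneg (h 1 0)]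
  have h2 : h 1 0 = 0 := by nlinarith [sq_nonneg (h 0 0 - h 1 1), sq_nonneg (h 0 1), sq_nonneg (h 1 0)]
  have h3 : h 0 0 - h 1 1 = 0 := by
    nlinarith [sq_nonneg (h 0 0 - h 1 1), sq_nonneg (h 0 1), sq_nonneg (h 1 0)]
  have h4 : h 0 0 = 1 := by rw [h1] at hd; nlinarith
  have h5 : h 1 1 = 1 := by linarith
  ext i j
  fin_cases i <;> fin_cases j <;> simp [h1, h2, h4, h5]

lemma tracelessNorm_pos {h : SL(2, ℝ)} (ht : 0 < h 0 0 + h 1 1) (h1 : h ≠ 1) :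
    0 < tracelessNorm h :=
  not_le.mp fun h0 => h1 (eq_one_of_tracelessNorm_eq_zero ht h0)

/-- The determinant of the traceless part (up to a factor) is bounded by its norm. -/
lemma abs_disc_le_tracelessNorm (M : Matrix (Fin 2) (Fin 2) ℝ) :
    |(M 0 0 - M 1 1) ^ 2 / 4 + M 0 1 * M 1 0| ≤ tracelessNorm M := by
  unfold tracelessNorm
  rw [abs_le]
  constructor <;> nlinarith [sq_nonneg (M 0 1 + M 1 0), sq_nonneg (M 0 1 - M 1 0),
    sq_nonneg (M 0 0 - M 1 1), sq_nonneg (M 0 1), sq_nonneg (M 1 0)]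

lemma frobenius_mul_le (a b c d x y z w : ℝ) :
    (a * x + b * z) ^ 2 + (a * y + b * w) ^ 2 + (c * x + d * z) ^ 2 + (c * y + d * w) ^ 2 ≤
      (a ^ 2 + b ^ 2 + c ^ 2 + d ^ 2) * (x ^ 2 + y ^ 2 + z ^ 2 + w ^ 2) := by
  nlinarith [sq_nonneg (a * z - b * x), sq_nonneg (a * w - b * y), sq_nonneg (c * z - d * x),
    sq_nonneg (c * w - d * y)]

lemma coe_inv_SL2 (h : SL(2, ℝ)) :
    ((h⁻¹ : SL(2, ℝ)) : Matrix (Fin 2) (Fin 2) ℝ) = !![h 1 1, -h 0 1; -h 1 0, h 0 0] := by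
  rw [Matrix.SpecialLinearGroup.coe_inv, Matrix.adjugate_fin_two]

/-- Commutators of elements near the identity are nearer to the identity. -/
lemma commute_or_commutator_lt {h k : SL(2, ℝ)} (hh : tracelessNorm h ≤ 1 / 100)
    (hk : tracelessNorm k ≤ 1 / 100) (ht : 0 < h 0 0 + h 1 1) :
    h * k = k * h ∨ (h * k * h⁻¹ * k⁻¹ ∈ nearOne (tracelessNorm h)) := by
  rcases eq_or_ne h 1 with rfl | h1
  · left; simp
  right
  have hpos := tracelessNorm_pos ht h1
  set N := tracelessNorm h with hN
  set N' := tracelessNorm k with hN'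
  have hN0 : 0 ≤ N' := tracelessNorm_nonneg _
  -- the traceless parts and their commutator
  set u := h⁻¹ * k⁻¹ with hu
  have hfu : u 0 0 ^ 2 + u 0 1 ^ 2 + u 1 0 ^ 2 + u 1 1 ^ 2 ≤ (2 + 2 * N) * (2 + 2 * N') := by
    have e1 : (u : Matrix (Fin 2) (Fin 2) ℝ) = !![h 1 1, -h 0 1; -h 1 0, h 0 0] *
        !![k 1 1, -k 0 1; -k 1 0, k 0 0] := by
      rw [← coe_inv_SL2, ← coe_inv_SL2, hu, Matrix.SpecialLinearGroup.coe_mul]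
    have e2 := frobenius_mul_le (h 1 1) (-h 0 1) (-h 1 0) (h 0 0) (k 1 1) (-k 0 1) (-k 1 0) (k 0 0)
    have e3 := frobenius_eq h
    have e4 := frobenius_eq k
    rw [e1]
    simp only [Matrix.mul_fin_two, Matrix.of_apply, Matrix.cons_val', Matrix.cons_val_zero,
      Matrix.cons_val_one, Matrix.cons_val_fin_one]
    refine le_trans (by linarith) (e2.trans ?_)
    refine mul_le_mul (by linarith) (by linarith) (by positivity) (by linarith)
  set p := h 0 1 * k 1 0 - h 1 0 * k 0 1 with hp
  set q := (h 0 0 - h 1 1) * k 0 1 - h 0 1 * (k 0 0 - k 1 1) with hq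
  set r := h 1 0 * (k 0 0 - k 1 1) - (h 0 0 - h 1 1) * k 1 0 with hr
  -- The commutator of traceless matrices is a cross product up to scaling, and this is Lagrange's
  -- identity with the squared inner product dropped.
  have hK : p ^ 2 + q ^ 2 + r ^ 2 + (-p) ^ 2 ≤ 2 * N * N' := by
    have : 2 * N * N' - (p ^ 2 + q ^ 2 + r ^ 2 + (-p) ^ 2) =
        2 * ((h 0 0 - h 1 1) * (k 0 0 - k 1 1) / 2 + h 0 1 * k 0 1 + h 1 0 * k 1 0) ^ 2 +
        2 * (h 0 1 * k 1 0 - h 1 0 * k 0 1) ^ 2 - 2 * p ^ 2 := by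
      rw [hN, hN', hp, hq, hr]; unfold tracelessNorm; ring
    nlinarith [sq_nonneg ((h 0 0 - h 1 1) * (k 0 0 - k 1 1) / 2 + h 0 1 * k 0 1 + h 1 0 * k 1 0)]
  -- `hkh⁻¹k⁻¹ - 1 = (hk - kh) h⁻¹k⁻¹`, and scalar parts drop out of `hk - kh`.
  have hcomm : ((h * k * h⁻¹ * k⁻¹ : SL(2, ℝ)) : Matrix (Fin 2) (Fin 2) ℝ) =
      1 + !![p, q; r, -p] * (u : Matrix (Fin 2) (Fin 2) ℝ) := by
    have e1 : h * k * h⁻¹ * k⁻¹ = h * k * u := by rw [hu]; group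
    have e2 : (1 : Matrix (Fin 2) (Fin 2) ℝ) = ((k * h * u : SL(2, ℝ)) : Matrix _ _ ℝ) := by
      rw [hu, show k * h * (h⁻¹ * k⁻¹) = 1 by group]; rfl
    rw [e1, e2, Matrix.SpecialLinearGroup.coe_mul, Matrix.SpecialLinearGroup.coe_mul (k * h),
      ← add_mul]
    congr 1
    ext i j
    fin_cases i <;> fin_cases j <;>
      simp [Matrix.SpecialLinearGroup.coe_mul, Matrix.mul_apply, Fin.sum_univ_two, hp, hq, hr] <;>
      ring
  set c := h * k * h⁻¹ * k⁻¹ with hc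
  have hE := frobenius_mul_le p q r (-p) (u 0 0) (u 0 1) (u 1 0) (u 1 1)
  have hE2 : (p ^ 2 + q ^ 2 + r ^ 2 + (-p) ^ 2) *
      (u 0 0 ^ 2 + u 0 1 ^ 2 + u 1 0 ^ 2 + u 1 1 ^ 2) ≤ 2 * N * N' * ((2 + 2 * N) * (2 + 2 * N')) :=
    mul_le_mul hK hfu (by positivity) (by positivity)
  -- This is where `1/100` is used: the last two factors multiply to at most `5`, so the product is
  -- at most `10 N N' ≤ N / 10`.
  have hE3 : 2 * N * N' * ((2 + 2 * N) * (2 + 2 * N')) ≤ N / 10 := by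
    have : (2 + 2 * N) * (2 + 2 * N') ≤ 5 :=
      (mul_le_mul (by linarith : 2 + 2 * N ≤ 2.02) (by linarith : 2 + 2 * N' ≤ 2.02)
        (by positivity) (by norm_num)).trans (by norm_num)
    have h0 : 0 ≤ 2 * N * N' := by positivity
    have h3 := mul_le_mul_of_nonneg_left this h0
    have h4 := mul_le_mul_of_nonneg_left hk hpos.le
    linarith
  have c00 : c 0 0 = 1 + (p * u 0 0 + q * u 1 0) := by
    rw [hcomm, Matrix.add_apply, Matrix.mul_apply]; simp [Fin.sum_univ_two]
  have c01 : c 0 1 = p * u 0 1 + q * u 1 1 := by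
    rw [hcomm, Matrix.add_apply, Matrix.mul_apply]; simp [Fin.sum_univ_two]
  have c10 : c 1 0 = r * u 0 0 + (-p) * u 1 0 := by
    rw [hcomm, Matrix.add_apply, Matrix.mul_apply]; simp [Fin.sum_univ_two]
  have c11 : c 1 1 = 1 + (r * u 0 1 + (-p) * u 1 1) := by
    rw [hcomm, Matrix.add_apply, Matrix.mul_apply]; simp [Fin.sum_univ_two]
  set e := p * u 0 0 + q * u 1 0
  set f := p * u 0 1 + q * u 1 1
  set e' := r * u 0 0 + (-p) * u 1 0
  set f' := r * u 0 1 + (-p) * u 1 1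
  have htot : e ^ 2 + f ^ 2 + e' ^ 2 + f' ^ 2 ≤ N / 10 := by linarith
  clear_value e f e' f' p q r u
  clear hE hE2 hE3 hcomm hfu hK hp hq hr
  refine ⟨?_, ?_⟩
  · rw [c00, c11]
    have h1 : -(1 / 2) < e := by nlinarith [sq_nonneg f, sq_nonneg e', sq_nonneg f']
    have h2 : -(1 / 2) < f' := by nlinarith [sq_nonneg f, sq_nonneg e', sq_nonneg e]
    linarith
  · unfold tracelessNorm
    rw [c00, c01, c10, c11]
    linarith [sq_nonneg (e + f'), sq_nonneg f, sq_nonneg e']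

lemma tracelessNorm_conj (g h : SL(2, ℝ)) : tracelessNorm ((g⁻¹ * h * g : SL(2, ℝ)) : Matrix _ _ ℝ) =
    2 * ((h 0 0 - h 1 1) / 2 * (g 0 0 * g 1 1 + g 0 1 * g 1 0) + h 0 1 * g 1 0 * g 1 1
      - h 1 0 * g 0 0 * g 0 1) ^ 2 +
    ((h 0 0 - h 1 1) * g 0 1 * g 1 1 + h 0 1 * g 1 1 ^ 2 - h 1 0 * g 0 1 ^ 2) ^ 2 +
    (-(h 0 0 - h 1 1) * g 0 0 * g 1 0 - h 0 1 * g 1 0 ^ 2 + h 1 0 * g 0 0 ^ 2) ^ 2 := by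
  unfold tracelessNorm
  rw [Matrix.SpecialLinearGroup.coe_mul, Matrix.SpecialLinearGroup.coe_mul, coe_inv_SL2]
  simp only [Matrix.mul_apply, Fin.sum_univ_two, Matrix.of_apply, Matrix.cons_val',
    Matrix.cons_val_zero, Matrix.cons_val_one, Matrix.cons_val_fin_one]
  ring

lemma trace_conj (g h : SL(2, ℝ)) :
    (g⁻¹ * h * g : SL(2, ℝ)) 0 0 + (g⁻¹ * h * g : SL(2, ℝ)) 1 1 = h 0 0 + h 1 1 := by
  have := det_SL2 g
  rw [Matrix.SpecialLinearGroup.coe_mul, Matrix.SpecialLinearGroup.coe_mul, coe_inv_SL2]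
  simp only [Matrix.mul_apply, Fin.sum_univ_two, Matrix.of_apply, Matrix.cons_val',
    Matrix.cons_val_zero, Matrix.cons_val_one, Matrix.cons_val_fin_one]
  linear_combination (h 0 0 + h 1 1) * this

/-- The traceless parts of commuting matrices are proportional. -/
lemma exists_tracelessNorm_conj_eq {h k : SL(2, ℝ)} (ht : 0 < h 0 0 + h 1 1) (h1 : h ≠ 1)
    (hk : h * k = k * h) : ∃ s : ℝ, 0 ≤ s ∧ ∀ g : SL(2, ℝ),
      tracelessNorm ((g⁻¹ * k * g : SL(2, ℝ)) : Matrix _ _ ℝ) =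
        s * tracelessNorm ((g⁻¹ * h * g : SL(2, ℝ)) : Matrix _ _ ℝ) := by
  have hpos := tracelessNorm_pos ht h1
  have hM := congrArg (fun m : SL(2, ℝ) => (m : Matrix (Fin 2) (Fin 2) ℝ)) hk
  simp only [Matrix.SpecialLinearGroup.coe_mul] at hM
  have m00 := congrFun (congrFun hM 0) 0
  have m01 := congrFun (congrFun hM 0) 1
  have m10 := congrFun (congrFun hM 1) 0
  simp only [Matrix.mul_apply, Fin.sum_univ_two] at m00 m01 m10
  suffices ∃ s : ℝ, k 0 0 - k 1 1 = s * (h 0 0 - h 1 1) ∧ k 0 1 = s * h 0 1 ∧ k 1 0 = s * h 1 0 by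
    obtain ⟨s, e1, e2, e3⟩ := this
    refine ⟨s ^ 2, sq_nonneg s, fun g => ?_⟩
    rw [tracelessNorm_conj, tracelessNorm_conj, e1, e2, e3]
    ring
  by_cases hb : h 0 1 = 0
  · by_cases hc : h 1 0 = 0
    · have ha : h 0 0 - h 1 1 ≠ 0 := by
        intro ha
        rw [tracelessNorm, ha, hb, hc] at hpos
        norm_num at hpos
      refine ⟨(k 0 0 - k 1 1) / (h 0 0 - h 1 1), by field_simp, ?_, ?_⟩
      · rw [hb, mul_zero]
        refine (mul_eq_zero.mp (?_ : (h 0 0 - h 1 1) * k 0 1 = 0)).resolve_left ha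
        rw [hb] at m01; linarith
      · rw [hc, mul_zero]
        refine (mul_eq_zero.mp (?_ : (h 0 0 - h 1 1) * k 1 0 = 0)).resolve_left ha
        rw [hc] at m10; linarith
    · refine ⟨k 1 0 / h 1 0, ?_, ?_, by field_simp⟩ <;> field_simp <;> linarith
  · refine ⟨k 0 1 / h 0 1, ?_, by field_simp, ?_⟩ <;> field_simp <;> linarith

/-- The traceless part of a nontrivial element of positive trace can be made larger by
conjugation. -/
lemma exists_tracelessNorm_conj_eq_of_le {h : SL(2, ℝ)} (ht : 0 < h 0 0 + h 1 1) (h1 : h ≠ 1)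
    {ε : ℝ} (hε : tracelessNorm h ≤ ε) :
    ∃ g : SL(2, ℝ), tracelessNorm ((g⁻¹ * h * g : SL(2, ℝ)) : Matrix _ _ ℝ) = ε := by
  have hpos := tracelessNorm_pos ht h1
  have hε0 : 0 < ε := hpos.trans_le hε
  -- Along one of these two unipotent families the norm is an unbounded polynomial in `t` starting
  -- at or below `ε`, so the intermediate value theorem applies.
  let up : ℝ → SL(2, ℝ) := fun t => ⟨!![1, t; 0, 1], by simp [Matrix.det_fin_two]⟩
  let lo : ℝ → SL(2, ℝ) := fun t => ⟨!![1, 0; t, 1], by simp [Matrix.det_fin_two]⟩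
  have hup : ∀ t, tracelessNorm (((up t)⁻¹ * h * up t : SL(2, ℝ)) : Matrix _ _ ℝ) =
      2 * ((h 0 0 - h 1 1) / 2 - h 1 0 * t) ^ 2 +
        ((h 0 0 - h 1 1) * t + h 0 1 - h 1 0 * t ^ 2) ^ 2 + h 1 0 ^ 2 := by
    intro t; rw [tracelessNorm_conj]; simp [up]
  have hlo : ∀ t, tracelessNorm (((lo t)⁻¹ * h * lo t : SL(2, ℝ)) : Matrix _ _ ℝ) =
      2 * ((h 0 0 - h 1 1) / 2 + h 0 1 * t) ^ 2 + h 0 1 ^ 2 +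
        (-(h 0 0 - h 1 1) * t - h 0 1 * t ^ 2 + h 1 0) ^ 2 := by
    intro t; rw [tracelessNorm_conj]; simp [lo]
  have key : ∀ (F : ℝ → SL(2, ℝ)) (φ : ℝ → ℝ), Continuous φ →
      (∀ t, tracelessNorm (((F t)⁻¹ * h * F t : SL(2, ℝ)) : Matrix _ _ ℝ) = φ t) →
      φ 0 ≤ ε → (∃ t, ε ≤ φ t) →
      ∃ g : SL(2, ℝ), tracelessNorm ((g⁻¹ * h * g : SL(2, ℝ)) : Matrix _ _ ℝ) = ε := by
    rintro F φ hφ hF h0 ⟨t, ht⟩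
    obtain ⟨s, hs⟩ := mem_range_of_exists_le_of_exists_ge hφ ⟨0, h0⟩ ⟨t, ht⟩
    exact ⟨F s, (hF s).trans hs⟩
  have hN : tracelessNorm h = (h 0 0 - h 1 1) ^ 2 / 2 + h 0 1 ^ 2 + h 1 0 ^ 2 := rfl
  by_cases hc : h 1 0 = 0
  · by_cases hb : h 0 1 = 0
    · have ha : h 0 0 - h 1 1 ≠ 0 := by
        intro ha
        rw [hN, ha, hb, hc] at hpos
        norm_num at hpos
      refine key up _ (by fun_prop) hup (by rw [hN] at hε; nlinarith)
        ⟨(ε + 1) / (h 0 0 - h 1 1), ?_⟩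
      rw [hb, hc, show (h 0 0 - h 1 1) * ((ε + 1) / (h 0 0 - h 1 1)) = ε + 1 by field_simp]
      nlinarith [sq_nonneg ((h 0 0 - h 1 1) / 2)]
    · refine key lo _ (by fun_prop) hlo (by rw [hN] at hε; nlinarith)
        ⟨((ε + 1) - (h 0 0 - h 1 1) / 2) / h 0 1, ?_⟩
      rw [show h 0 1 * (((ε + 1) - (h 0 0 - h 1 1) / 2) / h 0 1) =
        (ε + 1) - (h 0 0 - h 1 1) / 2 by field_simp]
      have := sq_nonneg (h 0 1)
      set t := ((ε + 1) - (h 0 0 - h 1 1) / 2) / h 0 1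
      nlinarith [sq_nonneg (-(h 0 0 - h 1 1) * t - h 0 1 * t ^ 2 + h 1 0)]
  · refine key up _ (by fun_prop) hup (by rw [hN] at hε; nlinarith)
      ⟨((h 0 0 - h 1 1) / 2 + (ε + 1)) / h 1 0, ?_⟩
    rw [show h 1 0 * (((h 0 0 - h 1 1) / 2 + (ε + 1)) / h 1 0) =
      (h 0 0 - h 1 1) / 2 + (ε + 1) by field_simp]
    have := sq_nonneg (h 1 0)
    set t := ((h 0 0 - h 1 1) / 2 + (ε + 1)) / h 1 0
    nlinarith [sq_nonneg ((h 0 0 - h 1 1) * t + h 0 1 - h 1 0 * t ^ 2)]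

lemma coe_translation : (translation : Matrix (Fin 2) (Fin 2) ℝ) = !![1, 1; 0, 1] := rfl

/-- Unipotent elements are conjugate to the translation or its inverse. -/
lemma exists_conj_translation {h : SL(2, ℝ)} (ht : 0 < h 0 0 + h 1 1) (h1 : h ≠ 1)
    (hdisc : (h 0 0 - h 1 1) ^ 2 / 4 + h 0 1 * h 1 0 = 0) :
    ∃ p : SL(2, ℝ), h = p * translation * p⁻¹ ∨ h⁻¹ = p * translation * p⁻¹ := by
  have hd := det_SL2 h
  have htr : h 0 0 + h 1 1 = 2 := by nlinarith
  have conj : ∀ k : SL(2, ℝ), k 0 0 + k 1 1 = 2 → k ≠ 1 → 0 ≤ k 0 1 → k 1 0 ≤ 0 →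
      ∃ p : SL(2, ℝ), k = p * translation * p⁻¹ := by
    intro k hk hk1 hb hc
    have hkd := det_SL2 k
    -- If the conjugator has first column `(x, y)`, the conjugate of the translation is `1 + (-xy,
    -- x²; -y², xy)`. Matching entries determines `x` and `y` up to a common sign; the second column
    -- only has to give determinant one.
    obtain ⟨x, hx⟩ : ∃ x, x ^ 2 = k 0 1 := ⟨√(k 0 1), Real.sq_sqrt hb⟩
    obtain ⟨y, hy, hxy⟩ : ∃ y, y ^ 2 = -k 1 0 ∧ x * y = -(k 0 0 - 1) := by
      have h2 : (x * √(-k 1 0)) ^ 2 = (k 0 0 - 1) ^ 2 := by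
        rw [mul_pow, Real.sq_sqrt (by linarith), hx]
        have : k 1 1 = 2 - k 0 0 := by linarith
        rw [this] at hkd
        nlinarith
      rcases sq_eq_sq_iff_eq_or_eq_neg.mp h2 with h | h
      · exact ⟨-√(-k 1 0), by rw [neg_sq, Real.sq_sqrt (by linarith)], by linarith⟩
      · exact ⟨√(-k 1 0), by rw [Real.sq_sqrt (by linarith)], by linarith⟩
    have hne : x ^ 2 + y ^ 2 ≠ 0 := by
      intro h0
      have hx0 : x = 0 := by nlinarith
      have hy0 : y = 0 := by nlinarith
      apply hk1
      rw [hx0] at hx hxy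
      rw [hy0] at hy
      have e1 : k 0 0 = 1 := by linarith
      have e2 : k 1 1 = 1 := by linarith
      have e3 : k 0 1 = 0 := by rw [← hx]; ring
      have e4 : k 1 0 = 0 := by linarith
      ext i j
      fin_cases i <;> fin_cases j <;> simp [e1, e2, e3, e4]
    obtain ⟨p, hp⟩ : ∃ p : SL(2, ℝ), (p : Matrix (Fin 2) (Fin 2) ℝ) =
        !![x, -y / (x ^ 2 + y ^ 2); y, x / (x ^ 2 + y ^ 2)] :=
      ⟨⟨_, by rw [Matrix.det_fin_two_of]; field_simp; ring⟩, rfl⟩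
    refine ⟨p, ?_⟩
    have e1 : k 1 1 = 2 - k 0 0 := by linarith
    have e2 : k 0 0 = 1 - x * y := by linarith
    have e3 : k 1 0 = - y ^ 2 := by linarith
    have : (k : Matrix (Fin 2) (Fin 2) ℝ) = ((p * translation * p⁻¹ : SL(2, ℝ)) : Matrix _ _ ℝ) := by
      rw [Matrix.SpecialLinearGroup.coe_mul, Matrix.SpecialLinearGroup.coe_mul, coe_inv_SL2,
        coe_translation, hp]
      ext i j
      fin_cases i <;> fin_cases j <;>
        simp [Matrix.mul_apply, Fin.sum_univ_two, e1, e2, e3, ← hx] <;> field_simp <;> ring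
    exact Subtype.ext this
  have hbc : h 0 1 * h 1 0 ≤ 0 := by nlinarith [sq_nonneg (h 0 0 - h 1 1)]
  by_cases hsign : 0 ≤ h 0 1 ∧ h 1 0 ≤ 0
  · obtain ⟨p, hp⟩ := conj h htr h1 hsign.1 hsign.2
    exact ⟨p, Or.inl hp⟩
  · have : h 0 1 ≤ 0 ∧ 0 ≤ h 1 0 := by
      rw [not_and_or, not_le, not_le] at hsign
      rcases hsign with hs | hs
      · exact ⟨hs.le, by nlinarith⟩
      · exact ⟨by nlinarith, hs.le⟩
    obtain ⟨p, hp⟩ := conj h⁻¹ (by rw [coe_inv_SL2]; simp; linarith) (inv_ne_one.mpr h1)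
      (by rw [coe_inv_SL2]; simpa using this.1) (by rw [coe_inv_SL2]; simpa using this.2)
    exact ⟨p, Or.inr hp⟩

lemma tracelessNorm_inv (h : SL(2, ℝ)) :
    tracelessNorm ((h⁻¹ : SL(2, ℝ)) : Matrix _ _ ℝ) = tracelessNorm h := by
  rw [coe_inv_SL2]; simp [tracelessNorm]; ring

lemma im_smul_I (g : SL(2, ℝ)) : (g • I : ℍ).im = (g 1 0 ^ 2 + g 1 1 ^ 2)⁻¹ := by
  rw [MulAction.compHom_smul_def, im_smul_eq_div_normSq]
  simp [denom, Complex.normSq_apply]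
  ring

lemma tracelessNorm_conj_translation (g : SL(2, ℝ)) :
    tracelessNorm ((g⁻¹ * translation * g : SL(2, ℝ)) : Matrix _ _ ℝ) * (g • I : ℍ).im ^ 2 = 1 := by
  rw [tracelessNorm_conj, im_smul_I, coe_translation]
  have : g 1 0 ^ 2 + g 1 1 ^ 2 ≠ 0 := by
    intro h
    have h1 : g 1 0 = 0 := by nlinarith
    have h2 : g 1 1 = 0 := by nlinarith
    have := det_SL2 g
    rw [h1, h2] at this
    norm_num at this
  simp
  field_simp
  ring

end TracelessNorm
end PLattice

namespace PLattice

open Topology MeasureTheory Pointwise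

/-! ### Reduction theory: a compact part and finitely many cusps -/

section Cusps

/-- Nontrivial elements of `Γ` whose conjugate by `g` is near the identity. -/
def smallElements (Γ : Subgroup SL(2, ℝ)) (ε : ℝ) (g : SL(2, ℝ)) : Set SL(2, ℝ) :=
  {γ | γ ∈ Γ ∧ γ ≠ 1 ∧ g⁻¹ * γ * g ∈ nearOne ε}

lemma finite_smallElements {Γ : Subgroup SL(2, ℝ)} [DiscreteTopology Γ] (ε : ℝ) (g : SL(2, ℝ)) :
    (smallElements Γ ε g).Finite := by
  have hC : IsCompact ((fun h : SL(2, ℝ) => g * h * g⁻¹) '' {h : SL(2, ℝ) | tracelessNorm h ≤ ε}) :=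
    (isCompact_tracelessNorm_le ε).image (by fun_prop)
  refine (finite_inter_of_isCompact (Γ := Γ) hC).subset ?_
  rintro γ ⟨hγ, -, -, h⟩
  exact ⟨hγ, g⁻¹ * γ * g, h.le, by group⟩

lemma exists_minimal_smallElements {Γ : Subgroup SL(2, ℝ)} [DiscreteTopology Γ] {ε : ℝ}
    {g : SL(2, ℝ)} (h : (smallElements Γ ε g).Nonempty) :
    ∃ γ ∈ smallElements Γ ε g, ∀ δ ∈ smallElements Γ ε g,
      tracelessNorm ((g⁻¹ * γ * g : SL(2, ℝ)) : Matrix _ _ ℝ) ≤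
        tracelessNorm ((g⁻¹ * δ * g : SL(2, ℝ)) : Matrix _ _ ℝ) :=
  Set.exists_min_image _ _ (finite_smallElements ε g) h

/-- Every minimal small element is minimal and of prescribed size at some other point. -/
lemma exists_smallElements_eq_empty {Γ : Subgroup SL(2, ℝ)} [DiscreteTopology Γ] {ε : ℝ}
    (hε : ε ≤ 1 / 100) {g γ : SL(2, ℝ)} (hγ : γ ∈ smallElements Γ ε g)
    (hmin : ∀ δ ∈ smallElements Γ ε g, tracelessNorm ((g⁻¹ * γ * g : SL(2, ℝ)) : Matrix _ _ ℝ) ≤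
        tracelessNorm ((g⁻¹ * δ * g : SL(2, ℝ)) : Matrix _ _ ℝ)) :
    ∃ g' : SL(2, ℝ), tracelessNorm ((g'⁻¹ * γ * g' : SL(2, ℝ)) : Matrix _ _ ℝ) = ε ∧
      smallElements Γ ε g' = ∅ := by
  obtain ⟨hγΓ, hγ1, hγt, hγn⟩ := hγ
  have hconj1 : ∀ x : SL(2, ℝ), x⁻¹ * γ * x ≠ 1 := fun x h => hγ1 (by
    have : γ = x * (x⁻¹ * γ * x) * x⁻¹ := by group
    rw [this, h]; group)
  -- The base point is moved until `γ` has size exactly `ε`. A smaller element `δ` appearing there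
  -- must commute with `γ`, and would then already have been smaller than `γ` at `g`.
  obtain ⟨p, hp⟩ := exists_tracelessNorm_conj_eq_of_le hγt (hconj1 g) hγn.le
  set g' := g * p with hg'
  have hg'n : tracelessNorm ((g'⁻¹ * γ * g' : SL(2, ℝ)) : Matrix _ _ ℝ) = ε := by
    rw [← hp, hg', show (g * p)⁻¹ * γ * (g * p) = p⁻¹ * (g⁻¹ * γ * g) * p by group]
  refine ⟨g', hg'n, ?_⟩
  by_contra hne
  obtain ⟨δ, ⟨hδΓ, hδ1, hδt, hδn⟩, hδmin⟩ :=
    exists_minimal_smallElements (Set.nonempty_iff_ne_empty.mpr hne)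
  have htγ : 0 < γ 0 0 + γ 1 1 := by rwa [trace_conj] at hγt
  have htδ : 0 < δ 0 0 + δ 1 1 := by rwa [trace_conj] at hδt
  have hcomm : γ * δ = δ * γ := by
    rcases commute_or_commutator_lt (hδn.le.trans hε) (hg'n.le.trans hε) hδt with h | h
    · have h1 : g' * (g'⁻¹ * δ * g' * (g'⁻¹ * γ * g')) * g'⁻¹ = δ * γ := by group
      have h2 : g' * (g'⁻¹ * γ * g' * (g'⁻¹ * δ * g')) * g'⁻¹ = γ * δ := by group
      rw [← h1, ← h2, h]
    -- A nontrivial commutator would be an element of `Γ` smaller at `g'` than the minimal `δ`.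
    · by_contra hne
      have he : g'⁻¹ * δ * g' * (g'⁻¹ * γ * g') * (g'⁻¹ * δ * g')⁻¹ * (g'⁻¹ * γ * g')⁻¹ =
        g'⁻¹ * (δ * γ * δ⁻¹ * γ⁻¹) * g' := by group
      rw [he] at h
      have hc1 : δ * γ * δ⁻¹ * γ⁻¹ ≠ 1 := fun h1 => hne (by
        have : δ * γ = δ * γ * δ⁻¹ * γ⁻¹ * (γ * δ) := by group
        rw [this, h1, one_mul])
      have := hδmin _ ⟨Γ.mul_mem (Γ.mul_mem (Γ.mul_mem hδΓ hγΓ) (Γ.inv_mem hδΓ)) (Γ.inv_mem hγΓ),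
        hc1, h.1, h.2.trans hδn⟩
      exact absurd h.2 (not_lt.mpr this)
  obtain ⟨s, hs0, hs⟩ := exists_tracelessNorm_conj_eq htγ hγ1 hcomm
  -- Commuting elements keep a constant ratio `s` of sizes at all base points. At `g'` this gives `s
  -- < 1`, and at `g` it contradicts minimality of `γ`.
  have hpos := tracelessNorm_pos hγt (hconj1 g)
  have hs1 : s < 1 := by
    rw [hs g', hg'n] at hδn
    nlinarith [hpos.trans hγn]
  have hlt : tracelessNorm ((g⁻¹ * δ * g : SL(2, ℝ)) : Matrix _ _ ℝ) <
      tracelessNorm ((g⁻¹ * γ * g : SL(2, ℝ)) : Matrix _ _ ℝ) := by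
    rw [hs g]; nlinarith
  exact absurd (hmin δ ⟨hδΓ, hδ1, by rwa [trace_conj], hlt.trans hγn⟩) (not_le.mpr hlt)

/-- Minimal small elements lie in finitely many conjugacy classes. -/
lemma exists_finite_conj_smallElements {Γ : Subgroup SL(2, ℝ)} (hΓ : IsLattice Γ) {ε : ℝ}
    (hε0 : 0 < ε) (hε : ε ≤ 1 / 100) :
    ∃ F : Set SL(2, ℝ), F.Finite ∧ F ⊆ Γ ∧ ∀ g, ∀ γ ∈ smallElements Γ ε g,
      (∀ δ ∈ smallElements Γ ε g, tracelessNorm ((g⁻¹ * γ * g : SL(2, ℝ)) : Matrix _ _ ℝ) ≤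
        tracelessNorm ((g⁻¹ * δ * g : SL(2, ℝ)) : Matrix _ _ ℝ)) → ∃ δ ∈ Γ, δ * γ * δ⁻¹ ∈ F := by
  have := hΓ.1
  obtain ⟨K, hK, hKΓ⟩ := exists_isCompact_of_isLattice hΓ (nearOne_mem_nhds hε0)
  have hC : IsCompact (K * {h : SL(2, ℝ) | tracelessNorm h ≤ ε} * K⁻¹) :=
    (hK.mul (isCompact_tracelessNorm_le ε)).mul hK.inv
  refine ⟨_, finite_inter_of_isCompact (Γ := Γ) hC, fun _ h => h.1, fun g γ hγ hmin => ?_⟩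
  obtain ⟨g', hg', hempty⟩ := exists_smallElements_eq_empty hε hγ hmin
  obtain ⟨δ, hδ, hδK⟩ := hKΓ g' fun κ hκ hn => by
    by_contra h1
    have : κ ∈ smallElements Γ ε g' := ⟨hκ, h1, hn⟩
    rw [hempty] at this
    exact this
  refine ⟨δ, hδ, Γ.mul_mem (Γ.mul_mem hδ hγ.1) (Γ.inv_mem hδ), ?_⟩
  have : δ * γ * δ⁻¹ = (δ * g') * (g'⁻¹ * γ * g') * (δ * g')⁻¹ := by group
  rw [this]
  exact Set.mul_mem_mul (Set.mul_mem_mul hδK hg'.le) (Set.inv_mem_inv.mpr hδK)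

/-- The quantity is a quarter of the squared trace minus the determinant, hence a conjugation
invariant. -/
lemma disc_conj (g h : SL(2, ℝ)) :
    ((g * h * g⁻¹ : SL(2, ℝ)) 0 0 - (g * h * g⁻¹ : SL(2, ℝ)) 1 1) ^ 2 / 4 +
      (g * h * g⁻¹ : SL(2, ℝ)) 0 1 * (g * h * g⁻¹ : SL(2, ℝ)) 1 0 =
    (h 0 0 - h 1 1) ^ 2 / 4 + h 0 1 * h 1 0 := by
  have h1 := det_SL2 h
  have h2 := det_SL2 (g * h * g⁻¹)
  have h3 := trace_conj g⁻¹ h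
  rw [inv_inv] at h3
  generalize (g * h * g⁻¹ : SL(2, ℝ)) = c at *
  have h4 : (c 0 0 + c 1 1) ^ 2 = (h 0 0 + h 1 1) ^ 2 := by rw [h3]
  linear_combination h4 / 4 + h1 - h2

/-- The quotient of the upper half plane by a lattice is the union of a compact set and finitely
many cusp neighbourhoods, which can be chosen arbitrarily small. -/
theorem exists_isCompact_cusps {Γ : Subgroup SL(2, ℝ)} (hΓ : IsLattice Γ) :
    ∃ F : Set SL(2, ℝ), F.Finite ∧ (∀ p ∈ F, p * translation * p⁻¹ ∈ Γ) ∧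
      ∀ Y : ℝ, ∃ K : Set ℍ, IsCompact K ∧
        ∀ z : ℍ, ∃ γ ∈ Γ, γ • z ∈ K ∨ ∃ p ∈ F, Y ≤ (p⁻¹ • γ • z).im := by
  have := hΓ.1
  obtain ⟨F, hF, hFΓ, hFc⟩ := exists_finite_conj_smallElements hΓ (ε := 1 / 100) (by norm_num) le_rfl
  let disc : SL(2, ℝ) → ℝ := fun h => (h 0 0 - h 1 1) ^ 2 / 4 + h 0 1 * h 1 0
  let Fp := {h | h ∈ F ∧ 0 < h 0 0 + h 1 1 ∧ h ≠ 1 ∧ disc h = 0}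
  have hFp : Fp.Finite := hF.subset fun _ h => h.1
  have hch : ∀ h : SL(2, ℝ), ∃ p : SL(2, ℝ), h ∈ Fp →
      (h = p * translation * p⁻¹ ∨ h⁻¹ = p * translation * p⁻¹) := by
    intro h
    by_cases hh : h ∈ Fp
    · obtain ⟨p, hp⟩ := exists_conj_translation hh.2.1 hh.2.2.1 hh.2.2.2
      exact ⟨p, fun _ => hp⟩
    · exact ⟨1, fun h' => absurd h' hh⟩
  choose p hp using hch
  refine ⟨p '' Fp, hFp.image p, ?_, fun Y => ?_⟩
  · rintro _ ⟨h, hh, rfl⟩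
    rcases hp h hh with h1 | h1
    · rw [← h1]; exact hFΓ hh.1
    · rw [← h1]; exact Γ.inv_mem (hFΓ hh.1)
  -- Minimal small elements lie in finitely many conjugacy classes, so the nonzero discriminants
  -- among them are bounded away from zero.
  obtain ⟨κ, hκ0, hκ⟩ : ∃ κ > 0, ∀ h ∈ F, disc h ≠ 0 → κ ≤ |disc h| := by
    have hfin : ((fun h => |disc h|) '' {h | h ∈ F ∧ disc h ≠ 0}).Finite :=
      (hF.subset fun _ h => h.1).image _
    rcases Set.eq_empty_or_nonempty {h | h ∈ F ∧ disc h ≠ 0} with he | hne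
    · refine ⟨1, one_pos, fun h hh h0 => ?_⟩
      have : h ∈ {h | h ∈ F ∧ disc h ≠ 0} := ⟨hh, h0⟩
      rw [he] at this; exact this.elim
    · obtain ⟨h, hh, hmin⟩ := Set.exists_min_image _ (fun h => |disc h|)
        (hF.subset fun _ h => h.1 : {h | h ∈ F ∧ disc h ≠ 0}.Finite) hne
      exact ⟨|disc h|, abs_pos.mpr hh.2, fun k hk hk0 => hmin k ⟨hk, hk0⟩⟩
  -- The three bounds serve the commutator estimate, the exclusion of nonparabolic minimal elements,
  -- and a height of at least `Y` in the cusp.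
  set ε := min (1 / 100) (min κ (1 / (Y ^ 2 + 1))) with hεdef
  have hε0 : 0 < ε := by
    refine lt_min (by norm_num) (lt_min hκ0 (by positivity))
  obtain ⟨K, hK, hKΓ⟩ := exists_isCompact_of_isLattice hΓ (nearOne_mem_nhds hε0)
  refine ⟨(fun g : SL(2, ℝ) => g • I) '' K, hK.image (by fun_prop), fun z => ?_⟩
  obtain ⟨g, rfl⟩ : ∃ g : SL(2, ℝ), g • I = z := MulAction.exists_smul_eq SL(2, ℝ) I z
  rcases Set.eq_empty_or_nonempty (smallElements Γ ε g) with he | hne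
  · obtain ⟨γ, hγ, hγK⟩ := hKΓ g fun κ hκ hn => by
      by_contra h1
      have : κ ∈ smallElements Γ ε g := ⟨hκ, h1, hn⟩
      rw [he] at this
      exact this
    exact ⟨γ, hγ, Or.inl ⟨_, hγK, mul_smul _ _ _⟩⟩
  · obtain ⟨γ, hγ, hmin⟩ := exists_minimal_smallElements hne
    have hγ' : γ ∈ smallElements Γ (1 / 100) g :=
      ⟨hγ.1, hγ.2.1, hγ.2.2.1, hγ.2.2.2.trans_le (min_le_left _ _)⟩
    -- `γ` stays minimal among the elements below the larger bound `1/100`, which is the bound used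
    -- to define `F` independently of `Y`.
    obtain ⟨δ, hδ, hδF⟩ := hFc g γ hγ' fun ξ hξ => by
      by_cases h : tracelessNorm ((g⁻¹ * ξ * g : SL(2, ℝ)) : Matrix _ _ ℝ) < ε
      · exact hmin ξ ⟨hξ.1, hξ.2.1, hξ.2.2.1, h⟩
      · exact hγ.2.2.2.le.trans (not_lt.mp h)
    have htγ : 0 < γ 0 0 + γ 1 1 := by have := hγ.2.2.1; rwa [trace_conj] at this
    have hdisc : disc (δ * γ * δ⁻¹) = 0 := by
      by_contra h0
      have h1 := hκ _ hδF h0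
      have h2 := abs_disc_le_tracelessNorm ((g⁻¹ * γ * g : SL(2, ℝ)) : Matrix _ _ ℝ)
      have h3 := disc_conj g⁻¹ γ
      rw [inv_inv] at h3
      have h4 : disc (δ * γ * δ⁻¹) = disc γ := disc_conj δ γ
      rw [h3] at h2
      rw [h4] at h1
      have h5 : ε ≤ κ := (min_le_right _ _).trans (min_le_left _ _)
      exact absurd (h1.trans h2) (not_le.mpr (hγ.2.2.2.trans_le h5))
    have hmem : δ * γ * δ⁻¹ ∈ Fp := by
      refine ⟨hδF, ?_, fun h => hγ.2.1 ?_, hdisc⟩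
      · have := trace_conj δ⁻¹ γ
        rw [inv_inv] at this
        rwa [this]
      · have : γ = δ⁻¹ * (δ * γ * δ⁻¹) * δ := by group
        rw [this, h]; group
    refine ⟨δ, hδ, Or.inr ⟨_, ⟨_, hmem, rfl⟩, ?_⟩⟩
    set q := p (δ * γ * δ⁻¹) with hq
    rw [← mul_smul, ← mul_smul]
    set x := q⁻¹ * δ * g with hx
    have hnorm : tracelessNorm ((x⁻¹ * translation * x : SL(2, ℝ)) : Matrix _ _ ℝ) < ε := by
      rcases hp _ hmem with h | h
      · have : x⁻¹ * translation * x = g⁻¹ * γ * g := by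
          rw [hx, show (q⁻¹ * δ * g)⁻¹ * translation * (q⁻¹ * δ * g) =
            g⁻¹ * δ⁻¹ * (q * translation * q⁻¹) * δ * g by group, ← h]; group
        rw [this]; exact hγ.2.2.2
      · have : x⁻¹ * translation * x = (g⁻¹ * γ * g)⁻¹ := by
          rw [hx, show (q⁻¹ * δ * g)⁻¹ * translation * (q⁻¹ * δ * g) =
            g⁻¹ * δ⁻¹ * (q * translation * q⁻¹) * δ * g by group, ← h]; group
        rw [this, tracelessNorm_inv]; exact hγ.2.2.2
    have h1 := tracelessNorm_conj_translation x
    have him := (x • I : ℍ).im_pos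
    have h2 : ε ≤ 1 / (Y ^ 2 + 1) := (min_le_right _ _).trans (min_le_right _ _)
    have h3 : tracelessNorm ((x⁻¹ * translation * x : SL(2, ℝ)) : Matrix _ _ ℝ) * (Y ^ 2 + 1) < 1 := by
      rw [← lt_div_iff₀ (by positivity)]; exact hnorm.trans_le h2
    have h4 := tracelessNorm_nonneg ((x⁻¹ * translation * x : SL(2, ℝ)) : Matrix _ _ ℝ)
    by_contra hlt
    rw [not_le] at hlt
    have : (x • I : ℍ).im ^ 2 ≤ Y ^ 2 + 1 := by nlinarith
    nlinarith [mul_le_mul_of_nonneg_left this h4]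

end Cusps
end PLattice

namespace PLattice

open Topology MeasureTheory Pointwise Filter

/-! ### Maximum principles for the invariant norm -/

section HolomorphicBounds

lemma slash_mapGL_apply (k : ℤ) (f : ℍ → ℂ) (g : SL(2, ℝ)) (z : ℍ) :
    (f ∣[k] SpecialLinearGroup.mapGL ℝ g) z =
      f (g • z) * ((g 1 0 : ℂ) * z + g 1 1) ^ (-k) := by
  rw [ModularForm.slash_def]
  simp [UpperHalfPlane.σ, denom]
  exact Or.inl rfl

lemma denom_ne_zero' (g : SL(2, ℝ)) (z : ℍ) : (g 1 0 : ℂ) * z + g 1 1 ≠ 0 := by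
  simpa [denom] using denom_ne_zero (SpecialLinearGroup.mapGL ℝ g) z

/-- The invariant function `|f(z)|² (Im z)ᵏ` attached to a form of weight `k`. -/
def invariantNorm (k : ℕ) (f : ℍ → ℂ) (z : ℍ) : ℝ := ‖f z‖ ^ 2 * z.im ^ k

/-- `Im(gz) = Im z / |cz+d|²` absorbs the squared automorphy factor. For a modular form the function
therefore descends to the quotient. -/
lemma invariantNorm_slash (k : ℕ) (f : ℍ → ℂ) (g : SL(2, ℝ)) (z : ℍ) :
    invariantNorm k (f ∣[(k : ℤ)] SpecialLinearGroup.mapGL ℝ g) z = invariantNorm k f (g • z) := by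
  have him : (g • z : ℍ).im = z.im / ‖(g 1 0 : ℂ) * z + g 1 1‖ ^ 2 := by
    rw [MulAction.compHom_smul_def, im_smul_eq_div_normSq, Complex.normSq_eq_norm_sq]
    simp [denom]
  have hne : ‖(g 1 0 : ℂ) * z + g 1 1‖ ≠ 0 := norm_ne_zero_iff.mpr (denom_ne_zero' g z)
  rw [invariantNorm, invariantNorm, slash_mapGL_apply, him, norm_mul, norm_zpow, _root_.zpow_neg,
    zpow_natCast, div_pow]
  field_simp
  ring

lemma invariantNorm_nonneg (k : ℕ) (f : ℍ → ℂ) (z : ℍ) : 0 ≤ invariantNorm k f z := by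
  have := z.im_pos
  unfold invariantNorm; positivity

lemma translation_smul (z : ℍ) : ((translation • z : ℍ) : ℂ) = z + 1 := by
  rw [UpperHalfPlane.coe_specialLinearGroup_apply]
  simp [coe_translation]

lemma slash_translation_apply (k : ℤ) (f : ℍ → ℂ) (z : ℍ) :
    (f ∣[k] SpecialLinearGroup.mapGL ℝ translation) z = f (translation • z) := by
  rw [slash_mapGL_apply]
  simp [coe_translation]

/-- Schwarz lemma for a holomorphic function on the upper half plane with a multiple zero. -/
lemma norm_le_of_derivAt_eq_zero (h : Hol) (z₀ : ℍ) (n : ℕ) (h0 : ∀ j ≤ n, derivAt j z₀ h = 0)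
    {R M : ℝ} (hR : R ≤ z₀.im)
    (hM : ∀ w : ℍ, dist (w : ℂ) z₀ < R → ‖(h : ℍ → ℂ) w‖ ≤ M) (z : ℍ) (hz : dist (z : ℂ) z₀ < R) :
    ‖(h : ℍ → ℂ) z‖ ≤ M * (dist (z : ℂ) z₀ / R) ^ (n + 1) := by
  set f := (h : ℍ → ℂ) ∘ ofComplex with hf
  have hball : Metric.ball (z₀ : ℂ) R ⊆ upperHalfPlaneSet := by
    intro w hw
    have h1 : |(w - z₀).im| ≤ ‖w - z₀‖ := Complex.abs_im_le_norm _
    rw [Metric.mem_ball, dist_eq_norm] at hw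
    have h2 := (abs_le.mp (h1.trans hw.le)).1
    have h3 := (abs_lt.mp (h1.trans_lt hw)).1
    rw [Complex.sub_im] at h3
    change 0 < w.im
    have : (z₀ : ℂ).im = z₀.im := rfl
    linarith
  have hd := UpperHalfPlane.mdifferentiable_iff.mp h.2
  have hv : ∀ w : ℍ, f w = (h : ℍ → ℂ) w := fun w => by simp [hf]
  have hf0 : f z₀ = 0 := by simpa [derivAt, hv] using h0 0 (Nat.zero_le _)
  have han : AnalyticAt ℂ f z₀ :=
    hd.analyticAt (isOpen_upperHalfPlaneSet.mem_nhds z₀.im_pos)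
  -- Vanishing Taylor coefficients up to order `n` give this decay, which is the hypothesis of the
  -- higher-order Schwarz lemma.
  have hO : (fun w => f w - f z₀) =o[𝓝 (z₀ : ℂ)] fun w => ‖w - z₀‖ ^ n := by
    have hp := han.hasFPowerSeriesAt
    have h1 := hp.isBigO_sub_partialSum_pow (n + 1)
    have h2 : ∀ y, FormalMultilinearSeries.partialSum (FormalMultilinearSeries.ofScalars ℂ
        (fun n => iteratedDeriv n f z₀ / n.factorial)) (n + 1) y = 0 := by
      intro y
      refine Finset.sum_eq_zero fun j hj => ?_
      have : iteratedDeriv j f z₀ = 0 := h0 j (Nat.lt_succ_iff.mp (Finset.mem_range.mp hj))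
      simp [this]
    simp only [h2, sub_zero] at h1
    have h3 : (fun w => f w - f z₀) =O[𝓝 (z₀ : ℂ)] fun w => ‖w - z₀‖ ^ (n + 1) := by
      have ht : Tendsto (fun w : ℂ => w - z₀) (𝓝 (z₀ : ℂ)) (𝓝 0) := by
        have : Continuous fun w : ℂ => w - z₀ := by fun_prop
        simpa using this.tendsto (z₀ : ℂ)
      simpa [Function.comp_def, hf0] using h1.comp_tendsto ht
    refine h3.trans_isLittleO ?_
    have ht : Tendsto (fun w : ℂ => ‖w - z₀‖) (𝓝 (z₀ : ℂ)) (𝓝 0) := by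
      have : Continuous fun w : ℂ => ‖w - z₀‖ := by fun_prop
      simpa using this.tendsto (z₀ : ℂ)
    exact (Asymptotics.isLittleO_pow_pow (Nat.lt_succ_self n)).comp_tendsto ht
  have hmaps : Set.MapsTo f (Metric.ball (z₀ : ℂ) R) (Metric.closedBall (f z₀) M) := by
    intro w hw
    rw [hf0, mem_closedBall_zero_iff, ← UpperHalfPlane.coe_mk w (hball hw), hv]
    exact hM _ hw
  have := Complex.dist_le_mul_div_pow_of_mapsTo_ball_of_isLittleO
    (hd.mono hball) hmaps hO (z := (z : ℂ)) hz
  change dist (f z) (f z₀) ≤ _ at this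
  rwa [hf0, dist_zero_right, hv] at this

lemma periodic_comp_ofComplex {f : ℍ → ℂ} (hper : ∀ z, f (translation • z) = f z) :
    Function.Periodic (f ∘ ofComplex) (1 : ℝ) := by
  intro w
  by_cases! hw : 0 < w.im
  · have hw1 : 0 < (w + (1 : ℝ)).im := by simpa using hw
    simp only [Function.comp_apply, ofComplex_apply_of_im_pos hw1, ofComplex_apply_of_im_pos hw]
    rw [← hper ⟨w, hw⟩]
    congr 1
    ext
    rw [translation_smul]
    simp
  · have hw1 : (w + (1 : ℝ)).im ≤ 0 := by simpa using hw
    simp only [Function.comp_apply]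
    rw [ofComplex_apply_of_im_nonpos hw1, ofComplex_apply_of_im_nonpos hw]

/-- In the variable `q = exp(2πiz)` a bounded periodic function extends holomorphically over `q =
0`, and its value there is the limit. -/
lemma tendsto_valueAtInfty {f : ℍ → ℂ} (hf : MDiff f) (hper : ∀ z, f (translation • z) = f z)
    (hb : IsBoundedAtImInfty f) : Tendsto f atImInfty (𝓝 (valueAtInfty f)) := by
  have hper' := periodic_comp_ofComplex hper
  have han := analyticAt_cuspFunction_zero one_pos hper' hf hb
  rw [← cuspFunction_apply_zero one_pos han hper']
  have := han.continuousAt.tendsto.comp (qParam_tendsto_atImInfty one_pos)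
  refine this.congr fun τ => ?_
  exact UpperHalfPlane.eq_cuspFunction τ one_ne_zero hper'

/-- Maximum principle in a cusp neighbourhood for a periodic function vanishing at infinity. -/
lemma norm_le_exp_of_isZeroAtImInfty {f : ℍ → ℂ} (hf : MDiff f)
    (hper : ∀ z, f (translation • z) = f z) (h0 : IsZeroAtImInfty f) {Y M : ℝ} (hY : 0 < Y)
    (hM : ∀ w : ℍ, w.im = Y → ‖f w‖ ≤ M) (z : ℍ) (hz : Y ≤ z.im) :
    ‖f z‖ ≤ M * Real.exp (-2 * Real.pi * (z.im - Y)) := by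
  rcases hz.eq_or_lt with hz | hz
  · rw [← hz]; simpa using hM z hz.symm
  have hper' := periodic_comp_ofComplex hper
  have hbd : IsBoundedAtImInfty f := h0.isBoundedAtImInfty
  set c := cuspFunction 1 f with hc
  have hdiff : ∀ q : ℂ, ‖q‖ < 1 → DifferentiableAt ℂ c q := fun q hq =>
    UpperHalfPlane.differentiableAt_cuspFunction one_pos hper' hf hbd hq
  have hc0 : c 0 = 0 := h0.cuspFunction_apply_zero one_pos
  have hcq : ∀ τ : ℍ, c (Function.Periodic.qParam 1 τ) = f τ := fun τ =>
    UpperHalfPlane.eq_cuspFunction τ one_ne_zero hper'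
  set r := Real.exp (-2 * Real.pi * Y) with hr
  have hr0 : 0 < r := Real.exp_pos _
  have hr1 : r < 1 := by
    rw [hr, ← Real.exp_zero]; exact Real.exp_lt_exp.mpr (by nlinarith [Real.pi_pos])
  have hsub : Metric.closedBall (0 : ℂ) r ⊆ Metric.ball 0 1 := Metric.closedBall_subset_ball hr1
  have hsphere : ∀ q ∈ frontier (Metric.ball (0 : ℂ) r), ‖c q‖ ≤ M := by
    intro q hq
    rw [frontier_ball _ hr0.ne', mem_sphere_zero_iff_norm] at hq
    have hq0 : q ≠ 0 := by rintro rfl; simp at hq; exact hr0.ne hq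
    have him : (Function.Periodic.invQParam 1 q).im = Y := by
      rw [Function.Periodic.im_invQParam, hq, hr, Real.log_exp]
      field_simp
    have hpos : 0 < (Function.Periodic.invQParam 1 q).im := by rw [him]; exact hY
    have h1 := hcq ⟨_, hpos⟩
    rw [UpperHalfPlane.coe_mk, Function.Periodic.qParam_right_inv one_ne_zero hq0] at h1
    rw [h1]
    exact hM _ him
  have hball : ∀ q ∈ closure (Metric.ball (0 : ℂ) r), ‖c q‖ ≤ M := fun q hq => by
    refine Complex.norm_le_of_forall_mem_frontier_norm_le Metric.isBounded_ball
      (DifferentiableOn.diffContOnCl ?_) hsphere hq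
    rw [closure_ball _ hr0.ne']
    intro x hx
    exact (hdiff x (by simpa using hsub hx)).differentiableWithinAt
  have hq : ‖Function.Periodic.qParam 1 (z : ℂ)‖ = Real.exp (-2 * Real.pi * z.im) := by
    rw [Function.Periodic.norm_qParam]; simp
  have hmem : Function.Periodic.qParam 1 (z : ℂ) ∈ Metric.ball (0 : ℂ) r := by
    rw [mem_ball_zero_iff, hq, hr]
    exact Real.exp_lt_exp.mpr (by nlinarith [Real.pi_pos])
  -- Schwarz's lemma on `|q| < r`, whose boundary circle is the horocycle `Im z = Y`; the bound `M`
  -- holds inside by the maximum principle.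
  have := Complex.dist_le_div_mul_dist_of_mapsTo_ball (f := c) (c := 0) (R₁ := r) (R₂ := M)
    (z := Function.Periodic.qParam 1 (z : ℂ))
    (fun x hx => (hdiff x (by
      simpa using hsub (Metric.ball_subset_closedBall hx))).differentiableWithinAt)
    (fun x hx => by
      rw [hc0, mem_closedBall_zero_iff]; exact hball x (subset_closure hx)) hmem
  rw [hc0, dist_zero_right, dist_zero_right, hcq, hq, hr] at this
  refine this.trans_eq ?_
  rw [div_mul_eq_mul_div, mul_div_assoc, ← Real.exp_sub]
  congr 2
  ring

/-- The invariant norm of a form vanishing at a cusp is maximal on the boundary of a sufficiently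
small cusp neighbourhood. -/
lemma invariantNorm_le_of_isZeroAtImInfty {k : ℕ} {f : ℍ → ℂ} (hf : MDiff f)
    (hper : ∀ z, f (translation • z) = f z) (h0 : IsZeroAtImInfty f) {Y S : ℝ} (hY : k + 1 ≤ Y)
    (hM : ∀ w : ℍ, w.im = Y → invariantNorm k f w ≤ S) (z : ℍ) (hz : Y ≤ z.im) :
    invariantNorm k f z ≤ S := by
  have hY0 : 0 < Y := by have : (0 : ℝ) ≤ k := Nat.cast_nonneg k; linarith
  have hS0 : 0 ≤ S := (invariantNorm_nonneg k f _).trans (hM ⟨Complex.I * Y, by simpa using hY0⟩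
    (by change (Complex.I * Y).im = Y; simp))
  have hb : ∀ w : ℍ, w.im = Y → ‖f w‖ ≤ √(S / Y ^ k) := by
    intro w hw
    refine Real.le_sqrt_of_sq_le ?_
    rw [le_div_iff₀ (by positivity), ← hw]
    exact hM w hw
  have h1 := norm_le_exp_of_isZeroAtImInfty hf hper h0 hY0 hb z hz
  have h2 : ‖f z‖ ^ 2 ≤ S / Y ^ k * Real.exp (-(z.im - Y)) := by
    calc ‖f z‖ ^ 2 ≤ (√(S / Y ^ k) * Real.exp (-2 * Real.pi * (z.im - Y))) ^ 2 := by gcongr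
      _ = S / Y ^ k * Real.exp (2 * (-2 * Real.pi * (z.im - Y))) := by
        rw [mul_pow, Real.sq_sqrt (by positivity), ← Real.exp_nat_mul]; norm_num
      _ ≤ _ := by
        gcongr
        nlinarith [Real.pi_gt_three, sub_nonneg.mpr hz]
  -- Since `k ≤ Y`, the growth of `y^k` above height `Y` is beaten by the exponential decay of `f`.
  have h3 : (z.im / Y) ^ k ≤ Real.exp (z.im - Y) := by
    have h4 : z.im / Y ≤ Real.exp ((z.im - Y) / Y) := by
      have := Real.add_one_le_exp ((z.im - Y) / Y)
      rwa [show (z.im - Y) / Y + 1 = z.im / Y by field_simp; ring] at this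
    calc (z.im / Y) ^ k ≤ Real.exp ((z.im - Y) / Y) ^ k :=
          pow_le_pow_left₀ (div_nonneg z.im_pos.le hY0.le) h4 k
      _ = Real.exp (k * ((z.im - Y) / Y)) := by rw [← Real.exp_nat_mul]
      _ ≤ _ := by
        refine Real.exp_le_exp.mpr ?_
        rw [mul_div_assoc', div_le_iff₀ hY0]
        nlinarith [sub_nonneg.mpr hz]
  calc invariantNorm k f z = ‖f z‖ ^ 2 * z.im ^ k := rfl
    _ ≤ S / Y ^ k * Real.exp (-(z.im - Y)) * z.im ^ k := by
      have := z.im_pos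
      gcongr
    _ = S * Real.exp (-(z.im - Y)) * (z.im / Y) ^ k := by rw [div_pow]; ring
    _ ≤ S * Real.exp (-(z.im - Y)) * Real.exp (z.im - Y) := by gcongr
    _ = S := by rw [mul_assoc, ← Real.exp_add]; simp

/-- Local bound of the invariant norm near a multiple zero. -/
lemma invariantNorm_le_of_derivAt_eq_zero {k : ℕ} (h : Hol) (z₀ : ℍ)
    (h0 : ∀ j ≤ k, derivAt j z₀ h = 0) {S : ℝ} (hS : ∀ w, invariantNorm k (h : ℍ → ℂ) w ≤ S)
    (z : ℍ) (hz : dist (z : ℂ) z₀ < z₀.im / 4) : invariantNorm k (h : ℍ → ℂ) z ≤ S / 4 := by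
  have hy := z₀.im_pos
  have hS0 : 0 ≤ S := (invariantNorm_nonneg k _ z).trans (hS z)
  have him : ∀ w : ℍ, |w.im - z₀.im| ≤ dist (w : ℂ) z₀ := fun w => by
    have := Complex.abs_im_le_norm ((w : ℂ) - z₀)
    rwa [Complex.sub_im, ← dist_eq_norm] at this
  have hM : ∀ w : ℍ, dist (w : ℂ) z₀ < z₀.im / 2 → ‖(h : ℍ → ℂ) w‖ ≤ √(S / (z₀.im / 2) ^ k) := by
    intro w hw
    refine Real.le_sqrt_of_sq_le ?_
    rw [le_div_iff₀ (by positivity)]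
    refine le_trans ?_ (hS w)
    have := (abs_le.mp ((him w).trans hw.le)).1
    unfold invariantNorm
    gcongr
    linarith
  have h1 := norm_le_of_derivAt_eq_zero h z₀ k h0 (by linarith) hM z (by linarith)
  have h2 : dist (z : ℂ) z₀ / (z₀.im / 2) ≤ 1 / 2 := by
    rw [div_le_iff₀ (by positivity)]; linarith
  have h3 : ‖(h : ℍ → ℂ) z‖ ≤ √(S / (z₀.im / 2) ^ k) * (1 / 2) ^ (k + 1) :=
    h1.trans (mul_le_mul_of_nonneg_left (pow_le_pow_left₀ (by positivity) h2 _)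
      (Real.sqrt_nonneg _))
  have h4 : z.im ≤ 3 * (z₀.im / 2) := by
    have := (abs_le.mp ((him z).trans hz.le)).2
    linarith
  have h5 : ((3 : ℝ) / 4) ^ k ≤ 1 := pow_le_one₀ (by norm_num) (by norm_num)
  have hz0 := z.im_pos
  -- The zero of order at least `k + 1` gains `4^{-(k+1)}` at half the radius, while `y^k` varies by
  -- a factor of at most `3^k`. The product is at most `1/4`.
  calc invariantNorm k (h : ℍ → ℂ) z
      ≤ (√(S / (z₀.im / 2) ^ k) * (1 / 2) ^ (k + 1)) ^ 2 * (3 * (z₀.im / 2)) ^ k := by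
        unfold invariantNorm; gcongr
    _ = S * (3 / 4) ^ k / 4 := by
        rw [mul_pow, Real.sq_sqrt (by positivity), mul_pow 3, ← pow_mul, mul_comm (k + 1) 2,
          pow_mul, pow_succ, div_pow 3 4]
        field_simp
        norm_num
        rw [mul_assoc, ← mul_pow]
        norm_num
    _ ≤ S / 4 := by nlinarith

end HolomorphicBounds
end PLattice

namespace PLattice

open Topology MeasureTheory Pointwise Filter

/-! ### Finite dimensionality of the classical spaces -/

section FiniteDimension

open OnePoint in
lemma isParabolic_conj_translation (p : SL(2, ℝ)) :
    (SpecialLinearGroup.mapGL ℝ (p * translation * p⁻¹)).IsParabolic := by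
  rw [map_mul, map_mul, map_inv]
  suffices (SpecialLinearGroup.mapGL ℝ translation).IsParabolic by simpa
  refine ⟨fun ⟨a, ha⟩ => zero_ne_one' ℝ ?_, ?_⟩
  · simpa [coe_translation] using congr_fun₂ ha 0 1
  · simp [discr_fin_two, trace_fin_two, det_fin_two, coe_translation]
    norm_num

open OnePoint in
lemma conj_translation_smul (p : SL(2, ℝ)) :
    SpecialLinearGroup.mapGL ℝ (p * translation * p⁻¹) • (SpecialLinearGroup.mapGL ℝ p • ∞) =
      SpecialLinearGroup.mapGL ℝ p • (∞ : OnePoint ℝ) := by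
  rw [← mul_smul, ← map_mul, inv_mul_cancel_right, map_mul, mul_smul]
  congr 1
  rw [smul_infty_eq_self_iff]
  simp [coe_translation]

open OnePoint in
lemma isCusp_of_conj_translation_mem {Γ : Subgroup SL(2, ℝ)} {p : SL(2, ℝ)}
    (hp : p * translation * p⁻¹ ∈ Γ) :
    IsCusp (SpecialLinearGroup.mapGL ℝ p • ∞) (Γ.map (SpecialLinearGroup.mapGL ℝ)) :=
  ⟨_, Subgroup.mem_map_of_mem _ hp, isParabolic_conj_translation p, conj_translation_smul p⟩

open OnePoint in
/-- Every cusp is represented by a conjugate of the translation. -/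
lemma exists_conj_translation_of_isCusp {Γ : Subgroup SL(2, ℝ)} {c : OnePoint ℝ}
    (hc : IsCusp c (Γ.map (SpecialLinearGroup.mapGL ℝ))) :
    ∃ p : SL(2, ℝ), p * translation * p⁻¹ ∈ Γ ∧ SpecialLinearGroup.mapGL ℝ p • ∞ = c := by
  obtain ⟨_, ⟨γ, hγ, rfl⟩, hpar, hfix⟩ := hc
  -- A parabolic `γ` may have trace `-2`; its square always has trace `2`, so it is conjugate to the
  -- translation or its inverse.
  have hfix2 : SpecialLinearGroup.mapGL ℝ (γ ^ 2) • c = c := by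
    rw [map_pow, pow_two, mul_smul, hfix, hfix]
  have hpar2 := hpar.pow two_ne_zero
  rw [← map_pow] at hpar2
  have hdet := det_SL2 γ
  have hdet2 := det_SL2 (γ ^ 2)
  have htr : (γ ^ 2) 0 0 + (γ ^ 2) 1 1 = (γ 0 0 + γ 1 1) ^ 2 - 2 := by
    rw [pow_two γ, Matrix.SpecialLinearGroup.coe_mul, Matrix.mul_apply, Matrix.mul_apply]
    simp only [Fin.sum_univ_two]
    linear_combination -2 * hdet
  have hd := hpar.2
  simp only [discr_fin_two, trace_fin_two, det_fin_two, SpecialLinearGroup.mapGL_coe_matrix,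
    SpecialLinearGroup.map_apply_coe, RingHom.mapMatrix_apply, Matrix.map_apply,
    Algebra.algebraMap_self, RingHom.id_apply] at hd
  have hd2 := hpar2.2
  simp only [discr_fin_two, trace_fin_two, det_fin_two, SpecialLinearGroup.mapGL_coe_matrix,
    SpecialLinearGroup.map_apply_coe, RingHom.mapMatrix_apply, Matrix.map_apply,
    Algebra.algebraMap_self, RingHom.id_apply] at hd2
  have hne : γ ^ 2 ≠ 1 := by
    intro h
    refine hpar2.1 ⟨1, ?_⟩
    rw [h]; simp
  obtain ⟨p, hp⟩ := exists_conj_translation (h := γ ^ 2) (by rw [htr]; nlinarith) hne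
    (by linear_combination hd2 / 4)
  have hfixp : SpecialLinearGroup.mapGL ℝ (p * translation * p⁻¹) • c = c := by
    rcases hp with h | h
    · rw [← h, hfix2]
    · rw [← h, map_inv, inv_smul_eq_iff, hfix2]
  refine ⟨p, ?_, ?_⟩
  · rcases hp with h | h
    · rw [← h]; exact Γ.pow_mem hγ 2
    · rw [← h]; exact Γ.inv_mem (Γ.pow_mem hγ 2)
  · have hpp := isParabolic_conj_translation p
    rw [hpp.smul_eq_self_iff.mp (conj_translation_smul p), ← hpp.smul_eq_self_iff.mp hfixp]

variable {Γ : Subgroup SL(2, ℝ)} {k : ℕ}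

lemma slash_conj_translation {p : SL(2, ℝ)} (hp : p * translation * p⁻¹ ∈ Γ) {f : ℍ → ℂ}
    (hf : ∀ γ ∈ Γ, f ∣[(k : ℤ)] SpecialLinearGroup.mapGL ℝ γ = f) (z : ℍ) :
    (f ∣[(k : ℤ)] SpecialLinearGroup.mapGL ℝ p) (translation • z) =
      (f ∣[(k : ℤ)] SpecialLinearGroup.mapGL ℝ p) z := by
  rw [← slash_translation_apply k (f ∣[(k : ℤ)] SpecialLinearGroup.mapGL ℝ p) z,
    ← SlashAction.slash_mul, ← map_mul,
    show p * translation = p * translation * p⁻¹ * p by group, map_mul, SlashAction.slash_mul,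
    hf _ hp]

lemma slash_eq_of_mem (f : ModularForm (Γ.map (SpecialLinearGroup.mapGL ℝ)) k) (γ : SL(2, ℝ))
    (hγ : γ ∈ Γ) : (f : ℍ → ℂ) ∣[(k : ℤ)] SpecialLinearGroup.mapGL ℝ γ = f :=
  f.slash_action_eq' _ (Subgroup.mem_map_of_mem _ hγ)

lemma isBoundedAtImInfty_slash (f : ModularForm (Γ.map (SpecialLinearGroup.mapGL ℝ)) k)
    {p : SL(2, ℝ)} (hp : p * translation * p⁻¹ ∈ Γ) :
    IsBoundedAtImInfty ((f : ℍ → ℂ) ∣[(k : ℤ)] SpecialLinearGroup.mapGL ℝ p) :=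
  f.bdd_at_cusps' (isCusp_of_conj_translation_mem hp) _ rfl

lemma mdiff_slash {f : ℍ → ℂ} (hf : MDiff f) (p : SL(2, ℝ)) :
    MDiff (f ∣[(k : ℤ)] SpecialLinearGroup.mapGL ℝ p) := MDifferentiable.slash hf _ _

/-- A modular form as a holomorphic function. -/
def modularFormToHol (Γ : Subgroup SL(2, ℝ)) (k : ℕ) :
    ModularForm (Γ.map (SpecialLinearGroup.mapGL ℝ)) k →ₗ[ℂ] Hol where
  toFun f := ⟨f, f.holo'⟩
  map_add' _ _ := rfl
  map_smul' _ _ := rfl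

/-- The value of a modular form at a cusp. -/
def valueAtCusp (k : ℕ) {p : SL(2, ℝ)} (hp : p * translation * p⁻¹ ∈ Γ) :
    ModularForm (Γ.map (SpecialLinearGroup.mapGL ℝ)) k →ₗ[ℂ] ℂ where
  toFun f := valueAtInfty ((f : ℍ → ℂ) ∣[(k : ℤ)] SpecialLinearGroup.mapGL ℝ p)
  map_add' f g := by
    have hf := tendsto_valueAtInfty (mdiff_slash (ModularFormClass.holo f) p)
      (slash_conj_translation hp (slash_eq_of_mem f))
        (isBoundedAtImInfty_slash f hp)
    have hg := tendsto_valueAtInfty (mdiff_slash (ModularFormClass.holo g) p)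
      (slash_conj_translation hp (slash_eq_of_mem g)) (isBoundedAtImInfty_slash g hp)
    refine Tendsto.limUnder_eq ?_
    rw [FunLike.coe_add, SlashAction.add_slash]
    exact hf.add hg
  map_smul' c f := by
    have hf := tendsto_valueAtInfty (mdiff_slash (ModularFormClass.holo f) p)
      (slash_conj_translation hp (slash_eq_of_mem f))
        (isBoundedAtImInfty_slash f hp)
    refine Tendsto.limUnder_eq ?_
    have : (⇑(c • f) : ℍ → ℂ) ∣[(k : ℤ)] SpecialLinearGroup.mapGL ℝ p =
        c • ((f : ℍ → ℂ) ∣[(k : ℤ)] SpecialLinearGroup.mapGL ℝ p) := by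
      rw [FunLike.coe_smul, ModularForm.smul_slash]
      simp [UpperHalfPlane.σ]
    rw [this]
    exact hf.const_mul c

/-- Finite dimensionality of the space of modular forms for a lattice. -/
theorem finite_modularForm (hΓ : IsLattice Γ) (k : ℕ) :
    Module.Finite ℂ (ModularForm (Γ.map (SpecialLinearGroup.mapGL ℝ)) k) := by
  obtain ⟨F, hF, hFΓ, hcov⟩ := exists_isCompact_cusps hΓ
  obtain ⟨K, hK, hKcov⟩ := hcov (k + 1)
  have hY0 : (0 : ℝ) < k + 1 := by positivity
  let seg : ℝ → ℍ := fun x => ⟨x + (k + 1 : ℝ) * Complex.I, by simpa using hY0⟩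
  have hseg : Continuous seg := by
    refine UpperHalfPlane.isEmbedding_coe.continuous_iff.mpr ?_
    change Continuous fun x : ℝ => (x : ℂ) + (k + 1 : ℝ) * Complex.I
    fun_prop
  -- One period of each boundary horocycle is added, at height `k + 1`, where the cusp maximum
  -- principle becomes available.
  set K' : Set ℍ := K ∪ ⋃ p ∈ F, p • (seg '' Set.Icc 0 1) with hK'def
  have hK' : IsCompact K' :=
    hK.union (hF.isCompact_biUnion fun p _ => (isCompact_Icc.image hseg).smul p)
  obtain ⟨t, ht, htK⟩ := hK'.elim_finite_subcover_image (b := Set.univ)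
    (c := fun z₀ : ℍ => {z : ℍ | dist (z : ℂ) z₀ < z₀.im / 4})
    (fun z₀ _ => isOpen_lt (by fun_prop) continuous_const)
    (fun z _ => by
      simp only [Set.mem_iUnion]
      exact ⟨z, Set.mem_univ _, by
        change dist (z : ℂ) z < z.im / 4
        rw [dist_self]; have := z.im_pos; positivity⟩)
  obtain ⟨htf, htK⟩ := htK
  have : Finite t := htf
  have : Finite F := hF
  -- Finitely many linear conditions: Taylor coefficients up to order `k` at the centres of the
  -- cover, and the values at the cusps. They suffice to determine the form.
  let Φ : ModularForm (Γ.map (SpecialLinearGroup.mapGL ℝ)) k →ₗ[ℂ]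
      ((t × Fin (k + 1)) ⊕ F → ℂ) := LinearMap.pi fun i =>
    Sum.elim (fun a => derivAt a.2 (a.1 : ℍ) ∘ₗ modularFormToHol Γ k)
      (fun p => valueAtCusp k (hFΓ p.1 p.2)) i
  refine Module.Finite.of_injective Φ ?_
  rw [← LinearMap.ker_eq_bot, LinearMap.ker_eq_bot']
  intro f hf
  have hder : ∀ z₀ ∈ t, ∀ j ≤ k, derivAt j z₀ (modularFormToHol Γ k f) = 0 := fun z₀ hz₀ j hj =>
    congrFun hf (Sum.inl (⟨z₀, hz₀⟩, ⟨j, Nat.lt_succ_of_le hj⟩))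
  have hcusp : ∀ p ∈ F, IsZeroAtImInfty ((f : ℍ → ℂ) ∣[(k : ℤ)] SpecialLinearGroup.mapGL ℝ p) := by
    intro p hp
    have h1 : valueAtInfty ((f : ℍ → ℂ) ∣[(k : ℤ)] SpecialLinearGroup.mapGL ℝ p) = 0 :=
      congrFun hf (Sum.inr ⟨p, hp⟩)
    have h2 := tendsto_valueAtInfty (mdiff_slash (ModularFormClass.holo f) p)
      (slash_conj_translation (hFΓ p hp) (slash_eq_of_mem f))
        (isBoundedAtImInfty_slash f (hFΓ p hp))
    rwa [h1] at h2
  have hinv : ∀ γ ∈ Γ, ∀ z, invariantNorm k f (γ • z) = invariantNorm k f z := by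
    intro γ hγ z
    rw [← invariantNorm_slash, slash_eq_of_mem f γ hγ]
  have hcont : Continuous (invariantNorm k f) := by
    have h1 : Continuous (f : ℍ → ℂ) := ModularFormClass.continuous f
    exact ((h1.norm.pow 2).mul (UpperHalfPlane.continuous_im.pow k))
  -- a bound on the compact set is a global bound
  have hglob : ∀ S, (∀ z ∈ K', invariantNorm k f z ≤ S) → ∀ z, invariantNorm k f z ≤ S := by
    intro S hS z
    obtain ⟨γ, hγ, h | ⟨p, hp, h⟩⟩ := hKcov z
    · rw [← hinv γ hγ]; exact hS _ (Or.inl h)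
    · have hper := slash_conj_translation (hFΓ p hp) (slash_eq_of_mem f)
      have hperZ : ∀ (n : ℤ) (w : ℍ),
          invariantNorm k ((f : ℍ → ℂ) ∣[(k : ℤ)] SpecialLinearGroup.mapGL ℝ p)
            ((n : ℝ) +ᵥ w) =
          invariantNorm k ((f : ℍ → ℂ) ∣[(k : ℤ)] SpecialLinearGroup.mapGL ℝ p) w := by
        have h1 : ∀ w : ℍ, (1 : ℝ) +ᵥ w = translation • w := fun w => by
          ext; rw [translation_smul, coe_vadd]; push_cast; ring
        have hone : ∀ w : ℍ,
            invariantNorm k ((f : ℍ → ℂ) ∣[(k : ℤ)] SpecialLinearGroup.mapGL ℝ p) ((1 : ℝ) +ᵥ w) =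
            invariantNorm k ((f : ℍ → ℂ) ∣[(k : ℤ)] SpecialLinearGroup.mapGL ℝ p) w := by
          intro w
          have him : ((1 : ℝ) +ᵥ w).im = w.im := UpperHalfPlane.vadd_im _ _
          rw [invariantNorm, invariantNorm, him, h1, hper]
        intro n
        induction n using Int.induction_on with
        | zero => intro w; simp
        | succ i ih =>
          intro w
          rw [← ih w, ← hone ((((i : ℤ) : ℝ)) +ᵥ w)]
          congr 1
          rw [← add_vadd]; push_cast; rw [add_comm]
        | pred i ih =>
          intro w
          rw [← ih w, ← hone]
          congr 1
          rw [← add_vadd]; push_cast; congr 1; ring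
      have hline : ∀ w : ℍ, w.im = k + 1 →
          invariantNorm k ((f : ℍ → ℂ) ∣[(k : ℤ)] SpecialLinearGroup.mapGL ℝ p) w ≤ S := by
        intro w hw
        rw [← hperZ (-⌊w.re⌋) w, invariantNorm_slash]
        refine hS _ (Or.inr ?_)
        simp only [Set.mem_iUnion]
        refine ⟨p, hp, Set.smul_mem_smul_set ⟨w.re - ⌊w.re⌋, ?_, ?_⟩⟩
        · exact ⟨sub_nonneg.mpr (Int.floor_le _), by linarith [Int.lt_floor_add_one w.re]⟩
        · ext
          rw [coe_vadd]
          apply Complex.ext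
          · simp [seg, -Int.self_sub_floor]; ring
          · simp [seg, hw]
      have := invariantNorm_le_of_isZeroAtImInfty (mdiff_slash (ModularFormClass.holo f) p) hper
        (hcusp p hp)
        le_rfl hline _ h
      rw [invariantNorm_slash, smul_inv_smul, hinv γ hγ] at this
      exact this
  -- The maximum over `K'` is a global bound `S`. It is attained near one of the prescribed zeros,
  -- where the value is at most `S / 4`, so `S ≤ 0`.
  have hzero : ∀ z, invariantNorm k f z ≤ 0 := by
    rcases K'.eq_empty_or_nonempty with he | hne
    · exact hglob 0 fun z hz => by rw [he] at hz; exact hz.elim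
    · obtain ⟨z, hz, hmax⟩ := hK'.exists_isMaxOn hne hcont.continuousOn
      have h1 := hglob (invariantNorm k f z) fun w hw => hmax hw
      have h2 := htK hz
      simp only [Set.mem_iUnion] at h2
      obtain ⟨z₀, hz₀, h3⟩ := h2
      have h4 := invariantNorm_le_of_derivAt_eq_zero (modularFormToHol Γ k f) z₀ (hder z₀ hz₀)
        (S := invariantNorm k f z) h1 z h3
      have h5 : invariantNorm k f z ≤ invariantNorm k f z / 4 := h4
      intro w
      linarith [h1 w]
  refine ModularForm.ext fun z => ?_
  have h1 := hzero z
  have h2 : 0 < z.im ^ k := pow_pos z.im_pos k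
  unfold invariantNorm at h1
  have h3 : ‖f z‖ ^ 2 ≤ 0 := by
    by_contra h; rw [not_le] at h; nlinarith [mul_pos h h2]
  have h4 : ‖f z‖ = 0 := by nlinarith [sq_nonneg ‖f z‖]
  simpa using h4

/-- Finite dimensionality of the space of cusp forms for a lattice. -/
theorem finite_cuspForm (hΓ : IsLattice Γ) (k : ℕ) :
    Module.Finite ℂ (CuspForm (Γ.map (SpecialLinearGroup.mapGL ℝ)) k) := by
  have := finite_modularForm hΓ k
  let ι : CuspForm (Γ.map (SpecialLinearGroup.mapGL ℝ)) k →ₗ[ℂ]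
      ModularForm (Γ.map (SpecialLinearGroup.mapGL ℝ)) k :=
    { toFun := fun f => ⟨f.toSlashInvariantForm, f.holo', fun hc g hg =>
        (f.zero_at_cusps' hc g hg).isBoundedAtImInfty⟩
      map_add' := fun _ _ => rfl
      map_smul' := fun _ _ => rfl }
  refine Module.Finite.of_injective ι fun f g h => ?_
  ext z
  exact congrArg (fun F : ModularForm (Γ.map (SpecialLinearGroup.mapGL ℝ)) k => F z) h

end FiniteDimension
-- Leading forms on ideals and the leading coefficients of twists
section LeadingCoefficient

variable {P : Type*} [CommRing P] [Algebra ℝ P]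

/-- Application of a linear form on `P^ℂ` to the coefficients of a `P`-holomorphic function. -/
def coeffMap (l : PC P →ₗ[ℂ] ℂ) : PHol P →ₗ[ℂ] Hol :=
  (TensorProduct.lid ℂ Hol).toLinearMap ∘ₗ l.rTensor Hol

@[simp] lemma coeffMap_tmul (l : PC P →ₗ[ℂ] ℂ) (p : PC P) (h : Hol) :
    coeffMap l (p ⊗ₜ[ℂ] h) = l p • h := rfl

lemma derivAt_zero (z : ℍ) (h : Hol) : derivAt 0 z h = (h : ℍ → ℂ) z := by
  simp [derivAt]

lemma eval_tmul (z : ℍ) (p : PC P) (h : Hol) :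
    eval z (p ⊗ₜ[ℂ] h) = (h : ℍ → ℂ) z • p := by
  simp only [eval, LinearMap.liftBaseChange_tmul, LinearMap.comp_apply, derivAt_zero,
    Algebra.linearMap_apply, smul_eq_mul]
  rw [mul_comm]; exact (Algebra.smul_def _ _).symm

lemma evalDeriv_tmul (z : ℍ) (p : PC P) (h : Hol) :
    evalDeriv z (p ⊗ₜ[ℂ] h) = derivAt 1 z h • p := by
  simp only [evalDeriv, LinearMap.liftBaseChange_tmul, LinearMap.comp_apply,
    Algebra.linearMap_apply, smul_eq_mul]
  rw [mul_comm]; exact (Algebra.smul_def _ _).symm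

lemma apply_eval (l : PC P →ₗ[ℂ] ℂ) (z : ℍ) (f : PHol P) :
    l (eval z f) = (coeffMap l f : ℍ → ℂ) z := by
  induction f using TensorProduct.induction_on with
  | zero => simp
  | tmul p h => rw [eval_tmul, map_smul, coeffMap_tmul]; simp [mul_comm]
  | add x y hx hy => rw [map_add, map_add, map_add, hx, hy]; rfl

lemma apply_evalDeriv (l : PC P →ₗ[ℂ] ℂ) (z : ℍ) (f : PHol P) :
    l (evalDeriv z f) = derivAt 1 z (coeffMap l f) := by
  induction f using TensorProduct.induction_on with
  | zero => simp
  | tmul p h => rw [evalDeriv_tmul, map_smul, coeffMap_tmul, map_smul]; simp [mul_comm]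
  | add x y hx hy => rw [map_add, map_add, map_add, map_add, hx, hy]

/-- The `P`-holomorphic functions with coefficients in an ideal. -/
def coeffIn (J : Ideal (PC P)) : Submodule ℂ (PHol P) :=
  Submodule.span ℂ {f | ∃ p ∈ J, ∃ h : Hol, f = p ⊗ₜ[ℂ] h}

lemma tmul_mem_coeffIn {J : Ideal (PC P)} {p : PC P} (hp : p ∈ J) (h : Hol) :
    p ⊗ₜ[ℂ] h ∈ coeffIn J := Submodule.subset_span ⟨p, hp, h, rfl⟩

lemma coeffIn_top : coeffIn (⊤ : Ideal (PC P)) = ⊤ := by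
  rw [eq_top_iff]
  intro f _
  induction f using TensorProduct.induction_on with
  | zero => exact zero_mem _
  | tmul p h => exact tmul_mem_coeffIn Submodule.mem_top h
  | add x y hx hy => exact add_mem (hx trivial) (hy trivial)

lemma coeffIn_bot : coeffIn (⊥ : Ideal (PC P)) = ⊥ := by
  rw [coeffIn, Submodule.span_eq_bot]
  rintro _ ⟨p, hp, h, rfl⟩
  rw [(Submodule.mem_bot _).mp hp, TensorProduct.zero_tmul]

lemma slashReal_mem_coeffIn {J : Ideal (PC P)} (k : ℕ) (g : SL(2, ℝ)) {f : PHol P}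
    (hf : f ∈ coeffIn J) : slashReal k g f ∈ coeffIn J := by
  induction hf using Submodule.span_induction with
  | mem x hx =>
    obtain ⟨p, hp, h, rfl⟩ := hx
    rw [slashReal, LinearMap.baseChange_tmul]
    exact tmul_mem_coeffIn hp _
  | zero => rw [map_zero]; exact zero_mem _
  | add x y _ _ hx hy => rw [map_add]; exact add_mem hx hy
  | smul c x _ hx =>
    have : slashReal k g (c • x) = c • slashReal k g x :=
      ((slashReal k g).restrictScalars ℂ).map_smul c x
    rw [this]; exact Submodule.smul_mem _ _ hx

lemma coeffMap_slashReal (l : PC P →ₗ[ℂ] ℂ) (k : ℕ) (g : SL(2, ℝ)) (f : PHol P) :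
    coeffMap l (slashReal k g f) = slashHol k g (coeffMap l f) := by
  induction f using TensorProduct.induction_on with
  | zero => simp
  | tmul p h => rw [slashReal, LinearMap.baseChange_tmul, coeffMap_tmul, coeffMap_tmul, map_smul]
  | add x y hx hy => rw [map_add, map_add, map_add, map_add, hx, hy]

lemma evalPPoint_tmul (τ : ℍ) (a : PC P) (p : PC P) (h : Hol) :
    evalPPoint τ a (p ⊗ₜ[ℂ] h) =
      p * ∑ n ∈ Finset.range (nilpotencyClass (a - algebraMap ℂ (PC P) τ)),
        ((n.factorial : ℂ)⁻¹ * derivAt n τ h) • (a - algebraMap ℂ (PC P) τ) ^ n := by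
  simp only [evalPPoint, LinearMap.liftBaseChange_tmul, LinearMap.sum_apply, LinearMap.comp_apply,
    LinearMap.smul_apply, LinearMap.toSpanSingleton_apply, smul_eq_mul]

lemma finrank_PC : Module.finrank ℂ (PC P) = Module.finrank ℝ P :=
  Module.finrank_baseChange

variable [ParameterAlgebra P]

instance finite_PC : Module.Finite ℂ (PC P) :=
  haveI := ParameterAlgebra.finite (P := P)
  Module.Finite.base_change ℝ ℂ P

instance nontrivial_PC : Nontrivial (PC P) := (bodyC P).toRingHom.domain_nontrivial

lemma bodyC_tmul (c : ℂ) (p : P) :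
    bodyC P (c ⊗ₜ[ℝ] p) = c * (ParameterAlgebra.body p : ℝ) := by
  simp [bodyC, Algebra.TensorProduct.lift_tmul, Algebra.ofId_apply]

@[simp] lemma bodyC_incl (p : P) : bodyC P (incl p) = (ParameterAlgebra.body p : ℝ) := by
  rw [incl, Algebra.TensorProduct.includeRight_apply, bodyC_tmul, one_mul]

@[simp] lemma bodyC_algebraMap (c : ℂ) : bodyC P (algebraMap ℂ (PC P) c) = c :=
  (bodyC P).commutes c

@[simp] lemma bodyC_tmul_one (c : ℂ) : bodyC P (c ⊗ₜ[ℝ] (1 : P)) = c := bodyC_algebraMap c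

/-- The nilpotent ideal of all elements of `P^ℂ` with body zero. -/
abbrev nilIdeal (P : Type*) [CommRing P] [Algebra ℝ P] [ParameterAlgebra P] : Ideal (PC P) :=
  RingHom.ker (bodyC P)

lemma sub_bodyC_mem (x : PC P) :
    x - algebraMap ℂ (PC P) (bodyC P x) ∈
      Ideal.map (incl : P →ₐ[ℝ] PC P) (RingHom.ker (ParameterAlgebra.body (P := P))) := by
  induction x using TensorProduct.induction_on with
  | zero => simp
  | tmul c p =>
    have h1 : p - algebraMap ℝ P (ParameterAlgebra.body p) ∈
        RingHom.ker (ParameterAlgebra.body (P := P)) := by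
      simp [RingHom.mem_ker]
    have h2 := Ideal.mul_mem_left _ (algebraMap ℂ (PC P) c)
      (Ideal.mem_map_of_mem (incl : P →ₐ[ℝ] PC P) h1)
    convert h2 using 1
    rw [bodyC_tmul, map_sub, AlgHom.commutes, map_mul, mul_sub]
    congr 1
    rw [incl, Algebra.TensorProduct.includeRight_apply, Algebra.TensorProduct.algebraMap_apply,
      Algebra.TensorProduct.tmul_mul_tmul]
    simp
  | add x y hx hy =>
    have := add_mem hx hy
    convert this using 1
    rw [map_add, map_add]; ring

/-- The kernel of the complexified body map is contained in the extension of the kernel over `P`,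
which inherits nilpotency. -/
lemma isNilpotent_nilIdeal : IsNilpotent (nilIdeal P) := by
  obtain ⟨n, hn⟩ := ParameterAlgebra.nilpotent (P := P)
  refine ⟨n, ?_⟩
  have h1 : nilIdeal P ≤
      Ideal.map (incl : P →ₐ[ℝ] PC P) (RingHom.ker (ParameterAlgebra.body (P := P))) := by
    intro x hx
    have := sub_bodyC_mem x
    rwa [(RingHom.mem_ker).mp hx, map_zero, sub_zero] at this
  rw [Ideal.zero_eq_bot, eq_bot_iff]
  refine (Ideal.pow_right_mono h1 n).trans ?_
  rw [← Ideal.map_pow, hn, Ideal.zero_eq_bot, Ideal.map_bot]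

lemma isNilpotent_of_bodyC_eq_zero {x : PC P} (hx : bodyC P x = 0) : IsNilpotent x := by
  obtain ⟨n, hn⟩ := isNilpotent_nilIdeal (P := P)
  refine ⟨n, ?_⟩
  have := Ideal.pow_mem_pow (show x ∈ nilIdeal P from hx) n
  rwa [hn] at this

lemma isUnit_of_bodyC_ne_zero {x : PC P} (hx : bodyC P x ≠ 0) : IsUnit x := by
  have h1 : IsUnit (algebraMap ℂ (PC P) (bodyC P x)) := (isUnit_iff_ne_zero.mpr hx).map _
  have h2 : IsNilpotent (x - algebraMap ℂ (PC P) (bodyC P x)) :=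
    isNilpotent_of_bodyC_eq_zero (by simp)
  have := h2.isUnit_add_left_of_commute h1 (Commute.all _ _)
  simpa using this

lemma bodyC_inverse (x : PC P) : bodyC P (Ring.inverse x) = (bodyC P x)⁻¹ := by
  by_cases hx : bodyC P x = 0
  · have : ¬ IsUnit x := fun h => (h.map (bodyC P)).ne_zero hx
    rw [Ring.inverse_non_unit _ this, hx, map_zero, _root_.inv_zero]
  · have h := Ring.inverse_mul_cancel x (isUnit_of_bodyC_ne_zero hx)
    have := congrArg (bodyC P) h
    rw [map_mul, map_one] at this
    exact eq_inv_of_mul_eq_one_left this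

/-- A linear form vanishing on `nilIdeal P * J` is linear over `P^ℂ` on `J`. -/
lemma apply_mul_of_mem {J : Ideal (PC P)} {l : PC P →ₗ[ℂ] ℂ}
    (hl : ∀ x ∈ nilIdeal P, ∀ p ∈ J, l (x * p) = 0) {p : PC P} (hp : p ∈ J) (x : PC P) :
    l (p * x) = l p * bodyC P x := by
  have h1 := hl (x - algebraMap ℂ (PC P) (bodyC P x)) (by simp [RingHom.mem_ker]) p hp
  rw [sub_mul, map_sub, sub_eq_zero, ← Algebra.smul_def, map_smul] at h1
  rw [mul_comm p, h1, smul_eq_mul, mul_comm]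

/-- The space of linear forms detecting the leading coefficient of an ideal is nonzero. -/
lemma exists_leading_form {J : Ideal (PC P)} (hJ : J ≠ ⊥) :
    ∃ l : PC P →ₗ[ℂ] ℂ, (∀ x ∈ nilIdeal P, ∀ p ∈ J, l (x * p) = 0) ∧ ∃ p ∈ J, l p ≠ 0 := by
  -- Nakayama's lemma in its nilpotent form: iterating the inclusion would give `J = 0`. A form
  -- separating a point of `J` from the product ideal then does the job.
  have hlt : ¬ J ≤ nilIdeal P * J := by
    intro hle
    obtain ⟨n, hn⟩ := isNilpotent_nilIdeal (P := P)
    have : ∀ j, J ≤ nilIdeal P ^ j * J := by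
      intro j
      induction j with
      | zero => simp
      | succ j ih =>
        refine ih.trans ?_
        rw [pow_succ, mul_assoc]
        exact Ideal.mul_mono_right hle
    have h := this n
    rw [hn, Ideal.zero_eq_bot, Ideal.bot_mul] at h
    exact hJ (eq_bot_iff.mpr h)
  obtain ⟨p, hp, hpn⟩ := Set.not_subset.mp hlt
  obtain ⟨l, hl1, hl2⟩ := Submodule.exists_le_ker_of_notMem
    (p := (nilIdeal P * J).restrictScalars ℂ) (v := p) hpn
  exact ⟨l, fun x hx q hq => hl2 (Ideal.mul_mem_mul hx hq), p, hp, hl1⟩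

/-- The higher Taylor terms contain a power of the body-zero element `a - τ`, hence are invisible to
`l` on coefficients from `J`; only the value at the body survives. -/
lemma apply_evalPPoint {J : Ideal (PC P)} {l : PC P →ₗ[ℂ] ℂ}
    (hl : ∀ x ∈ nilIdeal P, ∀ p ∈ J, l (x * p) = 0) {f : PHol P} (hf : f ∈ coeffIn J)
    {τ : ℍ} {a : PC P} (ha : bodyC P a = τ) (u : PC P) :
    l (evalPPoint τ a f * u) = (coeffMap l f : ℍ → ℂ) τ * bodyC P u := by
  induction hf using Submodule.span_induction with
  | mem x hx =>
    obtain ⟨p, hp, h, rfl⟩ := hx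
    have hnil : IsNilpotent (a - algebraMap ℂ (PC P) τ) :=
      isNilpotent_of_bodyC_eq_zero (by simp [ha])
    rw [evalPPoint_tmul, mul_assoc, apply_mul_of_mem hl hp, map_mul, map_sum, coeffMap_tmul,
      ← mul_assoc]
    congr 1
    rw [Finset.sum_eq_single_of_mem 0 (Finset.mem_range.mpr (pos_nilpotencyClass_iff.mpr hnil))]
    · rw [derivAt_zero]; simp
    · intro n _ hn
      rw [map_smul, map_pow, map_sub, ha, bodyC_algebraMap, sub_self, zero_pow hn, smul_zero]
  | zero => simp
  | add x y _ _ hx hy => rw [map_add, add_mul, map_add, hx, hy, map_add]; simp [add_mul]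
  | smul c x _ hx =>
    have : evalPPoint τ a (c • x) = c • evalPPoint τ a x :=
      ((evalPPoint τ a).restrictScalars ℂ).map_smul c x
    rw [this, smul_mul_assoc, map_smul, hx, map_smul]
    simp [mul_assoc]

lemma bodySL_apply (γ : SL(2, P)) (i j : Fin 2) :
    (bodySL P γ) i j = ParameterAlgebra.body (γ i j) := rfl

lemma bodyC_mobius (γ : SL(2, P)) (z : ℍ) :
    bodyC P (mobius γ.1 (algebraMap ℂ (PC P) z)) = (bodySL P γ • z : ℍ) := by
  rw [mobius, map_mul, bodyC_inverse, UpperHalfPlane.coe_specialLinearGroup_apply, div_eq_mul_inv]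
  simp [bodySL_apply]

lemma bodyC_jFactor (γ : SL(2, P)) (z : ℍ) :
    bodyC P (jFactor γ.1 (algebraMap ℂ (PC P) z)) =
      ((bodySL P γ 1 0 : ℂ) * z + bodySL P γ 1 1)⁻¹ := by
  rw [jFactor, bodyC_inverse]
  simp [bodySL_apply]

/-- The leading coefficient of `f|_γ`. -/
lemma apply_slashAt {J : Ideal (PC P)} {l : PC P →ₗ[ℂ] ℂ}
    (hl : ∀ x ∈ nilIdeal P, ∀ p ∈ J, l (x * p) = 0) {f : PHol P} (hf : f ∈ coeffIn J)
    (k : ℕ) (γ : SL(2, P)) (z : ℍ) :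
    l (slashAt k γ z f) =
      ((coeffMap l f : ℍ → ℂ) ∣[(k : ℤ)] SpecialLinearGroup.mapGL ℝ (bodySL P γ)) z := by
  rw [slashAt, LinearMap.smul_apply, smul_eq_mul, mul_comm,
    apply_evalPPoint hl hf (bodyC_mobius γ z), map_pow, bodyC_jFactor, slash_mapGL_apply]
  simp

lemma bodyC_unipotentPow {x : PC P} (hx : bodyC P x = 1) (r : ℝ) :
    bodyC P (unipotentPow x r) = 1 := by
  have hnil : IsNilpotent (x - 1) := isNilpotent_of_bodyC_eq_zero (by simp [hx])
  have hsm : ∀ (c : ℝ) (y : PC P), bodyC P (c • y) = c • bodyC P y := fun c y =>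
    map_smul ((bodyC P).restrictScalars ℝ) c y
  rw [unipotentPow, map_sum,
    Finset.sum_eq_single_of_mem 0 (Finset.mem_range.mpr (pos_nilpotencyClass_iff.mpr hnil))]
  · rw [hsm]; simp
  · intro n _ hn
    rw [hsm, map_pow, map_sub, hx, map_one, sub_self, zero_pow hn, smul_zero]

lemma bodyC_evalDeriv {Ω : PHol P} (hΩ : ∀ z : ℍ, bodyForm Ω z = z) (z : ℍ) :
    bodyC P (evalDeriv z Ω) = 1 := by
  have h1 : ((coeffMap (bodyC P).toLinearMap Ω : Hol) : ℍ → ℂ) = fun w : ℍ => (w : ℂ) := by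
    ext w
    rw [← apply_eval]
    exact hΩ w
  have h2 := apply_evalDeriv (bodyC P).toLinearMap z Ω
  rw [AlgHom.toLinearMap_apply] at h2
  rw [h2]
  change iteratedDeriv 1 (((coeffMap (bodyC P).toLinearMap Ω : Hol) : ℍ → ℂ) ∘ ofComplex) z = 1
  rw [h1, iteratedDeriv_one]
  have : ((fun w : ℍ => (w : ℂ)) ∘ ofComplex) =ᶠ[nhds (z : ℂ)] id := by
    filter_upwards [isOpen_upperHalfPlaneSet.mem_nhds z.im_pos] with w hw
    simp [ofComplex_apply_of_im_pos (show 0 < w.im from hw)]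
  rw [this.deriv_eq, deriv_id]

/-- The leading coefficient of `(f|_g)|_Ω`. -/
lemma apply_slashSlash {J : Ideal (PC P)} {l : PC P →ₗ[ℂ] ℂ}
    (hl : ∀ x ∈ nilIdeal P, ∀ p ∈ J, l (x * p) = 0) {f : PHol P} (hf : f ∈ coeffIn J)
    (k : ℕ) (g : SL(2, ℝ)) {Ω : PHol P} (hΩ : ∀ z : ℍ, bodyForm Ω z = z) (z : ℍ) :
    l (slashSlash k g Ω f z) =
      ((coeffMap l f : ℍ → ℂ) ∣[(k : ℤ)] SpecialLinearGroup.mapGL ℝ g) z := by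
  rw [slashSlash, apply_evalPPoint hl (slashReal_mem_coeffIn k g hf) (hΩ z),
    bodyC_unipotentPow (bodyC_evalDeriv hΩ z), mul_one, coeffMap_slashReal]
  rfl

end LeadingCoefficient
-- The dimension theorem
section Dimension

lemma finrank_le_finrank_map_add {V W : Type*} [AddCommGroup V] [Module ℂ V] [AddCommGroup W]
    [Module ℂ W] (φ : V →ₗ[ℂ] W) (Y K : Submodule ℂ V) [Module.Finite ℂ Y] [Module.Finite ℂ K]
    (hle : Y ⊓ LinearMap.ker φ ≤ K) :
    Module.finrank ℂ Y ≤ Module.finrank ℂ (Y.map φ) + Module.finrank ℂ K := by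
  have h1 := LinearMap.finrank_range_add_finrank_ker (φ.domRestrict Y)
  rw [LinearMap.range_domRestrict] at h1
  have h2 : Module.finrank ℂ (LinearMap.ker (φ.domRestrict Y)) ≤ Module.finrank ℂ K := by
    refine LinearMap.finrank_le_finrank_of_injective
      (f := LinearMap.codRestrict _ (Y.subtype ∘ₗ (LinearMap.ker (φ.domRestrict Y)).subtype)
        fun x => hle ⟨x.1.2, x.2⟩) ?_
    intro x y hxy
    exact Subtype.ext (Subtype.ext (congrArg (fun v : K => (v : V)) hxy))
  omega

lemma finrank_eq_of_rank_eq_natCast {A N : Type*} [CommRing A] [Algebra ℂ A] [AddCommGroup N]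
    [Module A N] [Module ℂ N] [IsScalarTower ℂ A N] [Nontrivial A] [Module.Free A N] {n : ℕ}
    (h : Module.rank A N = n) : Module.finrank ℂ N = n * Module.finrank ℂ A := by
  rw [← Module.finrank_mul_finrank ℂ A N, Module.finrank_eq_of_rank_eq h, mul_comm]

lemma finrank_span_range {A N : Type*} [CommRing A] [Algebra ℂ A] [AddCommGroup N]
    [Module A N] [Module ℂ N] [IsScalarTower ℂ A N] [Nontrivial A] {r : ℕ} {f : Fin r → N}
    (hf : LinearIndependent A f) :
    Module.finrank ℂ (Submodule.span A (Set.range f)) = r * Module.finrank ℂ A := by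
  have b := Module.Basis.span hf
  have := Module.Free.of_basis b
  refine finrank_eq_of_rank_eq_natCast ?_
  rw [rank_eq_card_basis b, Fintype.card_fin]


lemma span_range_eq_top_of_finrank_le {A N : Type*} [CommRing A] [Algebra ℂ A] [AddCommGroup N]
    [Module A N] [Module ℂ N] [IsScalarTower ℂ A N] [Nontrivial A] [Module.Finite ℂ N] {r : ℕ}
    {f : Fin r → N} (hf : LinearIndependent A f)
    (h : Module.finrank ℂ N ≤ r * Module.finrank ℂ A) : Submodule.span A (Set.range f) = ⊤ := by
  rw [← finrank_span_range hf] at h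
  have h3 : (Submodule.span A (Set.range f)).restrictScalars ℂ = ⊤ :=
    Submodule.eq_top_of_finrank_eq (le_antisymm (Submodule.finrank_le _) h)
  rwa [Submodule.restrictScalars_eq_top_iff] at h3

lemma finrank_top_ideal (P : Type*) [CommRing P] [Algebra ℝ P] :
    Module.finrank ℂ (⊤ : Ideal (PC P)) = Module.finrank ℝ P := by
  rw [← finrank_PC]
  exact finrank_top ℂ (PC P)

variable {P : Type*} [CommRing P] [Algebra ℝ P] [ParameterAlgebra P]

lemma bodyForm_eq_coeffMap (f : PHol P) (z : ℍ) :
    bodyForm f z = (coeffMap (bodyC P).toLinearMap f : ℍ → ℂ) z := by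
  rw [← apply_eval]; rfl

/-- The kernel of a leading form on an ideal. -/
def leadingKer (J : Ideal (PC P)) (l : PC P →ₗ[ℂ] ℂ)
    (hl : ∀ x ∈ nilIdeal P, ∀ p ∈ J, l (x * p) = 0) : Ideal (PC P) where
  carrier := {p | p ∈ J ∧ l p = 0}
  zero_mem' := ⟨J.zero_mem, map_zero l⟩
  add_mem' ha hb := ⟨J.add_mem ha.1 hb.1, by rw [map_add, ha.2, hb.2, add_zero]⟩
  smul_mem' c p hp := ⟨J.mul_mem_left c hp.1, by
    rw [smul_eq_mul, mul_comm, apply_mul_of_mem hl hp.1, hp.2, zero_mul]⟩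

/-- This is the splitting `J = ℂp₀ ⊕ (J ∩ ker l)`, tensored with `𝒪(ℍ)`. It shows that a function
with coefficients in `J` and vanishing `l`-coefficient has all its coefficients in the smaller
ideal. -/
lemma sub_tmul_mem_coeffIn_leadingKer {J : Ideal (PC P)} {l : PC P →ₗ[ℂ] ℂ}
    (hl : ∀ x ∈ nilIdeal P, ∀ p ∈ J, l (x * p) = 0) {p₀ : PC P} (hp₀ : p₀ ∈ J) (hlp₀ : l p₀ = 1)
    {f : PHol P} (hf : f ∈ coeffIn J) :
    f - p₀ ⊗ₜ[ℂ] coeffMap l f ∈ coeffIn (leadingKer J l hl) := by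
  induction hf using Submodule.span_induction with
  | mem x hx =>
    obtain ⟨p, hp, h, rfl⟩ := hx
    have : p ⊗ₜ[ℂ] h - p₀ ⊗ₜ[ℂ] coeffMap l (p ⊗ₜ[ℂ] h) = (p - l p • p₀) ⊗ₜ[ℂ] h := by
      rw [coeffMap_tmul, TensorProduct.sub_tmul, TensorProduct.smul_tmul]
    rw [this]
    have hmem : p - l p • p₀ ∈ leadingKer J l hl :=
      ⟨J.sub_mem hp (Submodule.smul_of_tower_mem J _ hp₀),
        by rw [map_sub, map_smul, hlp₀, smul_eq_mul, mul_one, sub_self]⟩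
    exact tmul_mem_coeffIn hmem h
  | zero => simp
  | add x y _ _ hx hy =>
    convert add_mem hx hy using 1
    rw [map_add, TensorProduct.tmul_add]; abel
  | smul c x _ hx =>
    convert Submodule.smul_mem _ c hx using 1
    rw [map_smul, TensorProduct.tmul_smul, smul_sub]

lemma finrank_leadingKer_lt {J : Ideal (PC P)} {l : PC P →ₗ[ℂ] ℂ}
    (hl : ∀ x ∈ nilIdeal P, ∀ p ∈ J, l (x * p) = 0) {p₀ : PC P} (hp₀ : p₀ ∈ J) (hlp₀ : l p₀ = 1) :
    Module.finrank ℂ (leadingKer J l hl) < Module.finrank ℂ J := by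
  refine Submodule.finrank_lt_finrank_of_lt (s := (leadingKer J l hl).restrictScalars ℂ)
    (t := J.restrictScalars ℂ) (lt_of_le_of_ne (fun p hp => hp.1) fun h => ?_)
  have : p₀ ∈ (leadingKer J l hl).restrictScalars ℂ := h ▸ hp₀
  have h0 : l p₀ = 0 := this.2
  rw [hlp₀] at h0
  exact one_ne_zero h0

lemma fg_of_fg_leadingKer {J : Ideal (PC P)} {l : PC P →ₗ[ℂ] ℂ}
    (hl : ∀ x ∈ nilIdeal P, ∀ p ∈ J, l (x * p) = 0) {p₀ : PC P} (hp₀ : p₀ ∈ J) (hlp₀ : l p₀ = 1)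
    (X : Submodule ℂ (PHol P)) (hmap : ((X ⊓ coeffIn J).map (coeffMap l)).FG)
    (hker : (X ⊓ coeffIn (leadingKer J l hl)).FG) :
    (X ⊓ coeffIn J).FG ∧ Module.finrank ℂ ↥(X ⊓ coeffIn J) ≤
      Module.finrank ℂ ((X ⊓ coeffIn J).map (coeffMap l)) +
        Module.finrank ℂ ↥(X ⊓ coeffIn (leadingKer J l hl)) := by
  have hle : X ⊓ coeffIn J ⊓ LinearMap.ker (coeffMap l) ≤ X ⊓ coeffIn (leadingKer J l hl) := by
    rintro f ⟨⟨hfX, hfJ⟩, hf0⟩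
    refine ⟨hfX, ?_⟩
    have := sub_tmul_mem_coeffIn_leadingKer hl hp₀ hlp₀ hfJ
    rwa [LinearMap.mem_ker.mp hf0, TensorProduct.tmul_zero, sub_zero] at this
  have hfin : Module.Finite ℂ ↥(X ⊓ coeffIn (leadingKer J l hl)) := Module.Finite.iff_fg.mpr hker
  have hfg : (X ⊓ coeffIn J).FG := by
    refine Submodule.fg_of_fg_map_of_fg_inf_ker (coeffMap l) hmap ?_
    exact Submodule.FG.of_le hker hle
  refine ⟨hfg, ?_⟩
  have hfin' : Module.Finite ℂ ↥(X ⊓ coeffIn J) := Module.Finite.iff_fg.mpr hfg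
  exact finrank_le_finrank_map_add (coeffMap l) _ _ hle

variable {M : Type*} [AddCommGroup M] [Module ℂ M] {ι : M →ₗ[ℂ] Hol}

/-- Induction on `dim J`. Passing to the kernel of a leading form lowers `dim J` and costs at most
`dim M`, because the leading coefficients are classical forms. Finite generation is carried along,
since ranks only add once it is known. -/
lemma finrank_inf_coeffIn_le [Module.Finite ℂ M] (X : Submodule ℂ (PHol P))
    (hX : ∀ (J : Ideal (PC P)) (l : PC P →ₗ[ℂ] ℂ), (∀ x ∈ nilIdeal P, ∀ p ∈ J, l (x * p) = 0) →
      ∀ f ∈ X, f ∈ coeffIn J → coeffMap l f ∈ LinearMap.range ι) (J : Ideal (PC P)) :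
    (X ⊓ coeffIn J).FG ∧
      Module.finrank ℂ ↥(X ⊓ coeffIn J) ≤ Module.finrank ℂ M * Module.finrank ℂ J := by
  induction hn : Module.finrank ℂ J using Nat.strong_induction_on generalizing J with
  | _ n ih =>
  by_cases hJ : J = ⊥
  · subst hJ
    rw [coeffIn_bot, inf_bot_eq]
    exact ⟨Submodule.fg_bot, by simp⟩
  obtain ⟨l₁, hl₁, p₀, hp₀, hne⟩ := exists_leading_form hJ
  obtain ⟨l, hl, hlp₀⟩ : ∃ l : PC P →ₗ[ℂ] ℂ,
      (∀ x ∈ nilIdeal P, ∀ p ∈ J, l (x * p) = 0) ∧ l p₀ = 1 :=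
    ⟨(l₁ p₀)⁻¹ • l₁, fun x hx p hp => by simp [hl₁ x hx p hp], by simp [hne]⟩
  have hlt := finrank_leadingKer_lt hl hp₀ hlp₀
  obtain ⟨h1, h2⟩ := ih _ (hn ▸ hlt) (leadingKer J l hl) rfl
  have hle : (X ⊓ coeffIn J).map (coeffMap l) ≤ LinearMap.range ι := by
    rintro _ ⟨f, hf, rfl⟩
    exact hX J l hl f hf.1 hf.2
  have hfgι : (LinearMap.range ι).FG := Module.Finite.iff_fg.mp inferInstance
  obtain ⟨h3, h4⟩ := fg_of_fg_leadingKer hl hp₀ hlp₀ X (Submodule.FG.of_le hfgι hle) h1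
  refine ⟨h3, h4.trans ?_⟩
  have h5 := (Submodule.finrank_mono hle).trans (LinearMap.finrank_range_le ι)
  rw [hn] at hlt
  calc _ ≤ Module.finrank ℂ M + Module.finrank ℂ M * Module.finrank ℂ (leadingKer J l hl) :=
        add_le_add h5 h2
    _ = Module.finrank ℂ M * (Module.finrank ℂ (leadingKer J l hl) + 1) := by ring
    _ ≤ _ := Nat.mul_le_mul_left _ hlt

lemma coeffMap_smul_of_mem {J : Ideal (PC P)} {l : PC P →ₗ[ℂ] ℂ}
    (hl : ∀ x ∈ nilIdeal P, ∀ p ∈ J, l (x * p) = 0) {a : PC P} (ha : a ∈ J) (f : PHol P) :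
    coeffMap l (a • f) = l a • coeffMap (bodyC P).toLinearMap f := by
  induction f using TensorProduct.induction_on with
  | zero => simp
  | tmul p h =>
    rw [TensorProduct.smul_tmul', coeffMap_tmul, coeffMap_tmul, smul_eq_mul,
      apply_mul_of_mem hl ha, mul_smul]
    rfl
  | add x y hx hy => rw [smul_add, map_add, map_add, hx, hy, smul_add]

/-- `P`-holomorphic functions with linearly independent bodies are independent over `P^ℂ`. -/
lemma linearIndependent_of_body {r : ℕ} {f : Fin r → PHol P}
    (hf : LinearIndependent ℂ fun i => coeffMap (bodyC P).toLinearMap (f i)) :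
    LinearIndependent (PC P) f := by
  rw [Fintype.linearIndependent_iff]
  intro a ha
  by_contra! hne
  obtain ⟨i₀, hi₀⟩ := hne
  set J : Ideal (PC P) := Ideal.span (Set.range a)
  have hmem : ∀ i, a i ∈ J := fun i => Ideal.subset_span ⟨i, rfl⟩
  -- A leading form on the ideal generated by the coefficients turns the relation into a ℂ-linear
  -- relation `∑ l(aᵢ) fᵢ^# = 0`. Independence of the bodies then makes `l` vanish on the whole
  -- ideal.
  have hJne : J ≠ ⊥ := fun h => hi₀ ((Submodule.mem_bot _).mp (h ▸ hmem i₀))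
  obtain ⟨l, hl, p, hp, hlp⟩ := exists_leading_form hJne
  have h1 := congrArg (coeffMap l) ha
  rw [map_sum, map_zero] at h1
  simp only [coeffMap_smul_of_mem hl (hmem _)] at h1
  have h2 := Fintype.linearIndependent_iff.mp hf _ h1
  have hle : J ≤ leadingKer J l hl := by
    refine Ideal.span_le.mpr ?_
    rintro _ ⟨i, rfl⟩
    exact ⟨hmem i, h2 i⟩
  exact hlp (hle hp).2

/-- Any nonzero element of the last nonvanishing power of `I` works. -/
lemma exists_ne_zero_annihilated {A : Type*} [CommRing A] [Nontrivial A] {I : Ideal A}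
    (hex : IsNilpotent I) : ∃ p : A, p ≠ 0 ∧ ∀ x ∈ I, x * p = 0 := by
  classical
  set n := Nat.find hex with hn
  have hspec : I ^ n = ⊥ := Nat.find_spec hex
  have h0 : n ≠ 0 := by
    intro h
    rw [h, pow_zero, Ideal.one_eq_top] at hspec
    exact top_ne_bot hspec
  have hmin : I ^ (n - 1) ≠ ⊥ := Nat.find_min hex (by omega)
  obtain ⟨p, hp, hp0⟩ := Submodule.exists_mem_ne_zero_of_ne_bot hmin
  refine ⟨p, hp0, fun x hx => ?_⟩
  have h1 := Ideal.mul_mem_mul hx hp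
  rw [← pow_succ', Nat.sub_add_cancel (Nat.one_le_iff_ne_zero.mpr h0), hspec] at h1
  exact h1

/-- The lifts span a free module of ℂ-dimension `dim M · dim P`, which already exhausts the upper
bound for `X`. -/
lemma linearIndependent_and_span_eq_top (hι : Function.Injective ι) (X : Submodule (PC P) (PHol P))
    [Module.Finite ℂ X] (hupper : Module.finrank ℂ X ≤ Module.finrank ℂ M * Module.finrank ℝ P)
    {r : ℕ} {f : Fin r → X} {b : Module.Basis (Fin r) ℂ M}
    (hfb : ∀ i z, (ι (b i) : ℍ → ℂ) z = bodyForm (f i : PHol P) z) :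
    LinearIndependent (PC P) f ∧ Submodule.span (PC P) (Set.range f) = ⊤ := by
  have hcoeff : (fun i => coeffMap (bodyC P).toLinearMap (f i : PHol P)) = ι ∘ b := by
    ext i z
    rw [← bodyForm_eq_coeffMap, ← hfb]; rfl
  have hli : LinearIndependent (PC P) f := by
    refine LinearIndependent.of_comp X.subtype (linearIndependent_of_body ?_)
    change LinearIndependent ℂ fun i => coeffMap (bodyC P).toLinearMap (f i : PHol P)
    rw [hcoeff]
    exact b.linearIndependent.map' ι (LinearMap.ker_eq_bot.mpr hι)
  refine ⟨hli, ?_⟩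
  have h2 := Module.finrank_eq_card_basis b
  rw [Fintype.card_fin] at h2
  rw [h2, ← finrank_PC] at hupper
  exact span_range_eq_top_of_finrank_le (A := PC P) (N := X) hli hupper

/-- The dimension theorem for a space of `P`-holomorphic functions whose leading coefficients are
classical forms and which contains the classical forms with coefficients in the socle. -/
theorem dimension_theorem [Module.Finite ℂ M] (hι : Function.Injective ι)
    (X : Submodule (PC P) (PHol P))
    (hX : ∀ (J : Ideal (PC P)) (l : PC P →ₗ[ℂ] ℂ), (∀ x ∈ nilIdeal P, ∀ p ∈ J, l (x * p) = 0) →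
      ∀ f ∈ X, f ∈ coeffIn J → coeffMap l f ∈ LinearMap.range ι)
    (hsocle : ∀ p : PC P, (∀ x ∈ nilIdeal P, x * p = 0) → ∀ h : M, p ⊗ₜ[ℂ] ι h ∈ X) :
    Module.Finite ℂ M ∧ Module.Finite ℂ X ∧
      Module.finrank ℂ M ≤ Module.finrank ℂ X ∧
      Module.finrank ℂ X ≤ Module.finrank ℂ M * Module.finrank ℝ P ∧
      [Module.finrank ℂ X = Module.finrank ℂ M * Module.finrank ℝ P,
        ∃ (r : ℕ) (f : Fin r → X) (b : Module.Basis (Fin r) ℂ M),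
          ∀ i z, (ι (b i) : ℍ → ℂ) z = bodyForm (f i : PHol P) z,
        Module.Free (PC P) X ∧ Module.rank (PC P) X = Module.finrank ℂ M].TFAE ∧
      ∀ (r : ℕ) (f : Fin r → X) (b : Module.Basis (Fin r) ℂ M),
        (∀ i z, (ι (b i) : ℍ → ℂ) z = bodyForm (f i : PHol P) z) →
          LinearIndependent (PC P) f ∧ Submodule.span (PC P) (Set.range f) = ⊤ := by
  have hX' : ∀ (J : Ideal (PC P)) (l : PC P →ₗ[ℂ] ℂ),
      (∀ x ∈ nilIdeal P, ∀ p ∈ J, l (x * p) = 0) →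
      ∀ f ∈ X.restrictScalars ℂ, f ∈ coeffIn J → coeffMap l f ∈ LinearMap.range ι := hX
  have htop := finrank_inf_coeffIn_le (X.restrictScalars ℂ) hX' ⊤
  rw [coeffIn_top, inf_top_eq, finrank_top_ideal] at htop
  have hfin : Module.Finite ℂ X := Module.Finite.iff_fg.mpr htop.1
  have hupper : Module.finrank ℂ X ≤ Module.finrank ℂ M * Module.finrank ℝ P := htop.2
  have hlower : Module.finrank ℂ M ≤ Module.finrank ℂ X := by
    obtain ⟨p, hp0, hp⟩ := exists_ne_zero_annihilated (isNilpotent_nilIdeal (P := P))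
    obtain ⟨l, hl⟩ := Module.Projective.exists_dual_ne_zero ℂ hp0
    let φ : M →ₗ[ℂ] X.restrictScalars ℂ :=
      LinearMap.codRestrict _ (TensorProduct.mk ℂ (PC P) Hol p ∘ₗ ι) (hsocle p hp)
    refine LinearMap.finrank_le_finrank_of_injective (f := φ) fun x y hxy => hι ?_
    have h1 : coeffMap l (p ⊗ₜ[ℂ] ι x) = coeffMap l (p ⊗ₜ[ℂ] ι y) :=
      congrArg (fun w : X.restrictScalars ℂ => coeffMap l w.1) hxy
    rw [coeffMap_tmul, coeffMap_tmul] at h1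
    exact smul_right_injective _ hl h1
  have hbasis : ∀ (r : ℕ) (f : Fin r → X) (b : Module.Basis (Fin r) ℂ M),
      (∀ i z, (ι (b i) : ℍ → ℂ) z = bodyForm (f i : PHol P) z) →
        LinearIndependent (PC P) f ∧ Submodule.span (PC P) (Set.range f) = ⊤ :=
    fun _ _ _ hfb => linearIndependent_and_span_eq_top hι X hupper hfb
  refine ⟨inferInstance, hfin, hlower, hupper, ?_, hbasis⟩
  tfae_have 1 → 2 := by
    intro h
    have hl : ∀ x ∈ nilIdeal P, ∀ p ∈ (⊤ : Ideal (PC P)),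
        (bodyC P).toLinearMap (x * p) = 0 := by
      intro x hx p _
      rw [AlgHom.toLinearMap_apply, map_mul, (RingHom.mem_ker).mp hx, zero_mul]
    have hl1 : (bodyC P).toLinearMap 1 = 1 := map_one (bodyC P)
    have hlt := finrank_leadingKer_lt hl Submodule.mem_top hl1
    obtain ⟨h1, h2⟩ := finrank_inf_coeffIn_le (X.restrictScalars ℂ) hX' (leadingKer ⊤ _ hl)
    have hle : (X.restrictScalars ℂ ⊓ coeffIn ⊤).map (coeffMap (bodyC P).toLinearMap) ≤
        LinearMap.range ι := by
      rintro _ ⟨f, hf, rfl⟩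
      exact hX ⊤ _ hl f hf.1 hf.2
    have hfgι : (LinearMap.range ι).FG := Module.Finite.iff_fg.mp inferInstance
    obtain ⟨-, h4⟩ := fg_of_fg_leadingKer hl Submodule.mem_top hl1 (X.restrictScalars ℂ)
      (Submodule.FG.of_le hfgι hle) h1
    -- The body map is the leading form on `J = P^ℂ`. Its kernel part has dimension at most `dim M ·
    -- (dim P - 1)`, so equality in the upper bound leaves at least `dim M` for the image.
    have heq : (X.restrictScalars ℂ ⊓ coeffIn ⊤).map (coeffMap (bodyC P).toLinearMap) =
        LinearMap.range ι := by
      refine Submodule.eq_of_le_of_finrank_le hle ?_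
      refine (LinearMap.finrank_range_le ι).trans ?_
      have h5 : Module.finrank ℂ ↥(X.restrictScalars ℂ ⊓ coeffIn ⊤) =
          Module.finrank ℂ M * Module.finrank ℝ P := by
        rw [coeffIn_top, inf_top_eq, ← h]; rfl
      rw [finrank_top_ideal P] at hlt
      have h6 : Module.finrank ℂ M * (Module.finrank ℂ (leadingKer ⊤ _ hl) + 1) ≤
          Module.finrank ℂ M * Module.finrank ℝ P := Nat.mul_le_mul_left _ hlt
      rw [mul_add, mul_one] at h6
      omega
    have hb := Module.finBasis ℂ M
    have hex : ∀ i, ∃ f : X, coeffMap (bodyC P).toLinearMap f = ι (hb i) := by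
      intro i
      have : ι (hb i) ∈ LinearMap.range ι := ⟨_, rfl⟩
      rw [← heq] at this
      obtain ⟨f, hf, hfe⟩ := this
      exact ⟨⟨f, hf.1⟩, hfe⟩
    choose f hf using hex
    exact ⟨_, f, hb, fun i z => by rw [bodyForm_eq_coeffMap, hf]⟩
  tfae_have 2 → 3 := by
    rintro ⟨r, f, b, hfb⟩
    obtain ⟨hli, hsp⟩ := hbasis r f b hfb
    have B := Module.Basis.mk hli hsp.ge
    refine ⟨Module.Free.of_basis B, ?_⟩
    rw [rank_eq_card_basis B, Module.finrank_eq_card_basis b]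
  tfae_have 3 → 1 := by
    rintro ⟨hfree, hrank⟩
    rw [finrank_eq_of_rank_eq_natCast (A := PC P) (N := X) hrank, finrank_PC]
  tfae_finish

end Dimension

/-! ### Exponentials and logarithms of nilpotent elements -/

section Exponential

variable {A : Type*} [Ring A] [Algebra ℝ A]

/-- The exponential of a nilpotent element of a real algebra. -/
def nexp (x : A) : A :=
  ∑ n ∈ Finset.range (nilpotencyClass x), ((n.factorial : ℝ)⁻¹) • x ^ n

variable (A) in
/-- The rational structure on a real algebra. -/
abbrev ratModule : Module ℚ A := Module.compHom A (algebraMap ℚ ℝ)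

lemma nexp_eq_exp (x : A) :
    nexp x = @IsNilpotent.exp A _ (ratModule A) x := by
  let _ := ratModule A
  refine Finset.sum_congr rfl fun n _ => ?_
  change _ = (algebraMap ℚ ℝ (n.factorial : ℚ)⁻¹) • x ^ n
  simp

lemma nexp_add {x y : A} (h : Commute x y) (hx : IsNilpotent x) (hy : IsNilpotent y) :
    nexp (x + y) = nexp x * nexp y := by
  let _ := ratModule A
  rw [nexp_eq_exp, nexp_eq_exp, nexp_eq_exp]
  exact IsNilpotent.exp_add_of_commute h hx hy

lemma nexp_zero : nexp (0 : A) = 1 := by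
  let _ := ratModule A
  rw [nexp_eq_exp]
  exact IsNilpotent.exp_zero

lemma nexp_eq_sum {x : A} {k : ℕ} (h : x ^ k = 0) :
    nexp x = ∑ n ∈ Finset.range k, ((n.factorial : ℝ)⁻¹) • x ^ n := by
  let _ := ratModule A
  rw [nexp_eq_exp, IsNilpotent.exp_eq_sum h]
  refine Finset.sum_congr rfl fun n _ => ?_
  change (algebraMap ℚ ℝ (n.factorial : ℚ)⁻¹) • x ^ n = _
  simp

lemma map_nexp {B : Type*} [Ring B] [Algebra ℝ B] (φ : A →ₐ[ℝ] B) {x : A} (hx : IsNilpotent x) :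
    φ (nexp x) = nexp (φ x) := by
  obtain ⟨k, hk⟩ := hx
  rw [nexp_eq_sum hk, nexp_eq_sum (k := k) (by rw [← map_pow, hk, map_zero]), map_sum]
  exact Finset.sum_congr rfl fun n _ => by rw [map_smul, map_pow]

lemma nexp_of_sq_eq_zero {x : A} (h : x ^ 2 = 0) : nexp x = 1 + x := by
  rw [nexp_eq_sum h]
  simp [Finset.sum_range_succ]

/-- The exponential agrees with `1 + x` to second order. The cofactor is a polynomial in `x`, so it
commutes with `x`, which the noncommutative arguments below depend on. -/
lemma exists_nexp_eq {x : A} (hx : IsNilpotent x) :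
    ∃ h ∈ Algebra.adjoin ℝ {x}, nexp x = 1 + x + x ^ 2 * h := by
  obtain ⟨k, hk⟩ := hx
  refine ⟨∑ n ∈ Finset.range k, (((n + 2).factorial : ℝ)⁻¹) • x ^ n, ?_, ?_⟩
  · exact sum_mem fun n _ => Subalgebra.smul_mem _
      (pow_mem (Algebra.self_mem_adjoin_singleton ℝ x) n) _
  · rw [nexp_eq_sum (k := k + 2) (by rw [pow_add, hk, zero_mul]), Finset.sum_range_succ',
      Finset.sum_range_succ', Finset.mul_sum]
    simp only [mul_smul_comm, ← pow_add, Nat.factorial, Nat.cast_one, _root_.inv_one, one_smul,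
      pow_one, pow_zero, zero_add, mul_one]
    rw [add_comm, add_comm _ x, ← add_assoc]
    congr 1
    exact Finset.sum_congr rfl fun n _ => by rw [add_comm 2 n]

lemma eq_zero_of_nexp_eq_one {x : A} (hx : IsNilpotent x) (h : nexp x = 1) : x = 0 := by
  obtain ⟨y, hy, he⟩ := exists_nexp_eq hx
  have hc : Commute x y := Algebra.commute_of_mem_adjoin_self hy
  have hu : IsUnit (1 + x * y) := (hc.isNilpotent_mul_right hx).isUnit_one_add
  rw [h, add_assoc, left_eq_add, pow_two, mul_assoc, ← mul_one_add x] at he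
  exact (hu.mul_left_eq_zero).mp he

/-- Logarithms of unipotent elements. -/
lemma exists_nexp_eq_one_add (n : ℕ) : ∀ r : A, r ^ n = 0 →
    ∃ b ∈ Algebra.adjoin ℝ {r}, IsNilpotent b ∧ nexp b = 1 + r := by
  induction n with
  | zero =>
    intro r hr
    rw [pow_zero] at hr
    have : ∀ a b : A, a = b := fun a b => by rw [← mul_one a, ← mul_one b, hr, mul_zero, mul_zero]
    exact ⟨0, zero_mem _, IsNilpotent.zero, this _ _⟩
  | succ n ih =>
    intro r hr
    rcases Nat.eq_zero_or_pos n with rfl | hn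
    · rw [zero_add, pow_one] at hr
      exact ⟨0, zero_mem _, IsNilpotent.zero, by rw [nexp_zero, hr, add_zero]⟩
    have hrn : IsNilpotent r := ⟨_, hr⟩
    obtain ⟨h, hh, he⟩ := exists_nexp_eq hrn.neg
    have hmem : r ∈ Algebra.adjoin ℝ {r} := Algebra.self_mem_adjoin_singleton ℝ r
    have hh' : h ∈ Algebra.adjoin ℝ {r} :=
      Algebra.adjoin_le (Set.singleton_subset_iff.mpr (neg_mem hmem)) hh
    have hc : Commute r h := Algebra.commute_of_mem_adjoin_self hh'
    set g : A := h + h * r - 1 with hg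
    have hgmem : g ∈ Algebra.adjoin ℝ {r} :=
      sub_mem (add_mem hh' (mul_mem hh' hmem)) (one_mem _)
    have hcg : Commute r g := Algebra.commute_of_mem_adjoin_self hgmem
    -- A Newton-type step: dividing by `exp r` leaves a unipotent element with quadratically small
    -- defect, whose nilpotency order is lower. Its logarithm plus `r` is the one sought.
    have hfac : nexp (-r) * (1 + r) = 1 + r ^ 2 * g := by
      rw [he, hg, neg_sq]
      noncomm_ring
    have hpow : (r ^ 2 * g) ^ n = 0 := by
      rw [(hcg.pow_left 2).mul_pow, ← pow_mul, show 2 * n = (n + 1) + (n - 1) by omega, pow_add,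
        hr, zero_mul, zero_mul]
    obtain ⟨b, hb, hbn, hbe⟩ := ih _ hpow
    have hb' : b ∈ Algebra.adjoin ℝ {r} :=
      Algebra.adjoin_le (Set.singleton_subset_iff.mpr (mul_mem (pow_mem hmem 2) hgmem)) hb
    have hcb : Commute r b := Algebra.commute_of_mem_adjoin_self hb'
    refine ⟨r + b, add_mem hmem hb', hcb.isNilpotent_add hrn hbn, ?_⟩
    rw [nexp_add hcb hrn hbn, hbe, ← hfac, ← mul_assoc,
      ← nexp_add (Commute.refl r).neg_right hrn hrn.neg, add_neg_cancel, nexp_zero, one_mul]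

end Exponential

/-! ### Trace, determinant and exponential of 2 × 2 matrices -/

section TwoByTwo

variable {R : Type*} [CommRing R]

lemma adjugate_eq_trace_sub (X : Matrix (Fin 2) (Fin 2) R) :
    X.adjugate = X.trace • (1 : Matrix (Fin 2) (Fin 2) R) - X := by
  rw [adjugate_fin_two, Matrix.trace_fin_two]
  ext i j
  fin_cases i <;> fin_cases j <;> simp

lemma sq_eq_trace_sub_det (X : Matrix (Fin 2) (Fin 2) R) :
    X ^ 2 = X.trace • X - X.det • (1 : Matrix (Fin 2) (Fin 2) R) := by
  have h := Matrix.mul_adjugate X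
  rw [adjugate_eq_trace_sub, mul_sub, mul_smul_comm, mul_one, ← pow_two] at h
  rw [← h, sub_sub_cancel]

lemma isNilpotent_of_trace_det {X : Matrix (Fin 2) (Fin 2) R} (ht : IsNilpotent X.trace)
    (hd : IsNilpotent X.det) : IsNilpotent X := by
  have h1 : IsNilpotent (X ^ 2) := by
    rw [sq_eq_trace_sub_det]
    refine Commute.isNilpotent_sub ?_ ?_ ?_
    · exact ((Commute.one_right X).smul_right _).smul_left _
    · obtain ⟨n, hn⟩ := ht
      exact ⟨n, by rw [_root_.smul_pow, hn, zero_smul]⟩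
    · obtain ⟨n, hn⟩ := hd
      exact ⟨n, by rw [_root_.smul_pow, hn, zero_smul]⟩
  obtain ⟨n, hn⟩ := h1
  exact ⟨2 * n, by rw [pow_mul, hn]⟩

variable [Algebra ℝ R]

/-- For 2 × 2 matrices the adjugate `tr X - X` is additive and compatible with powers, so it passes
through the exponential series. -/
lemma adjugate_nexp {X : Matrix (Fin 2) (Fin 2) R} (hX : IsNilpotent X) :
    (nexp X).adjugate = nexp X.adjugate := by
  obtain ⟨k, hk⟩ := hX
  have hpow : ∀ n, X.adjugate ^ n = (X ^ n).adjugate := fun n => (Matrix.adjugate_pow X n).symm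
  have hk' : X.adjugate ^ k = 0 := by
    rw [hpow, hk, adjugate_eq_trace_sub, Matrix.trace_zero, zero_smul, sub_zero]
  rw [nexp_eq_sum hk, nexp_eq_sum hk', adjugate_eq_trace_sub, Matrix.trace_sum, Finset.sum_smul,
    ← Finset.sum_sub_distrib]
  refine Finset.sum_congr rfl fun n _ => ?_
  rw [hpow, adjugate_eq_trace_sub (X ^ n), Matrix.trace_smul, smul_sub, smul_assoc]

/-- The logarithm of a unimodular matrix is traceless. -/
lemma trace_eq_zero_of_det_nexp {X : Matrix (Fin 2) (Fin 2) R} (hX : IsNilpotent X)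
    (htr : IsNilpotent X.trace) (hdet : (nexp X).det = 1) : X.trace = 0 := by
  have hadj := adjugate_eq_trace_sub X
  have hT : IsNilpotent (X.trace • (1 : Matrix (Fin 2) (Fin 2) R)) := by
    obtain ⟨n, hn⟩ := htr
    exact ⟨n, by rw [_root_.smul_pow, hn, zero_smul]⟩
  have hc : Commute X (X.trace • (1 : Matrix (Fin 2) (Fin 2) R)) :=
    (Commute.one_right X).smul_right _
  have hcA : Commute X X.adjugate := by
    rw [hadj]; exact hc.sub_right (Commute.refl X)
  have hA : IsNilpotent X.adjugate := by
    rw [hadj]; exact hc.symm.isNilpotent_sub hT hX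
  -- `1 = det(exp X) = exp(X) exp(adj X) = exp(tr X)`, and a nilpotent scalar with exponential one
  -- is zero.
  have h1 := Matrix.mul_adjugate (nexp X)
  rw [hdet, one_smul, adjugate_nexp hX, ← nexp_add hcA hX hA, hadj, add_sub_cancel] at h1
  have h2 := eq_zero_of_nexp_eq_one hT h1
  have h3 := congrFun (congrFun h2 0) 0
  simpa using h3

end TwoByTwo

/-! ### Holomorphic representability of `P^ℂ`-valued functions -/

section Representable

variable {P : Type*} [CommRing P] [Algebra ℝ P]

/-- A function with values in `P^ℂ` is represented by a `P`-holomorphic function. -/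
def IsRepresentable (F : ℍ → PC P) : Prop := ∃ f : PHol P, ∀ z, eval z f = F z

lemma isRepresentable_const (p : PC P) : IsRepresentable fun _ => p :=
  ⟨p ⊗ₜ[ℂ] (⟨fun _ => 1, mdifferentiable_const⟩ : Hol), fun z => by
    rw [eval_tmul]; exact one_smul ℂ p⟩

lemma isRepresentable_coe : IsRepresentable fun z => algebraMap ℂ (PC P) (z : ℂ) :=
  ⟨1 ⊗ₜ[ℂ] (⟨fun z => (z : ℂ), UpperHalfPlane.mdifferentiable_coe⟩ : Hol), fun z => by
    rw [eval_tmul]; exact (Algebra.algebraMap_eq_smul_one _).symm⟩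

lemma IsRepresentable.add {F G : ℍ → PC P} (hF : IsRepresentable F) (hG : IsRepresentable G) :
    IsRepresentable fun z => F z + G z := by
  obtain ⟨f, hf⟩ := hF
  obtain ⟨g, hg⟩ := hG
  exact ⟨f + g, fun z => by rw [map_add, hf, hg]⟩

lemma IsRepresentable.mul {F G : ℍ → PC P} (hF : IsRepresentable F) (hG : IsRepresentable G) :
    IsRepresentable fun z => F z * G z := by
  obtain ⟨f, hf⟩ := hF
  obtain ⟨g, hg⟩ := hG
  simp only [← hf, ← hg]
  clear hf hg
  induction f using TensorProduct.induction_on with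
  | zero => exact ⟨0, fun z => by simp⟩
  | add x y hx hy =>
    obtain ⟨u, hu⟩ := hx
    obtain ⟨v, hv⟩ := hy
    exact ⟨u + v, fun z => by
      change _ = eval z (x + y) * eval z g
      rw [map_add, map_add, hu, hv, add_mul]⟩
  | tmul p h =>
    induction g using TensorProduct.induction_on with
    | zero => exact ⟨0, fun z => by simp⟩
    | add x y hx hy =>
      obtain ⟨u, hu⟩ := hx
      obtain ⟨v, hv⟩ := hy
      exact ⟨u + v, fun z => by
        change _ = eval z (p ⊗ₜ[ℂ] h) * eval z (x + y)
        rw [map_add, map_add, hu, hv, mul_add]⟩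
    | tmul q h' =>
      refine ⟨(p * q) ⊗ₜ[ℂ] (⟨(h : ℍ → ℂ) * (h' : ℍ → ℂ), h.2.mul h'.2⟩ : Hol), fun z => ?_⟩
      change _ = eval z (p ⊗ₜ[ℂ] h) * eval z (q ⊗ₜ[ℂ] h')
      rw [eval_tmul, eval_tmul, eval_tmul, smul_mul_smul_comm]
      rfl

lemma IsRepresentable.sum {ι : Type*} (s : Finset ι) {F : ι → ℍ → PC P}
    (hF : ∀ i ∈ s, IsRepresentable (F i)) : IsRepresentable fun z => ∑ i ∈ s, F i z := by
  classical
  induction s using Finset.induction_on with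
  | empty => simpa using isRepresentable_const (0 : PC P)
  | insert i s hi ih =>
    simp only [Finset.sum_insert hi]
    exact (hF i (Finset.mem_insert_self i s)).add
      (ih fun j hj => hF j (Finset.mem_insert_of_mem hj))

lemma IsRepresentable.pow {F : ℍ → PC P} (hF : IsRepresentable F) (n : ℕ) :
    IsRepresentable fun z => F z ^ n := by
  induction n with
  | zero => simpa using isRepresentable_const (1 : PC P)
  | succ n ih => simpa only [pow_succ] using ih.mul hF

lemma nexp_add_smul {R : Type*} [CommRing R] [Algebra ℂ R] [Algebra ℝ R]
    {X : Matrix (Fin 2) (Fin 2) R} (hX : IsNilpotent X) (a b : ℂ) :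
    nexp ((a + b) • X) = nexp (a • X) * nexp (b • X) := by
  have hsm : ∀ c : ℂ, IsNilpotent (c • X) := by
    intro c
    obtain ⟨k, hk⟩ := hX
    exact ⟨k, by rw [_root_.smul_pow, hk, smul_zero]⟩
  rw [add_smul, nexp_add _ (hsm _) (hsm _)]
  exact ((Commute.refl X).smul_left _).smul_right _

lemma isRepresentable_nexp_smul {X : Matrix (Fin 2) (Fin 2) (PC P)} (hX : IsNilpotent X)
    (i j : Fin 2) : IsRepresentable fun z : ℍ => nexp ((z : ℂ) • X) i j := by
  obtain ⟨k, hk⟩ := hX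
  have hF : IsRepresentable fun z : ℍ => ∑ n ∈ Finset.range k,
      algebraMap ℂ (PC P) (z : ℂ) ^ n * (((n.factorial : ℝ)⁻¹) • (X ^ n) i j) :=
    IsRepresentable.sum _ fun n _ => (isRepresentable_coe.pow n).mul (isRepresentable_const _)
  convert hF using 2 with z
  rw [nexp_eq_sum (k := k) (by rw [_root_.smul_pow, hk, smul_zero]), Matrix.sum_apply]
  refine Finset.sum_congr rfl fun n _ => ?_
  rw [_root_.smul_pow, Matrix.smul_apply, Matrix.smul_apply, mul_smul_comm, ← map_pow,
    ← Algebra.smul_def]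

lemma IsRepresentable.inverse [ParameterAlgebra P] {F : ℍ → PC P} (hF : IsRepresentable F)
    (h1 : ∀ z, bodyC P (F z) = 1) : IsRepresentable fun z => Ring.inverse (F z) := by
  obtain ⟨n, hn⟩ := isNilpotent_nilIdeal (P := P)
  -- The inverse is a geometric series in `1 - F`, which terminates at the nilpotency order of the
  -- ideal uniformly in `z`.
  have hG : IsRepresentable fun z => ∑ i ∈ Finset.range n, (1 + (-1) * F z) ^ i :=
    IsRepresentable.sum _ fun i _ => IsRepresentable.pow
      ((isRepresentable_const 1).add ((isRepresentable_const (-1)).mul hF)) i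
  convert hG using 2 with z
  have hx : (1 + (-1) * F z) ^ n = 0 := by
    have hmem : 1 + (-1) * F z ∈ nilIdeal P := by
      rw [RingHom.mem_ker]
      simp [h1]
    have := Ideal.pow_mem_pow hmem n
    rwa [hn] at this
  have hgeom := mul_neg_geom_sum (1 + (-1) * F z) n
  rw [hx, sub_zero, show 1 - (1 + (-1) * F z) = F z by ring] at hgeom
  have hu : IsUnit (F z) := isUnit_of_bodyC_ne_zero (by rw [h1]; exact one_ne_zero)
  rw [← left_inv_eq_right_inv (Ring.inverse_mul_cancel _ hu) hgeom]

end Representable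

/-! ### Existence of `χ` and `Ω` at a cusp -/

section CuspDatum

variable {P : Type*} [CommRing P] [Algebra ℝ P] [ParameterAlgebra P]

lemma isNilpotent_of_body_eq_zero {x : P} (hx : ParameterAlgebra.body x = (0 : ℝ)) :
    IsNilpotent x := by
  obtain ⟨n, hn⟩ := ParameterAlgebra.nilpotent (P := P)
  refine ⟨n, ?_⟩
  have := Ideal.pow_mem_pow (show x ∈ RingHom.ker (ParameterAlgebra.body (P := P)) from hx) n
  rwa [hn] at this

/-- A matrix in `SL(2, P)` whose body is a translation has a logarithm in `sl(2, P)`. -/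
lemma exists_log {N : SL(2, P)} (hN : bodySL P N = translation) :
    ∃ χ : Matrix (Fin 2) (Fin 2) P, IsNilpotent χ ∧ χ.trace = 0 ∧
      χ.map (ParameterAlgebra.body (P := P)) = !![0, 1; 0, 0] ∧ nexp χ = N.1 := by
  have hNm : (N.1).map (ParameterAlgebra.body (P := P)) = !![1, 1; 0, 1] :=
    congrArg Subtype.val hN
  set φ := (ParameterAlgebra.body (P := P)).mapMatrix (m := Fin 2) with hφ
  have hφN : φ N.1 = !![1, 1; 0, 1] := hNm
  have hφr : φ (N.1 - 1) = !![0, 1; 0, 0] := by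
    rw [map_sub, hφN, map_one, Matrix.one_fin_two]
    ext i j
    fin_cases i <;> fin_cases j <;> simp
  have htr : ∀ X : Matrix (Fin 2) (Fin 2) P, ParameterAlgebra.body X.trace = (φ X).trace :=
    fun X => AddMonoidHom.map_trace (ParameterAlgebra.body (P := P)).toAddMonoidHom X
  have hdet : ∀ X : Matrix (Fin 2) (Fin 2) P, ParameterAlgebra.body X.det = (φ X).det :=
    fun X => AlgHom.map_det _ X
  have hr : IsNilpotent (N.1 - 1) := by
    refine isNilpotent_of_trace_det (isNilpotent_of_body_eq_zero ?_)
      (isNilpotent_of_body_eq_zero ?_)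
    · rw [htr, hφr]; simp [Matrix.trace_fin_two]
    · rw [hdet, hφr]; simp [Matrix.det_fin_two]
  obtain ⟨n, hn⟩ := hr
  obtain ⟨χ, -, hχ, he⟩ := exists_nexp_eq_one_add n _ hn
  rw [add_sub_cancel] at he
  have hφχ : IsNilpotent (φ χ) := hχ.map φ
  have htr0 : IsNilpotent χ.trace := by
    refine isNilpotent_of_body_eq_zero ?_
    rw [htr]
    exact (Matrix.isNilpotent_trace_of_isNilpotent hφχ).eq_zero
  have htrace : χ.trace = 0 :=
    trace_eq_zero_of_det_nexp hχ htr0 (by rw [he]; exact N.2)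
  refine ⟨χ, hχ, htrace, ?_, he⟩
  have hdet0 : (φ χ).det = 0 := by
    obtain ⟨k, hk⟩ := hφχ
    refine eq_zero_of_pow_eq_zero (n := k) ?_
    rw [← Matrix.det_pow, hk, Matrix.det_zero]
  -- Cayley–Hamilton: the body has trace and determinant zero. Its exponential is therefore `1` plus
  -- itself, which identifies it with the body of `N - 1`.
  have hsq : φ χ ^ 2 = 0 := by
    rw [sq_eq_trace_sub_det, ← htr, htrace, map_zero, zero_smul, zero_sub,
      hdet0, zero_smul, neg_zero]
  have h1 := map_nexp φ hχ
  rw [he, nexp_of_sq_eq_zero hsq] at h1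
  change φ χ = _
  rw [← hφr, map_sub, h1, map_one, add_sub_cancel_left]

/-- The extension of scalars of a matrix over `P`. -/
def inclMatrix : Matrix (Fin 2) (Fin 2) P →ₐ[ℝ] Matrix (Fin 2) (Fin 2) (PC P) :=
  (incl : P →ₐ[ℝ] PC P).mapMatrix

/-- Existence of the conjugating map `Ω`. -/
lemma exists_equivariant {χ : Matrix (Fin 2) (Fin 2) P} (hχ : IsNilpotent χ)
    (hbody : χ.map (ParameterAlgebra.body (P := P)) = !![0, 1; 0, 0]) :
    ∃ Ω : PHol P, (∀ z : ℍ, bodyForm Ω z = z) ∧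
      ∀ (t : ℝ) (z : ℍ), eval (t +ᵥ z) Ω = mobius (nexp (t • χ)) (eval z Ω) := by
  set X := inclMatrix χ with hX
  have hXn : IsNilpotent X := hχ.map inclMatrix
  have hsm : ∀ c : ℂ, IsNilpotent (c • X) := by
    intro c
    obtain ⟨k, hk⟩ := hXn
    exact ⟨k, by rw [_root_.smul_pow, hk, smul_zero]⟩
  set E : ℍ → Matrix (Fin 2) (Fin 2) (PC P) := fun z => nexp ((z : ℂ) • X) with hE
  let ψ : Matrix (Fin 2) (Fin 2) (PC P) →ₐ[ℂ] Matrix (Fin 2) (Fin 2) ℂ := (bodyC P).mapMatrix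
  have hψX : ψ X = !![0, 1; 0, 0] := by
    ext i j
    have h1 : ψ X i j = ((χ.map (ParameterAlgebra.body (P := P)) i j : ℝ) : ℂ) := bodyC_incl _
    rw [h1, hbody]
    fin_cases i <;> fin_cases j <;> simp
  have hbodyE : ∀ (z : ℍ) i j, bodyC P (E z i j) = (1 + (z : ℂ) • !![0, 1; 0, 0] :
      Matrix (Fin 2) (Fin 2) ℂ) i j := by
    intro z i j
    have h1 : (ψ.restrictScalars ℝ) (E z) = nexp ((ψ.restrictScalars ℝ) ((z : ℂ) • X)) :=
      map_nexp _ (hsm _)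
    have h2 : (ψ.restrictScalars ℝ) ((z : ℂ) • X) = (z : ℂ) • !![0, 1; 0, 0] := by
      rw [← hψX]
      exact map_smul ψ _ _
    rw [h2, nexp_of_sq_eq_zero] at h1
    · exact congrFun (congrFun h1 i) j
    · rw [_root_.smul_pow, pow_two !![(0 : ℂ), 1; 0, 0]]
      ext i j
      fin_cases i <;> fin_cases j <;> simp
  have hd : ∀ z, bodyC P (E z 1 1) = 1 := fun z => by rw [hbodyE]; simp
  have hdu : ∀ z, IsUnit (E z 1 1) := fun z =>
    isUnit_of_bodyC_ne_zero (by rw [hd]; exact one_ne_zero)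
  -- `Ω(z)` is the Möbius image of `0` under `exp(zχ)`. Equivariance is the addition law of the
  -- exponential, and the body is the translate `0 + z`.
  have hrep : IsRepresentable fun z => E z 0 1 * Ring.inverse (E z 1 1) :=
    (isRepresentable_nexp_smul hXn 0 1).mul
      ((isRepresentable_nexp_smul hXn 1 1).inverse hd)
  obtain ⟨Ω, hΩ⟩ := hrep
  replace hΩ : ∀ z, eval z Ω = E z 0 1 * Ring.inverse (E z 1 1) := hΩ
  refine ⟨Ω, fun z => ?_, fun t z => ?_⟩
  · rw [bodyForm, hΩ, map_mul, bodyC_inverse, hd, hbodyE]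
    simp
  · have htχ : IsNilpotent (t • χ) := by
      obtain ⟨k, hk⟩ := hχ
      exact ⟨k, by rw [_root_.smul_pow, hk, smul_zero]⟩
    have hadd : E (t +ᵥ z) = inclMatrix (nexp (t • χ)) * E z := by
      have h1 : inclMatrix (t • χ) = (t : ℂ) • X := by
        rw [map_smul, hX]
        ext i j
        exact (algebraMap_smul ℂ t (inclMatrix χ i j)).symm
      rw [map_nexp _ htχ, h1, hE]
      change nexp (((t +ᵥ z : ℍ) : ℂ) • X) = _
      rw [UpperHalfPlane.coe_vadd, nexp_add_smul hXn]
    have hcol : ∀ i, E (t +ᵥ z) i 1 = incl (nexp (t • χ) i 0) * E z 0 1 +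
        incl (nexp (t • χ) i 1) * E z 1 1 := by
      intro i
      rw [hadd, Matrix.mul_apply, Fin.sum_univ_two]
      rfl
    have hden : ∀ i, E (t +ᵥ z) i 1 = (incl (nexp (t • χ) i 0) *
        (E z 0 1 * Ring.inverse (E z 1 1)) + incl (nexp (t • χ) i 1)) * E z 1 1 := by
      intro i
      rw [hcol, add_mul, mul_assoc, mul_assoc, Ring.inverse_mul_cancel _ (hdu z), mul_one]
    rw [hΩ, hΩ, mobius, hden 0, hden 1, Ring.mul_inverse_rev, mul_assoc,
      Ring.mul_inverse_cancel_left _ _ (hdu z)]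

/-- Existence of the data in the definition of boundedness at a cusp. -/
theorem exists_isCuspDatum {γ : SL(2, P)} {g : SL(2, ℝ)}
    (h : g⁻¹ * bodySL P γ * g = translation) : ∃ χ Ω, IsCuspDatum γ g χ Ω := by
  have hb : ∀ s : SL(2, ℝ), bodySL P (SpecialLinearGroup.map (algebraMap ℝ P) s) = s := by
    intro s
    ext i j
    exact AlgHom.commutes (ParameterAlgebra.body (P := P)) _
  obtain ⟨χ, hχ, htr, hbody, he⟩ := exists_log (P := P)
    (N := SpecialLinearGroup.map (algebraMap ℝ P) g⁻¹ * γ *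
      SpecialLinearGroup.map (algebraMap ℝ P) g) (by rw [map_mul, map_mul, hb, hb, h])
  obtain ⟨Ω, h1, h2⟩ := exists_equivariant hχ hbody
  exact ⟨χ, Ω, h, htr, hbody, he, h1, h2⟩

end CuspDatum

/-! ### Automorphic and cusp forms satisfy the hypotheses of the dimension theorem -/

section Forms

variable {P : Type*} [CommRing P] [Algebra ℝ P] [ParameterAlgebra P] {Υ : Subgroup SL(2, P)}
  {k : ℕ}

lemma coeffMap_slash_eq {J : Ideal (PC P)} {l : PC P →ₗ[ℂ] ℂ}
    (hl : ∀ x ∈ nilIdeal P, ∀ p ∈ J, l (x * p) = 0) {f : PHol P} (hJ : f ∈ coeffIn J)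
    (hf : ∀ γ ∈ Υ, ∀ z, slashAt k γ z f = eval z f) :
    ∀ g ∈ bodyGroup Υ, (coeffMap l f : ℍ → ℂ) ∣[(k : ℤ)] g = (coeffMap l f : ℍ → ℂ) := by
  rintro _ ⟨_, ⟨γ, hγ, rfl⟩, rfl⟩
  ext z
  rw [← apply_slashAt hl hJ, hf γ hγ z, apply_eval]

/-- Makes the growth condition nonvacuous at each classical cusp, so that it can be transferred to
leading coefficients. -/
lemma exists_isCuspDatum_of_isCusp {c : OnePoint ℝ} (hc : IsCusp c (bodyGroup Υ)) :
    ∃ γ ∈ Υ, ∃ g χ Ω, IsCuspDatum γ g χ Ω ∧ SpecialLinearGroup.mapGL ℝ g • OnePoint.infty = c := by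
  obtain ⟨g, ⟨γ, hγ, hγg⟩, hgc⟩ := exists_conj_translation_of_isCusp hc
  obtain ⟨χ, Ω, h⟩ := exists_isCuspDatum (P := P) (γ := γ) (g := g) (by rw [hγg]; group)
  exact ⟨γ, hγ, g, χ, Ω, h, hgc⟩

lemma IsCuspDatum.conj_translation_mem {γ : SL(2, P)} {g : SL(2, ℝ)}
    {χ : Matrix (Fin 2) (Fin 2) P} {Ω : PHol P} (h : IsCuspDatum γ g χ Ω) (hγ : γ ∈ Υ) :
    g * translation * g⁻¹ ∈ Υ.map (bodySL P) :=
  ⟨γ, hγ, by rw [← h.conj_body]; group⟩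

lemma coeffMap_mem_range_of_autForms {J : Ideal (PC P)} {l : PC P →ₗ[ℂ] ℂ}
    (hl : ∀ x ∈ nilIdeal P, ∀ p ∈ J, l (x * p) = 0) {f : PHol P} (hf : f ∈ autForms k Υ)
    (hJ : f ∈ coeffIn J) :
    coeffMap l f ∈ LinearMap.range (modularFormToHol (Υ.map (bodySL P)) k) := by
  refine ⟨⟨⟨coeffMap l f, coeffMap_slash_eq hl hJ hf.1⟩, (coeffMap l f).2, fun {c} hc => ?_⟩, rfl⟩
  obtain ⟨γ, hγ, g, χ, Ω, h, hgc⟩ := exists_isCuspDatum_of_isCusp hc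
  refine (OnePoint.isBoundedAt_iff hgc).mpr ?_
  have h1 := hf.2 γ hγ g χ Ω h l
  simp only [apply_slashSlash hl hJ k g h.bodyForm_eq] at h1
  exact h1

/-- On the ideal generated by a socle element every linear form is a leading form. Testing against
all of them reduces the conditions on `p ⊗ h` to classical ones. -/
lemma linear_of_annihilated {p : PC P} (hp : ∀ x ∈ nilIdeal P, x * p = 0) (l : PC P →ₗ[ℂ] ℂ) :
    ∀ x ∈ nilIdeal P, ∀ q ∈ Ideal.span {p}, l (x * q) = 0 := by
  intro x hx q hq
  obtain ⟨c, rfl⟩ := Ideal.mem_span_singleton'.mp hq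
  rw [mul_left_comm, hp x hx, mul_zero, map_zero]

lemma slashAt_eq_of_annihilated {p : PC P} (hp : ∀ x ∈ nilIdeal P, x * p = 0) {h : Hol}
    (hh : ∀ g ∈ Υ.map (bodySL P),
      (h : ℍ → ℂ) ∣[(k : ℤ)] SpecialLinearGroup.mapGL ℝ g = (h : ℍ → ℂ)) :
    ∀ γ ∈ Υ, ∀ z, slashAt k γ z (p ⊗ₜ[ℂ] h) = eval z (p ⊗ₜ[ℂ] h) := by
  intro γ hγ z
  have hJ : p ⊗ₜ[ℂ] h ∈ coeffIn (Ideal.span {p}) :=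
    tmul_mem_coeffIn (Ideal.mem_span_singleton_self p) h
  rw [← sub_eq_zero, ← Module.forall_dual_apply_eq_zero_iff ℂ]
  intro l
  rw [map_sub, apply_slashAt (linear_of_annihilated hp l) hJ, apply_eval, coeffMap_tmul]
  change (slashHol k (bodySL P γ) (l p • h) : ℍ → ℂ) z - _ = 0
  have h1 : slashHol k (bodySL P γ) h = h := Subtype.ext (hh _ (Subgroup.mem_map_of_mem _ hγ))
  rw [map_smul, h1, sub_self]

lemma tmul_mem_autForms {p : PC P} (hp : ∀ x ∈ nilIdeal P, x * p = 0)
    (h : ModularForm (bodyGroup Υ) k) :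
    p ⊗ₜ[ℂ] modularFormToHol (Υ.map (bodySL P)) k h ∈ autForms k Υ := by
  refine ⟨slashAt_eq_of_annihilated hp fun g hg => ?_, fun γ hγ g χ Ω hd l => ?_⟩
  · exact h.slash_action_eq' _ (Subgroup.mem_map_of_mem _ hg)
  · simp only [apply_slashSlash (linear_of_annihilated hp l)
      (tmul_mem_coeffIn (Ideal.mem_span_singleton_self p) _) k g hd.bodyForm_eq]
    rw [coeffMap_tmul, ← map_smul]
    exact (l p • h).bdd_at_cusps' (isCusp_of_conj_translation_mem (hd.conj_translation_mem hγ))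
      _ rfl

/-- A cusp form as a holomorphic function. -/
def cuspFormToHol (Γ : Subgroup SL(2, ℝ)) (k : ℕ) :
    CuspForm (Γ.map (SpecialLinearGroup.mapGL ℝ)) k →ₗ[ℂ] Hol where
  toFun f := ⟨f, f.holo'⟩
  map_add' _ _ := rfl
  map_smul' _ _ := rfl

lemma coeffMap_mem_range_of_cuspForms {J : Ideal (PC P)} {l : PC P →ₗ[ℂ] ℂ}
    (hl : ∀ x ∈ nilIdeal P, ∀ p ∈ J, l (x * p) = 0) {f : PHol P} (hf : f ∈ cuspForms k Υ)
    (hJ : f ∈ coeffIn J) :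
    coeffMap l f ∈ LinearMap.range (cuspFormToHol (Υ.map (bodySL P)) k) := by
  refine ⟨⟨⟨coeffMap l f, coeffMap_slash_eq hl hJ hf.1⟩, (coeffMap l f).2, fun {c} hc => ?_⟩, rfl⟩
  obtain ⟨γ, hγ, g, χ, Ω, h, hgc⟩ := exists_isCuspDatum_of_isCusp hc
  refine (OnePoint.isZeroAt_iff hgc).mpr ?_
  have h1 := hf.2 γ hγ g χ Ω h l
  simp only [apply_slashSlash hl hJ k g h.bodyForm_eq] at h1
  exact h1

lemma tmul_mem_cuspForms {p : PC P} (hp : ∀ x ∈ nilIdeal P, x * p = 0)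
    (h : CuspForm (bodyGroup Υ) k) :
    p ⊗ₜ[ℂ] cuspFormToHol (Υ.map (bodySL P)) k h ∈ cuspForms k Υ := by
  refine ⟨slashAt_eq_of_annihilated hp fun g hg => ?_, fun γ hγ g χ Ω hd l => ?_⟩
  · exact h.slash_action_eq' _ (Subgroup.mem_map_of_mem _ hg)
  · simp only [apply_slashSlash (linear_of_annihilated hp l)
      (tmul_mem_coeffIn (Ideal.mem_span_singleton_self p) _) k g hd.bodyForm_eq]
    rw [coeffMap_tmul, ← map_smul]
    exact (l p • h).zero_at_cusps' (isCusp_of_conj_translation_mem (hd.conj_translation_mem hγ))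
      _ rfl

end Forms

end PLattice

end

open PLattice

theorem mainTheorem5 {P : Type*} [CommRing P] [Algebra ℝ P] [ParameterAlgebra P]
    (Υ : Subgroup SL(2, P)) (hΥ : IsPLattice Υ) (k : ℕ) :
    (Module.Finite ℂ (ModularForm (bodyGroup Υ) k) ∧ Module.Finite ℂ (autForms k Υ) ∧
      Module.finrank ℂ (ModularForm (bodyGroup Υ) k) ≤ Module.finrank ℂ (autForms k Υ) ∧
      Module.finrank ℂ (autForms k Υ) ≤
        Module.finrank ℂ (ModularForm (bodyGroup Υ) k) * Module.finrank ℝ P ∧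
      [Module.finrank ℂ (autForms k Υ) =
          Module.finrank ℂ (ModularForm (bodyGroup Υ) k) * Module.finrank ℝ P,
        ∃ (r : ℕ) (f : Fin r → autForms k Υ)
          (b : Module.Basis (Fin r) ℂ (ModularForm (bodyGroup Υ) k)),
          ∀ i z, b i z = bodyForm (f i : PHol P) z,
        Module.Free (PC P) (autForms k Υ) ∧
          Module.rank (PC P) (autForms k Υ) =
            Module.finrank ℂ (ModularForm (bodyGroup Υ) k)].TFAE ∧
      ∀ (r : ℕ) (f : Fin r → autForms k Υ)
        (b : Module.Basis (Fin r) ℂ (ModularForm (bodyGroup Υ) k)),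
        (∀ i z, b i z = bodyForm (f i : PHol P) z) →
          LinearIndependent (PC P) f ∧ Submodule.span (PC P) (Set.range f) = ⊤) ∧
    (Module.Finite ℂ (CuspForm (bodyGroup Υ) k) ∧ Module.Finite ℂ (cuspForms k Υ) ∧
      Module.finrank ℂ (CuspForm (bodyGroup Υ) k) ≤ Module.finrank ℂ (cuspForms k Υ) ∧
      Module.finrank ℂ (cuspForms k Υ) ≤
        Module.finrank ℂ (CuspForm (bodyGroup Υ) k) * Module.finrank ℝ P ∧
      [Module.finrank ℂ (cuspForms k Υ) =
          Module.finrank ℂ (CuspForm (bodyGroup Υ) k) * Module.finrank ℝ P,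
        ∃ (r : ℕ) (f : Fin r → cuspForms k Υ)
          (b : Module.Basis (Fin r) ℂ (CuspForm (bodyGroup Υ) k)),
          ∀ i z, b i z = bodyForm (f i : PHol P) z,
        Module.Free (PC P) (cuspForms k Υ) ∧
          Module.rank (PC P) (cuspForms k Υ) =
            Module.finrank ℂ (CuspForm (bodyGroup Υ) k)].TFAE ∧
      ∀ (r : ℕ) (f : Fin r → cuspForms k Υ)
        (b : Module.Basis (Fin r) ℂ (CuspForm (bodyGroup Υ) k)),
        (∀ i z, b i z = bodyForm (f i : PHol P) z) →
          LinearIndependent (PC P) f ∧ Submodule.span (PC P) (Set.range f) = ⊤) := by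
  have := finite_modularForm hΥ.1 k
  have := finite_cuspForm hΥ.1 k
  refine ⟨?_, ?_⟩
  · exact dimension_theorem (ι := modularFormToHol (Υ.map (bodySL P)) k)
      (fun f g hfg => DFunLike.coe_injective (congrArg Subtype.val hfg)) (autForms k Υ)
      (fun _ _ hl _ hf hJ => coeffMap_mem_range_of_autForms hl hf hJ)
      (fun _ hp h => tmul_mem_autForms hp h)
  · exact dimension_theorem (ι := cuspFormToHol (Υ.map (bodySL P)) k)
      (fun f g hfg => DFunLike.coe_injective (congrArg Subtype.val hfg)) (cuspForms k Υ)
      (fun _ _ hl _ hf hJ => coeffMap_mem_range_of_cuspForms hl hf hJ)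
      (fun _ hp h => tmul_mem_cuspForms hp h)
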